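/- **Setting.** A data set is a finite multiset of elements $e=(e.\mathrm{key},e.\mathrm{val})$ with real values; $\nu_x$ is the sum of the values of the elements with key $x$. Keys come from any totally ordered set (e.g. strings), and $\mathrm{KeyHash}$ maps the keys that occur injectively to $[n]=\{1,\dots,n\}$, $n\ge 2$. Let $0<p\le 2$, $k\ge 1$, let $r_x\sim\mathrm{Exp}[1]$ be independent over keys $x$, and $\nu^*_x=\nu_x/r_x^{1/p}$. The $p$-ppswor sample of size $k$ according to $\nu$ consists of the $k$ keys with largest $|\nu^*_x|$ (all keys, if there are fewer), with their frequencies $\nu_x$, and the threshold $\tau$, the $(k+1)$-st largest $|\nu^*_x|$. **Method (two-pass WORp).** Pass I feeds the elements $(\mathrm{KeyHash}(e.\mathrm{key}),\,e.\mathrm{val}/r_{e.\mathrm{key}}^{1/p})$ to a composable sketch $R$ for $(k+1,\psi)$ residual heavy hitters. Pass II uses a composable structure $T$ that collects the exact frequencies of the $Bk$ keys with the largest estimates $|R.\mathrm{Est}(\mathrm{KeyHash}(x))|$. The method returns the $k$ keys $x$ of $T$ with largest $|\nu^*_x|$, their $\nu_x$, and the $(k+1)$-st largest $|\nu^*_x|$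 over $T$. In both passes the data may be processed and merged along any binary aggregation tree, fixed in advance. $R$ is one of: * CountSketch (values of any sign), with $\lceil A_2\log(n/\delta)\rceil$ rows of $\lceil A_1(k+1)/\psi\rceil$ counters, median estimates, independent rows, and in each row a bucket hash and a sign hash that are independent of each other, each uniform and pairwise independent; all these hashes are independent of $(r_x)$; * Counters (positive values), the mergeable Misra–Gries summary with at most $\lceil A_1(k+1)/\psi\rceil$ counters. The sketch size is the number of memory words of $R$ and $T$ together (hash functions are not counted), with the number of key strings stored in $T$ counted separately. **Theorem.** There are universal constants $A_1,A_2>0$ and $B\ge 1$ such that the following holds. 1. (Signed data.) For every $p\in(0,2]$ there are $\psi=\psi_p(n,k)>0$ such that for every $c>0$ there is a constant $C=C(p,c)$ for which, for all $n\ge 2$, $k\ge 1$, two-pass WORp with CountSketch and $\delta=n^{-c}$ has sketch size at most $Ck\log n$ words if $p<2$ and at most $Ck\log^2 n$ words if $p=2$, and stores at most $Ck$ key strings; and it returns the exact $p$-ppswor sample of size $k$ with probability at least $(1-n^{-c})(1-3e^{-k})$. 2. (Positive data.) For every $p\in(0,1]$ there are $\psi=\psi_p(n,k)>0$ and a constant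 $C=C(p)$ such that, for all $n\ge 2$, $k\ge 1$, two-pass WORp with Counters has sketch size at most $Ck$ words if $p<1$ and at most $Ck\log n$ words if $p=1$, and stores at most $Ck$ key strings; and it returns the exact $p$-ppswor sample of size $k$ with probability at least $1-3e^{-k}$. The size bounds hold for the sketches at every node of every aggregation tree. Both probability bounds hold for every data set and all aggregation trees, and they also hold conditioned on the top $k$ keys by $|\nu^*|$, in order, being any particular $k$-tuple (for which this event has positive probability). -/

import Mathlib

open MeasureTheory ProbabilityTheory
open scoped NNReal

noncomputable section

namespace WORp

open scoped Classical in
/-- `rank s f x` is the number of keys of `s` that come before `x` when the keys are listed by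
decreasing value of `f`, ties being broken by the linear order of the keys. -/
def rank {κ : Type*} [LinearOrder κ] (s : Finset κ) (f : κ → ℝ≥0) (x : κ) : ℕ :=
  (s.filter fun y => f x < f y ∨ (f y = f x ∧ y < x)).card

/-- The `m` keys of `s` with largest `f` (all of `s` if `s` has at most `m` keys). -/
def topKeys {κ : Type*} [LinearOrder κ] (m : ℕ) (s : Finset κ) (f : κ → ℝ≥0) : Finset κ :=
  s.filter fun x => rank s f x < m

/-- The `(m+1)`-st largest value of `f` on `s` (and `0` if `s` has at most `m` keys). -/
def nextLargest {κ : Type*} [LinearOrder κ] (m : ℕ) (s : Finset κ) (f : κ → ℝ≥0) : ℝ≥0 :=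
  (s \ topKeys m s f).sup f

/-! ### Data sets, and their distributed aggregation -/

/-- A data element: a key together with a value. -/
structure DataElement (κ : Type*) where
  key : κ
  val : ℝ

/-- The frequency of the key `x`: the sum of the values of the elements with key `x`. -/
def freq {κ : Type*} [DecidableEq κ] (D : Multiset (DataElement κ)) (x : κ) : ℝ :=
  ((D.filter fun e => e.key = x).map DataElement.val).sum

/-- The keys that occur in a data set. -/
def keys {κ : Type*} [DecidableEq κ] (D : Multiset (DataElement κ)) : Finset κ :=
  (D.map DataElement.key).toFinset

/-- A way of aggregating a data set with a composable sketch: start from empty sketches, feed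
single elements to sketches, and merge sketches, in any order and along any binary tree. -/
inductive Aggregation (κ : Type*) where
  | empty : Aggregation κ
  | process (a : Aggregation κ) (e : DataElement κ) : Aggregation κ
  | merge (a b : Aggregation κ) : Aggregation κ

/-- The data set that is aggregated. -/
def Aggregation.dataset {κ : Type*} : Aggregation κ → Multiset (DataElement κ)
  | .empty => 0
  | .process a e => e ::ₘ a.dataset
  | .merge a b => a.dataset + b.dataset

/-- Replace every element by its image under `g`, locally. -/
def Aggregation.map {κ κ' : Type*} (g : DataElement κ → DataElement κ') :
    Aggregation κ → Aggregation κ'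
  | .empty => .empty
  | .process a e => .process (a.map g) (g e)
  | .merge a b => .merge (a.map g) (b.map g)

/-- A composable sketch of elements with keys in `κ`, with states in `σ`. -/
structure ComposableSketch (κ σ : Type*) where
  empty : σ
  process : σ → DataElement κ → σ
  merge : σ → σ → σ

/-- The sketch that an aggregation produces. -/
def ComposableSketch.run {κ σ : Type*} (S : ComposableSketch κ σ) : Aggregation κ → σ
  | .empty => S.empty
  | .process a e => S.process (S.run a) e
  | .merge a b => S.merge (S.run a) (S.run b)

/-- A composable sketch of elements with keys in `Fin n` that also returns frequency estimates;
`words` is the number of memory words that a state occupies. -/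
structure FrequencySketch (n : ℕ) (σ : Type*) extends ComposableSketch (Fin n) σ where
  est : σ → Fin n → ℝ
  words : σ → ℕ

/-! ### CountSketch -/

/-- The median of `d` numbers: the entry of index `d / 2` (from `0`) in increasing order. -/
def median {d : ℕ} (f : Fin d → ℝ) : ℝ :=
  if hd : 0 < d then f (Tuple.sort f ⟨d / 2, Nat.div_lt_self hd one_lt_two⟩) else 0

/-- The number `1` or `-1` that is encoded by a bit. -/
def sgn (b : Bool) : ℝ := if b then 1 else -1

/-- `CountSketch` with `d` rows of `w` counters, bucket hashes `h i : Fin n → Fin w` and sign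
hashes `s i : Fin n → {1, -1}`. An element `(x, v)` adds `s i x * v` to the counter `h i x` of every
row `i`; sketches are merged by adding the tables; the estimate for `x` is the median over the
rows `i` of `s i x` times the counter `h i x`. -/
def countSketch {n : ℕ} (d w : ℕ) (h : Fin d → Fin n → Fin w) (s : Fin d → Fin n → Bool) :
    FrequencySketch n (Fin d → Fin w → ℝ) where
  empty := fun _ _ => 0
  process := fun T e i b => T i b + if h i e.key = b then sgn (s i e.key) * e.val else 0
  merge := fun T T' i b => T i b + T' i b
  est := fun T x => median fun i => sgn (s i x) * T i (h i x)
  words := fun _ => d * w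

/-- The random hashes of `CountSketch`: in every row the bucket hash and the sign hash are uniform
and pairwise independent, and independent of each other; the rows are independent. -/
structure IsCountSketchHash {Ω : Type*} [MeasurableSpace Ω] (P : Measure Ω) {n d w : ℕ}
    (h : Fin d → Fin n → Ω → Fin w) (s : Fin d → Fin n → Ω → Bool) : Prop where
  measurable_h : ∀ i x, Measurable (h i x)
  measurable_s : ∀ i x, Measurable (s i x)
  uniform_h : ∀ i x b, P.real {ω | h i x ω = b} = 1 / (w : ℝ)
  uniform_s : ∀ i x b, P.real {ω | s i x ω = b} = 1 / 2
  pairwise_h : ∀ i x y, x ≠ y → IndepFun (h i x) (h i y) P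
  pairwise_s : ∀ i x y, x ≠ y → IndepFun (s i x) (s i y) P
  indep_h_s : ∀ i, IndepFun (fun ω x => h i x ω) (fun ω x => s i x ω) P
  indep_rows : iIndepFun (fun i ω => ((fun x => h i x ω), (fun x => s i x ω))) P

/-! ### Counters -/

/-- Subtract the `(m+1)`-st largest counter from all counters, and drop those that do not stay
positive (subtraction in `ℝ≥0` is truncated at `0`). -/
def reduceCounters {n : ℕ} (m : ℕ) (c : Fin n → ℝ≥0) : Fin n → ℝ≥0 :=
  fun x => c x - nextLargest m Finset.univ c

/-- The deterministic counter-based sketch (Misra-Gries) for elements of positive value, with at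
most `m` stored counters. An element adds its value to the counter of its key, merging adds the
counters, and then the `(m+1)`-st largest counter is subtracted from all. A key that has no counter
is represented by the value `0`. A stored counter takes two words: the key and the count. -/
def counters (n m : ℕ) : FrequencySketch n (Fin n → ℝ≥0) where
  empty := fun _ => 0
  process := fun c e =>
    reduceCounters m fun x => c x + if e.key = x then e.val.toNNReal else 0
  merge := fun c c' => reduceCounters m fun x => c x + c' x
  est := fun c x => (c x : ℝ)
  words := fun c => 2 * (Finset.univ.filter fun x => c x ≠ 0).card

/-! ### The structure of the second pass -/

/-- Stored keys, with the total value collected for each of them (nothing for other keys). -/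
structure TopState (κ : Type*) where
  keys : Finset κ
  val : κ → ℝ
  val_eq_zero : ∀ x, x ∉ keys → val x = 0

/-- Keep the `m` keys of highest priority, and eject the others with their values. -/
def retain {κ : Type*} [LinearOrder κ] (m : ℕ) (prio : κ → ℝ≥0) (s : Finset κ) (v : κ → ℝ) :
    TopState κ where
  keys := topKeys m s prio
  val := fun x => if x ∈ topKeys m s prio then v x else 0
  val_eq_zero := fun _ hx => if_neg hx

/-- The composable top-`m` structure: it collects the total values of the `m` keys of highest
priority. -/
def topSketch {κ : Type*} [LinearOrder κ] (m : ℕ) (prio : κ → ℝ≥0) :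
    ComposableSketch κ (TopState κ) where
  empty := ⟨∅, fun _ => 0, fun _ _ => rfl⟩
  process := fun T e =>
    retain m prio (insert e.key T.keys) fun x => T.val x + if e.key = x then e.val else 0
  merge := fun T T' => retain m prio (T.keys ∪ T'.keys) fun x => T.val x + T'.val x

/-- The memory words of the top structure: a value and a priority for each stored key (the key
strings themselves are counted separately). -/
def TopState.words {κ : Type*} (T : TopState κ) : ℕ := 2 * T.keys.card

/-! ### The two-pass method -/

/-- The element that is generated from `e`:
`(keyHash(e.key), e.val / r_{e.key}^(1/p))`. -/
def outputElement {κ : Type*} {n : ℕ} (p : ℝ) (keyHash : κ → Fin n) (r : κ → ℝ)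
    (e : DataElement κ) : DataElement (Fin n) :=
  ⟨keyHash e.key, e.val / r e.key ^ (1 / p)⟩

/-- The state of the frequency sketch `R` after a first pass along `a₁`. -/
def passOne {κ σ : Type*} {n : ℕ} (R : FrequencySketch n σ) (p : ℝ) (keyHash : κ → Fin n)
    (r : κ → ℝ) (a₁ : Aggregation κ) : σ :=
  R.run (a₁.map (outputElement p keyHash r))

/-- The state of the top-`m` structure after a first pass along `a₁` and a second pass along `a₂`:
the priority of a key is the magnitude of its estimate from the first pass. -/
def passTwo {κ σ : Type*} [LinearOrder κ] {n : ℕ} (R : FrequencySketch n σ) (p : ℝ) (m : ℕ)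
    (keyHash : κ → Fin n) (r : κ → ℝ) (a₁ a₂ : Aggregation κ) : TopState κ :=
  (topSketch m fun x => ‖R.est (passOne R p keyHash r a₁) (keyHash x)‖₊).run a₂

/-- The transformed frequency `v_x / r_x^(1/p)`, in magnitude. -/
def transformed {κ : Type*} (p : ℝ) (r : κ → ℝ) (v : κ → ℝ) (x : κ) : ℝ≥0 :=
  ‖v x / r x ^ (1 / p)‖₊

/-- A sample: the sampled keys, each with its reported frequency, and a threshold. -/
structure Sample (κ : Type*) where
  keys : Finset κ
  val : κ → ℝ
  threshold : ℝ≥0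

/-- The sample that the two-pass method returns: the `k` stored keys of largest transformed
frequency with the values collected for them, and the `(k+1)`-st largest transformed frequency of
a stored key. -/
def twoPassSample {κ σ : Type*} [LinearOrder κ] {n : ℕ} (R : FrequencySketch n σ) (p : ℝ)
    (k m : ℕ) (keyHash : κ → Fin n) (r : κ → ℝ) (a₁ a₂ : Aggregation κ) : Sample κ :=
  let T := passTwo R p m keyHash r a₁ a₂
  { keys := topKeys k T.keys (transformed p r T.val)
    val := T.val
    threshold := nextLargest k T.keys (transformed p r T.val) }

/-- The words that the sketches occupy together during the two passes. -/
def twoPassWords {κ σ : Type*} [LinearOrder κ] {n : ℕ} (R : FrequencySketch n σ) (p : ℝ)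
    (m : ℕ) (keyHash : κ → Fin n) (r : κ → ℝ) (a₁ a₂ : Aggregation κ) : ℕ :=
  R.words (passOne R p keyHash r a₁) + (passTwo R p m keyHash r a₁ a₂).words

/-- The number of key strings that are stored. -/
def twoPassKeyStrings {κ σ : Type*} [LinearOrder κ] {n : ℕ} (R : FrequencySketch n σ) (p : ℝ)
    (m : ℕ) (keyHash : κ → Fin n) (r : κ → ℝ) (a₁ a₂ : Aggregation κ) : ℕ :=
  (passTwo R p m keyHash r a₁ a₂).keys.card

/-! ### The exact sample -/

/-- `S` is the exact bottom-`k` sample of the data set `D` for the randomization `r`: its keys are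
`k` keys of `D` (all keys, if there are fewer) of largest transformed frequency, reported with
their exact frequencies, and its threshold is the largest transformed frequency of the remaining
keys, that is, the `(k+1)`-st largest overall. If the `r x` are independent `Exp[1]` variables,
this is the `p`-ppswor sample. -/
structure IsExactSample {κ : Type*} [LinearOrder κ] (p : ℝ) (k : ℕ) (r : κ → ℝ)
    (D : Multiset (DataElement κ)) (S : Sample κ) : Prop where
  subset : S.keys ⊆ keys D
  card : S.keys.card = min k (keys D).card
  top : ∀ x ∈ S.keys, ∀ y ∈ keys D, y ∉ S.keys →
    transformed p r (freq D) y ≤ transformed p r (freq D) x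
  val : ∀ x ∈ S.keys, S.val x = freq D x
  threshold : S.threshold = (keys D \ S.keys).sup (transformed p r (freq D))

/-- The keys `t 0, t 1, …, t (k-1)`, in this order, are the top `k` keys of `D` by transformed
frequency. -/
structure IsTopTuple {κ : Type*} [LinearOrder κ] (p : ℝ) {k : ℕ} (r : κ → ℝ)
    (D : Multiset (DataElement κ)) (t : Fin k → κ) : Prop where
  injective : Function.Injective t
  mem : ∀ i, t i ∈ keys D
  antitone : Antitone fun i => transformed p r (freq D) (t i)
  top : ∀ y ∈ keys D, y ∉ Set.range t → ∀ i,
    transformed p r (freq D) y ≤ transformed p r (freq D) (t i)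

/-- `r` assigns independent `Exp[1]` variables to the keys. -/
structure IsExpHash {Ω κ : Type*} [MeasurableSpace Ω] (P : Measure Ω) (r : κ → Ω → ℝ) : Prop where
  measurable : ∀ x, Measurable (r x)
  law : ∀ x, P.map (r x) = expMeasure 1
  indep : iIndepFun r P

/-- The success probability is at least `β`, also conditioned on any particular `k`-tuple of
(ordered) top `k` keys. Here `R ω` is the frequency sketch with its randomization. -/
def SucceedsWithProb {Ω κ σ : Type*} [MeasurableSpace Ω] [LinearOrder κ] {n : ℕ} (P : Measure Ω)
    (β : ℝ) (R : Ω → FrequencySketch n σ) (p : ℝ) (k m : ℕ) (keyHash : κ → Fin n)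
    (r : κ → Ω → ℝ) (D : Multiset (DataElement κ)) (a₁ a₂ : Aggregation κ) : Prop :=
  let success : Set Ω :=
    {ω | IsExactSample p k (fun x => r x ω) D
      (twoPassSample (R ω) p k m keyHash (fun x => r x ω) a₁ a₂)}
  β ≤ P.real success ∧
    ∀ t : Fin k → κ, P {ω | IsTopTuple p (fun x => r x ω) D t} ≠ 0 →
      β ≤ (P[|{ω | IsTopTuple p (fun x => r x ω) D t}]).real success

/-- The dimensions of a sketch for `(k, ψ)` residual heavy hitters: `⌈A k / ψ⌉` counters per row. -/
def sketchWidth (A : ℝ) (k : ℕ) (ψ : ℝ) : ℕ := ⌈A * k / ψ⌉₊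

/-- The number of rows of `CountSketch` for error probability `δ`: `⌈A log (n / δ)⌉`. -/
def sketchDepth (A : ℝ) (n : ℕ) (δ : ℝ) : ℕ := ⌈A * Real.log (n / δ)⌉₊

end WORp

end

/-! Write f for the transformed frequency, and let q = 2 for CountSketch and q = 1 for Counters. The
proof looks for a level ε such that more than k keys have f > 3ε (or ε = 0), fewer than 600k keys
have f > ε, and the remaining keys satisfy ∑ f^q ≤ L ε^q, where L is of order k if p < q and of
order k log n if p = q. This is the event `concentrated`.

On this event a sketch whose width is a large multiple of k + L errs by at most ε: the keys above ε
play the role of the heavy keys, and the others form the residual (`abs_counters_est_sub_le` for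
Counters; `IsCountSketchHash.failure_le`, with high probability over the hashes, for CountSketch).
An error of ε suffices for exactness (`isExactSample_twoPassSample`): a key with f > 3ε is estimated
above 2ε, so only keys with f > ε can outrank it, and these are fewer than 600k. Hence the second
pass collects every key above 3ε, in particular the k + 1 keys that determine the sample.

It remains to bound the probability of the event, given the ordered top k keys. With weights w_x =
|ν_x|^p, the order by decreasing f is the order by increasing r_x / w_x. Let s be the largest of
these ratios among the top k keys, and W the total weight of the other keys. The other keys satisfy
r_x ≥ s w_x, and since the exponential law is memoryless, the excesses r_x - s w_x are again
independent `Exp[1]` variables, while the top k variables receive the extra weight exp(-sW)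
(`prod_pi_expMeasure_one_shift`). Put M = 16k/W and ε = M^(-1/p)/4. The ratio s exceeds M/2 with
small probability, by comparing the top k variables with their halves (`lintegral_tail_le`), so no
explicit law of s is needed. The smallest excess ratio has an exponential tail, and the number of
medium keys and the residual moment obey Chernoff bounds. Altogether the conditional failure
probability is at most 3e^(-k) (`conditional_failure_le`). The logarithm for p = q comes from the
mean of min(1, a/r), which is of order a log n up to a negligible tail.

The level ε depends on the top tuple only, and the hashes are independent of r. So r can be frozen
while the sketch is analysed (`measure_le_of_indepFun`), and the failure probabilities multiply. The
unconditional bound is the sum over all top tuples, which are almost surely unique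
(`succeedsWithProb_of_concentrated`). If at most k keys have non-zero frequency, ε = 0 works almost
surely. -/

namespace WORp

/-! ### Ranks and top keys -/

section TopKeys

variable {κ : Type*} [LinearOrder κ] {s t : Finset κ} {f g : κ → ℝ≥0} {x y : κ} {m : ℕ}

theorem rank_mono (h : s ⊆ t) (f : κ → ℝ≥0) (x : κ) : rank s f x ≤ rank t f x := by
  classical
  unfold rank
  exact Finset.card_le_card (Finset.filter_subset_filter _ h)

theorem rank_congr (h : ∀ y ∈ s, f y = g y) (hx : x ∈ s) : rank s f x = rank s g x := by
  classical
  unfold rank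
  congr 1
  refine Finset.filter_congr fun y hy => ?_
  rw [h y hy, h x hx]

theorem rank_lt_rank (hx : x ∈ s) (hxy : f y < f x ∨ (f x = f y ∧ x < y)) :
    rank s f x < rank s f y := by
  classical
  unfold rank
  refine Finset.card_lt_card ⟨fun z hz => ?_, fun h => ?_⟩
  · simp only [Finset.mem_filter] at hz ⊢
    refine ⟨hz.1, ?_⟩
    rcases hz.2 with h1 | ⟨h1, h1'⟩ <;> rcases hxy with h2 | ⟨h2, h2'⟩
    · exact .inl (h2.trans h1)
    · exact .inl (h2 ▸ h1)
    · exact .inl (h1 ▸ h2)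
    · exact .inr ⟨h1.trans h2, h1'.trans h2'⟩
  · have : x ∈ s.filter fun z => f x < f z ∨ (f z = f x ∧ z < x) :=
      h (by simpa using ⟨hx, hxy⟩)
    simp at this

theorem rank_injOn (s : Finset κ) (f : κ → ℝ≥0) : Set.InjOn (rank s f) s := by
  intro x hx y hy h
  by_contra hne
  rcases lt_trichotomy (f x) (f y) with h1 | h1 | h1
  · exact absurd h (rank_lt_rank hy (.inl h1)).ne'
  · rcases lt_or_gt_of_ne hne with h2 | h2
    · exact absurd h (rank_lt_rank hx (.inr ⟨h1, h2⟩)).ne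
    · exact absurd h (rank_lt_rank hy (.inr ⟨h1.symm, h2⟩)).ne'
  · exact absurd h (rank_lt_rank hx (.inl h1)).ne

theorem rank_lt_card (hx : x ∈ s) : rank s f x < s.card := by
  classical
  unfold rank
  refine Finset.card_lt_card ⟨Finset.filter_subset _ _, fun h => ?_⟩
  simpa using h hx

theorem le_of_rank_le (hx : x ∈ s) (h : rank s f y ≤ rank s f x) : f x ≤ f y := by
  by_contra hlt
  exact absurd h (rank_lt_rank hx (.inl (not_le.1 hlt))).not_ge

theorem mem_topKeys : x ∈ topKeys m s f ↔ x ∈ s ∧ rank s f x < m := by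
  unfold topKeys; simp

theorem topKeys_subset (m : ℕ) (s : Finset κ) (f : κ → ℝ≥0) : topKeys m s f ⊆ s :=
  fun _ h => (mem_topKeys.1 h).1

theorem topKeys_congr (h : ∀ y ∈ s, f y = g y) : topKeys m s f = topKeys m s g := by
  ext x
  simp only [mem_topKeys]
  exact and_congr_right fun hx => by rw [rank_congr h hx]

theorem nextLargest_congr (h : ∀ y ∈ s, f y = g y) : nextLargest m s f = nextLargest m s g := by
  unfold nextLargest
  rw [topKeys_congr h]
  exact Finset.sup_congr rfl fun y hy => h y (Finset.mem_sdiff.1 hy).1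

/-- Ranks are injective on `s` and smaller than `s.card`, so they fill `range s.card`; the top keys
are the preimage of an initial segment. -/
theorem card_topKeys (m : ℕ) (s : Finset κ) (f : κ → ℝ≥0) :
    (topKeys m s f).card = min m s.card := by
  classical
  have h1 : s.image (rank s f) = Finset.range s.card := by
    refine Finset.eq_of_subset_of_card_le (fun i hi => ?_) ?_
    · obtain ⟨x, hx, rfl⟩ := Finset.mem_image.1 hi
      exact Finset.mem_range.2 (rank_lt_card hx)
    · rw [Finset.card_image_of_injOn (rank_injOn s f), Finset.card_range]
  have h2 : (topKeys m s f).image (rank s f) = Finset.range (min m s.card) := by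
    ext i
    have := congrArg (i ∈ ·) h1
    simp only [Finset.mem_image, Finset.mem_range, eq_iff_iff] at this
    simp only [Finset.mem_image, Finset.mem_range, mem_topKeys, lt_min_iff, ← this]
    constructor
    · rintro ⟨x, ⟨hx, hm⟩, rfl⟩; exact ⟨hm, x, hx, rfl⟩
    · rintro ⟨hm, x, hx, rfl⟩; exact ⟨x, ⟨hx, hm⟩, rfl⟩
  rw [← Finset.card_range (min m s.card), ← h2, Finset.card_image_of_injOn]
  exact (rank_injOn s f).mono (topKeys_subset m s f)

theorem card_topKeys_le (m : ℕ) (s : Finset κ) (f : κ → ℝ≥0) : (topKeys m s f).card ≤ m :=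
  (card_topKeys m s f).trans_le (min_le_left _ _)

theorem card_topKeys_of_notMem (hx : x ∈ s) (hm : x ∉ topKeys m s f) :
    (topKeys m s f).card = m := by
  have h : m ≤ rank s f x := by
    by_contra h; exact hm (mem_topKeys.2 ⟨hx, not_le.1 h⟩)
  rw [card_topKeys, min_eq_left (h.trans (rank_lt_card hx).le)]

theorem le_of_mem_topKeys_of_notMem (hx : x ∈ s) (hxm : x ∉ topKeys m s f)
    (hy : y ∈ topKeys m s f) : f x ≤ f y := by
  have h : m ≤ rank s f x := by
    by_contra h; exact hxm (mem_topKeys.2 ⟨hx, not_le.1 h⟩)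
  exact le_of_rank_le hx ((mem_topKeys.1 hy).2.le.trans h)

/-- Passing to a subset only lowers ranks, so the top keys of `s` stay on top in `t`, and counting
excludes any further ones. Hence early ejections in the second pass do no harm. -/
theorem topKeys_eq_of_subset (hts : t ⊆ s) (h : topKeys m s f ⊆ t) :
    topKeys m t f = topKeys m s f := by
  classical
  refine (Finset.eq_of_subset_of_card_le (fun x hx => ?_) ?_).symm
  · exact mem_topKeys.2 ⟨h hx, (rank_mono hts f x).trans_lt (mem_topKeys.1 hx).2⟩
  · rw [card_topKeys, card_topKeys]
    exact min_le_min_left _ (Finset.card_le_card hts)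

/-- A key that is dominated by more than `k` keys of `t` is dominated by a key of `t` that is not
among the top `k`. -/
theorem exists_mem_sdiff_topKeys {k : ℕ} (hx : k + 1 ≤ (t.filter fun y => f x ≤ f y).card) :
    ∃ z ∈ t \ topKeys k t f, f x ≤ f z := by
  have : (topKeys k t f).card < (t.filter fun y => f x ≤ f y).card :=
    (Nat.lt_succ_of_le (card_topKeys_le k t f)).trans_le hx
  obtain ⟨z, hz, hz'⟩ := Finset.exists_mem_notMem_of_card_lt_card this
  rw [Finset.mem_filter] at hz
  exact ⟨z, Finset.mem_sdiff.2 ⟨hz.1, hz'⟩, hz.2⟩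

end TopKeys

/-! ### Frequencies and keys of a data set -/

section DataSets

variable {κ : Type*}

@[simp] theorem freq_zero [DecidableEq κ] (x : κ) : freq (0 : Multiset (DataElement κ)) x = 0 := by
  simp [freq]

theorem freq_cons [DecidableEq κ] (e : DataElement κ) (D : Multiset (DataElement κ)) (x : κ) :
    freq (e ::ₘ D) x = freq D x + if e.key = x then e.val else 0 := by
  unfold freq
  split_ifs with h
  · rw [Multiset.filter_cons_of_pos (p := fun e : DataElement κ => e.key = x) _ h]; simp [add_comm]
  · rw [Multiset.filter_cons_of_neg (p := fun e : DataElement κ => e.key = x) _ h]; simp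

theorem freq_add [DecidableEq κ] (D D' : Multiset (DataElement κ)) (x : κ) :
    freq (D + D') x = freq D x + freq D' x := by
  simp [freq]

@[simp] theorem keys_zero [DecidableEq κ] : keys (0 : Multiset (DataElement κ)) = ∅ := by
  simp [keys]

theorem keys_cons [DecidableEq κ] (e : DataElement κ) (D : Multiset (DataElement κ)) :
    keys (e ::ₘ D) = insert e.key (keys D) := by
  simp [keys]

theorem keys_add [DecidableEq κ] (D D' : Multiset (DataElement κ)) :
    keys (D + D') = keys D ∪ keys D' := by
  simp [keys]

theorem freq_eq_zero_of_notMem [DecidableEq κ] {D : Multiset (DataElement κ)} {x : κ}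
    (h : x ∉ keys D) : freq D x = 0 := by
  induction D using Multiset.induction_on with
  | empty => simp
  | cons e D ih =>
    rw [keys_cons, Finset.mem_insert, not_or] at h
    rw [freq_cons, ih h.2, if_neg (Ne.symm h.1), add_zero]

theorem transformed_congr {p : ℝ} {r : κ → ℝ} {v v' : κ → ℝ} {x : κ} (h : v x = v' x) :
    transformed p r v x = transformed p r v' x := by
  simp only [transformed, h]

end DataSets

/-! ### The second pass, and exactness of the sample -/

section TopSketch

variable {κ : Type*} [LinearOrder κ]

/-- A key among the top `m` at some node is among the top `m` in every sub-aggregation where it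
occurs, so no part of its value has ever been ejected. -/
theorem topSketch_run (m : ℕ) (prio : κ → ℝ≥0) (a : Aggregation κ) :
    ((topSketch m prio).run a).keys = topKeys m (keys a.dataset) prio ∧
      ∀ x ∈ topKeys m (keys a.dataset) prio,
        ((topSketch m prio).run a).val x = freq a.dataset x := by
  -- For a key that is retained later on, the value collected so far is exact: either the key is
  -- stored, or it has not occurred yet and both sides are 0.
  have key : ∀ (a : Aggregation κ) (s : Finset κ) (x : κ),
      ((topSketch m prio).run a).keys = topKeys m (keys a.dataset) prio →
      (∀ x ∈ topKeys m (keys a.dataset) prio,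
        ((topSketch m prio).run a).val x = freq a.dataset x) →
      keys a.dataset ⊆ s → x ∈ topKeys m s prio →
      ((topSketch m prio).run a).val x = freq a.dataset x := by
    intro a s x h1 h2 hs hx
    by_cases hxa : x ∈ topKeys m (keys a.dataset) prio
    · exact h2 x hxa
    · rw [((topSketch m prio).run a).val_eq_zero x (h1 ▸ hxa), freq_eq_zero_of_notMem]
      exact fun hk => hxa (mem_topKeys.2
        ⟨hk, (rank_mono hs prio x).trans_lt (mem_topKeys.1 hx).2⟩)
  have sub : ∀ s t : Finset κ, s ⊆ t → topKeys m t prio ∩ s ⊆ topKeys m s prio := by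
    intro s t h x hx
    rw [Finset.mem_inter, mem_topKeys] at hx
    exact mem_topKeys.2 ⟨hx.2, (rank_mono h prio x).trans_lt hx.1.2⟩
  induction a with
  | empty =>
    constructor
    · simp [ComposableSketch.run, topSketch, Aggregation.dataset, topKeys]
    · intro x hx; simp [Aggregation.dataset, topKeys] at hx
  | process a e ih =>
    have hk : topKeys m (insert e.key ((topSketch m prio).run a).keys) prio =
        topKeys m (keys (e ::ₘ a.dataset)) prio := by
      rw [ih.1, keys_cons]
      refine topKeys_eq_of_subset (Finset.insert_subset_insert _ (topKeys_subset _ _ _)) ?_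
      intro x hx
      rcases Finset.mem_insert.1 (topKeys_subset _ _ _ hx) with h | h
      · exact h ▸ Finset.mem_insert_self _ _
      · exact Finset.mem_insert_of_mem
          (sub _ _ (Finset.subset_insert _ _) (Finset.mem_inter.2 ⟨hx, h⟩))
    refine ⟨hk, fun x hx => ?_⟩
    have hx' : x ∈ topKeys m (insert e.key ((topSketch m prio).run a).keys) prio := hk ▸ hx
    change (if x ∈ topKeys m (insert e.key ((topSketch m prio).run a).keys) prio then
      ((topSketch m prio).run a).val x + (if e.key = x then e.val else 0) else 0) = _
    rw [if_pos hx', Aggregation.dataset, freq_cons,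
      key a _ x ih.1 ih.2 (by rw [Aggregation.dataset, keys_cons]; exact Finset.subset_insert _ _) hx]
  | merge a b iha ihb =>
    have hk : topKeys m (((topSketch m prio).run a).keys ∪ ((topSketch m prio).run b).keys) prio =
        topKeys m (keys (a.dataset + b.dataset)) prio := by
      rw [iha.1, ihb.1, keys_add]
      refine topKeys_eq_of_subset
        (Finset.union_subset_union (topKeys_subset _ _ _) (topKeys_subset _ _ _)) ?_
      intro x hx
      rcases Finset.mem_union.1 (topKeys_subset _ _ _ hx) with h | h
      · exact Finset.mem_union_left _
          (sub _ _ Finset.subset_union_left (Finset.mem_inter.2 ⟨hx, h⟩))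
      · exact Finset.mem_union_right _
          (sub _ _ Finset.subset_union_right (Finset.mem_inter.2 ⟨hx, h⟩))
    refine ⟨hk, fun x hx => ?_⟩
    have hx' : x ∈ topKeys m
      (((topSketch m prio).run a).keys ∪ ((topSketch m prio).run b).keys) prio := hk ▸ hx
    change (if x ∈ topKeys m
      (((topSketch m prio).run a).keys ∪ ((topSketch m prio).run b).keys) prio then
      ((topSketch m prio).run a).val x + ((topSketch m prio).run b).val x else 0) = _
    rw [if_pos hx', Aggregation.dataset, freq_add,
      key a _ x iha.1 iha.2
        (by rw [Aggregation.dataset, keys_add]; exact Finset.subset_union_left) hx,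
      key b _ x ihb.1 ihb.2
        (by rw [Aggregation.dataset, keys_add]; exact Finset.subset_union_right) hx]

theorem card_keys_topSketch_run_le (m : ℕ) (prio : κ → ℝ≥0) (a : Aggregation κ) :
    ((topSketch m prio).run a).keys.card ≤ m := by
  rw [(topSketch_run m prio a).1]
  exact card_topKeys_le _ _ _

/-- The two-pass method returns the exact sample if the magnitudes of the estimates err by at most
`ε`, fewer than `m` keys are larger than `ε`, and more than `k` keys are larger than `3 ε`
(or `ε = 0`). -/
theorem isExactSample_twoPassSample {σ : Type*} {n : ℕ} (R : FrequencySketch n σ) {p : ℝ}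
    {k m : ℕ} {keyHash : κ → Fin n} {r : κ → ℝ} {D : Multiset (DataElement κ)}
    {a₁ a₂ : Aggregation κ} (h₂ : a₂.dataset = D) (hkm : k < m) {ε : ℝ}
    (herr : ∀ x ∈ keys D, |‖R.est (passOne R p keyHash r a₁) (keyHash x)‖ -
      transformed p r (freq D) x| ≤ ε)
    (hm : ((keys D).filter fun x => ε < transformed p r (freq D) x).card < m)
    (hk : k + 1 ≤ ((keys D).filter fun x => 3 * ε < transformed p r (freq D) x).card ∨ ε = 0) :
    IsExactSample p k r D (twoPassSample R p k m keyHash r a₁ a₂) := by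
  set prio : κ → ℝ≥0 := fun x => ‖R.est (passOne R p keyHash r a₁) (keyHash x)‖₊ with hprio
  set f : κ → ℝ≥0 := transformed p r (freq D) with hf
  obtain ⟨hT, hV⟩ := topSketch_run m prio a₂
  rw [h₂] at hT hV
  set T := topKeys m (keys D) prio with hTdef
  have hTS : T ⊆ keys D := topKeys_subset _ _ _
  have hpass : passTwo R p m keyHash r a₁ a₂ = (topSketch m prio).run a₂ := rfl
  have hcongr : ∀ x ∈ T, transformed p r ((topSketch m prio).run a₂).val x = f x :=
    fun x hx => transformed_congr (hV x hx)
  have hkeys : (twoPassSample R p k m keyHash r a₁ a₂).keys = topKeys k T f := by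
    change topKeys k (passTwo R p m keyHash r a₁ a₂).keys
      (transformed p r (passTwo R p m keyHash r a₁ a₂).val) = _
    rw [hpass, hT]; exact topKeys_congr hcongr
  have hthr : (twoPassSample R p k m keyHash r a₁ a₂).threshold = nextLargest k T f := by
    change nextLargest k (passTwo R p m keyHash r a₁ a₂).keys
      (transformed p r (passTwo R p m keyHash r a₁ a₂).val) = _
    rw [hpass, hT]; exact nextLargest_congr hcongr
  -- If `f x > 3 ε`, the estimate of `x` exceeds `2 ε`. As `x` is missing, `m` stored keys have
  -- estimates at least as large, hence values above `ε`, against `hm`.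
  have hsmall : ∀ x ∈ keys D, x ∉ T → (f x : ℝ) ≤ 3 * ε := by
    intro x hx hxT
    by_contra! hlt
    refine hm.not_ge ?_
    rw [← card_topKeys_of_notMem hx hxT]
    refine Finset.card_le_card fun y hy => Finset.mem_filter.2 ⟨hTS hy, ?_⟩
    have h1 : (prio x : ℝ) ≤ prio y := NNReal.coe_le_coe.2 (le_of_mem_topKeys_of_notMem hx hxT hy)
    have h2 := abs_le.1 (herr x hx)
    have h3 := abs_le.1 (herr y (hTS hy))
    simp only [hprio, coe_nnnorm] at h1
    linarith
  -- A missed key affects neither sample nor threshold once `k + 1` stored keys dominate it. By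
  -- `hsmall` all keys above `3 ε` are stored; if `ε = 0`, a missed key has `f x = 0`, and `T` has
  -- `m > k` keys.
  have hdom : ∀ x ∈ keys D, x ∉ T → k + 1 ≤ (T.filter fun y => f x ≤ f y).card := by
    intro x hx hxT
    have hfx := hsmall x hx hxT
    rcases hk with hk | hε
    · refine hk.trans (Finset.card_le_card fun y hy => ?_)
      rw [Finset.mem_filter] at hy ⊢
      refine ⟨?_, NNReal.coe_le_coe.1 (hfx.trans hy.2.le)⟩
      by_contra hyT
      exact absurd (hsmall y hy.1 hyT) (not_le.2 hy.2)
    · have h0 : f x = 0 := by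
        have : (f x : ℝ) ≤ 0 := by simpa [hε] using hfx
        exact le_antisymm (by exact_mod_cast this) zero_le
      rw [Finset.filter_true_of_mem fun y _ => h0 ▸ zero_le,
        card_topKeys_of_notMem hx hxT]
      exact hkm
  have hcard : T.card = min m (keys D).card := card_topKeys _ _ _
  refine ⟨?_, ?_, ?_, ?_, ?_⟩
  · rw [hkeys]; exact (topKeys_subset _ _ _).trans hTS
  · rw [hkeys, card_topKeys, hcard, ← min_assoc, min_eq_left hkm.le]
  · rw [hkeys]
    intro x hx y hy hyk
    by_cases hyT : y ∈ T
    · exact le_of_mem_topKeys_of_notMem hyT hyk hx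
    · obtain ⟨z, hz, hyz⟩ := exists_mem_sdiff_topKeys (hdom y hy hyT)
      rw [Finset.mem_sdiff] at hz
      exact hyz.trans (le_of_mem_topKeys_of_notMem hz.1 hz.2 hx)
  · rw [hkeys]
    intro x hx
    change (passTwo R p m keyHash r a₁ a₂).val x = _
    rw [hpass]
    exact hV x (topKeys_subset _ _ _ hx)
  · rw [hthr, hkeys]
    refine le_antisymm (Finset.sup_mono (Finset.sdiff_subset_sdiff hTS subset_rfl)) ?_
    refine Finset.sup_le fun y hy => ?_
    rw [Finset.mem_sdiff] at hy
    by_cases hyT : y ∈ T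
    · exact Finset.le_sup (f := f) (Finset.mem_sdiff.2 ⟨hyT, hy.2⟩)
    · obtain ⟨z, hz, hyz⟩ := exists_mem_sdiff_topKeys (hdom y hy.1 hyT)
      exact hyz.trans (Finset.le_sup (f := f) hz)

end TopSketch

/-! ### The data set that the first pass sketches -/

section Aggregation

variable {κ κ' : Type*}

theorem Aggregation.dataset_map (g : DataElement κ → DataElement κ') (a : Aggregation κ) :
    (a.map g).dataset = a.dataset.map g := by
  induction a with
  | empty => rfl
  | process a e ih => simp [Aggregation.map, Aggregation.dataset, ih]
  | merge a b iha ihb => simp [Aggregation.map, Aggregation.dataset, iha, ihb]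

/-- Stated without injectivity, so that it yields the frequencies at hashed keys, the zeros
elsewhere, and measurability in `r`. The set `s` stays fixed while the keys of `D` grow in the
induction. -/
theorem freq_map_outputElement [DecidableEq κ] {n : ℕ} (p : ℝ) (keyHash : κ → Fin n) (r : κ → ℝ)
    (D : Multiset (DataElement κ)) {s : Finset κ} (hs : keys D ⊆ s) (z : Fin n) :
    freq (D.map (outputElement p keyHash r)) z =
      ∑ x ∈ s, if keyHash x = z then freq D x / r x ^ (1 / p) else 0 := by
  induction D using Multiset.induction_on with
  | empty => simp
  | cons e D ih =>
    rw [keys_cons, Finset.insert_subset_iff] at hs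
    rw [Multiset.map_cons, freq_cons, ih hs.2]
    have h1 : ∀ x, (if keyHash x = z then freq (e ::ₘ D) x / r x ^ (1 / p) else 0) =
        (if keyHash x = z then freq D x / r x ^ (1 / p) else 0) +
          if e.key = x then (if keyHash e.key = z then e.val / r e.key ^ (1 / p) else 0)
            else 0 := by
      intro x
      rw [freq_cons]
      by_cases hx : e.key = x
      · subst hx; simp only [if_true]; split_ifs <;> ring
      · simp [hx]
    simp_rw [h1]
    rw [Finset.sum_add_distrib, Finset.sum_ite_eq, if_pos hs.1]
    rfl

theorem freq_map_outputElement_of_injOn [DecidableEq κ] {n : ℕ} (p : ℝ) {keyHash : κ → Fin n}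
    (r : κ → ℝ) {D : Multiset (DataElement κ)} (hinj : Set.InjOn keyHash (keys D)) {x : κ}
    (hx : x ∈ keys D) :
    freq (D.map (outputElement p keyHash r)) (keyHash x) = freq D x / r x ^ (1 / p) := by
  rw [freq_map_outputElement p keyHash r D subset_rfl, Finset.sum_eq_single_of_mem x hx]
  · simp
  · intro y hy hyx
    exact if_neg fun h => hyx (hinj hy hx h)

theorem freq_map_outputElement_of_notMem [DecidableEq κ] {n : ℕ} (p : ℝ) {keyHash : κ → Fin n}
    (r : κ → ℝ) {D : Multiset (DataElement κ)} {z : Fin n} (hz : z ∉ (keys D).image keyHash) :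
    freq (D.map (outputElement p keyHash r)) z = 0 := by
  rw [freq_map_outputElement p keyHash r D subset_rfl]
  refine Finset.sum_eq_zero fun x hx => if_neg fun h => hz (Finset.mem_image.2 ⟨x, hx, h⟩)

end Aggregation

/-! ### Robustness of the median -/

section Median

/-- If the median is too large, so are the `d - d / 2` entries from its position upwards; if it is
too small, so are the `d / 2 + 1` entries up to its position. Both counts are at least `d - d / 2`.
-/
theorem abs_median_sub_le {d : ℕ} (f : Fin d → ℝ) {v ε : ℝ}
    (h : (Finset.univ.filter fun i => ε < |f i - v|).card < d - d / 2) : |median f - v| ≤ ε := by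
  have hd : 0 < d := by omega
  rw [median, dif_pos hd]
  set m : Fin d := ⟨d / 2, Nat.div_lt_self hd one_lt_two⟩ with hm
  have hmono : Monotone (f ∘ Tuple.sort f) := Tuple.monotone_sort f
  by_contra! hlt
  refine h.not_ge ?_
  rcases lt_abs.1 hlt with h1 | h1
  · have : ((Finset.Ici m).image (Tuple.sort f)).card = d - d / 2 := by
      rw [Finset.card_image_of_injective _ (Tuple.sort f).injective, Fin.card_Ici]
    rw [← this]
    refine Finset.card_le_card fun i hi => ?_
    obtain ⟨j, hj, rfl⟩ := Finset.mem_image.1 hi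
    have := hmono (Finset.mem_Ici.1 hj)
    simp only [Function.comp] at this
    exact Finset.mem_filter.2 ⟨Finset.mem_univ _, lt_abs.2 (.inl (by linarith))⟩
  · have : ((Finset.Iic m).image (Tuple.sort f)).card = d / 2 + 1 := by
      rw [Finset.card_image_of_injective _ (Tuple.sort f).injective, Fin.card_Iic]
    refine le_trans (by omega : d - d / 2 ≤ d / 2 + 1) ?_
    rw [← this]
    refine Finset.card_le_card fun i hi => ?_
    obtain ⟨j, hj, rfl⟩ := Finset.mem_image.1 hi
    have := hmono (Finset.mem_Iic.1 hj)
    simp only [Function.comp] at this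
    exact Finset.mem_filter.2 ⟨Finset.mem_univ _, lt_abs.2 (.inr (by linarith))⟩

end Median

/-! ### CountSketch as a linear function of the frequencies -/

section CountSketch

variable {n d w : ℕ}

/-- The estimate of the frequency of `x` from a single row of `CountSketch`. -/
noncomputable def rowEstimate (h : Fin n → Fin w) (s : Fin n → Bool) (f : Fin n → ℝ)
    (x : Fin n) : ℝ :=
  sgn (s x) * ∑ y, if h y = h x then sgn (s y) * f y else 0

theorem countSketch_run (h : Fin d → Fin n → Fin w) (s : Fin d → Fin n → Bool)
    (a : Aggregation (Fin n)) (i : Fin d) (b : Fin w) :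
    (countSketch d w h s).run a i b =
      ∑ y, if h i y = b then sgn (s i y) * freq a.dataset y else 0 := by
  induction a with
  | empty => simp [ComposableSketch.run, countSketch, Aggregation.dataset]
  | process a e ih =>
    change (countSketch d w h s).run a i b +
      (if h i e.key = b then sgn (s i e.key) * e.val else 0) = _
    rw [ih, Aggregation.dataset]
    have h1 : ∀ y, (if h i y = b then sgn (s i y) * freq (e ::ₘ a.dataset) y else 0) =
        (if h i y = b then sgn (s i y) * freq a.dataset y else 0) +
          if e.key = y then (if h i e.key = b then sgn (s i e.key) * e.val else 0) else 0 := by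
      intro y
      rw [freq_cons]
      by_cases hy : e.key = y
      · subst hy; simp only [if_true]; split_ifs <;> ring
      · simp [hy]
    simp_rw [h1]
    rw [Finset.sum_add_distrib, Finset.sum_ite_eq, if_pos (Finset.mem_univ _)]
  | merge a a' iha ihb =>
    change (countSketch d w h s).run a i b + (countSketch d w h s).run a' i b = _
    rw [iha, ihb, Aggregation.dataset, ← Finset.sum_add_distrib]
    refine Finset.sum_congr rfl fun y _ => ?_
    rw [freq_add]
    split_ifs <;> ring

theorem countSketch_est_run (h : Fin d → Fin n → Fin w) (s : Fin d → Fin n → Bool)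
    (a : Aggregation (Fin n)) (x : Fin n) :
    (countSketch d w h s).est ((countSketch d w h s).run a) x =
      median fun i => rowEstimate (h i) (s i) (freq a.dataset) x := by
  change (median fun i => sgn (s i x) * (countSketch d w h s).run a i (h i x)) = _
  simp_rw [countSketch_run]
  rfl

end CountSketch

/-! ### The error of the mergeable Misra–Gries summary -/

section Counters

variable {n m : ℕ}

/-- If the threshold is non-zero, it is attained at a key outside the top `m`; this key and the top
`m` are `m + 1` counters that lose the full threshold. -/
theorem sum_reduceCounters_add_le (c : Fin n → ℝ≥0) :
    ∑ x, reduceCounters m c x + (m + 1) * nextLargest m Finset.univ c ≤ ∑ x, c x := by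
  set θ := nextLargest m Finset.univ c with hθ
  rcases eq_or_ne θ 0 with h0 | h0
  · rw [h0, mul_zero, add_zero]
    exact Finset.sum_le_sum fun x _ => tsub_le_self
  · have hne : (Finset.univ \ topKeys m Finset.univ c).Nonempty := by
      by_contra h
      rw [Finset.not_nonempty_iff_eq_empty] at h
      exact h0 (by rw [hθ, nextLargest, h]; simp)
    obtain ⟨z, hz, hzθ⟩ := Finset.exists_mem_eq_sup _ hne c
    rw [Finset.mem_sdiff] at hz
    have hI : ∀ x ∈ insert z (topKeys m Finset.univ c), θ ≤ c x := by
      intro x hx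
      have hθz : θ = c z := hzθ
      rcases Finset.mem_insert.1 hx with rfl | hx
      · exact hθz.le
      · exact hθz.le.trans (le_of_mem_topKeys_of_notMem hz.1 hz.2 hx)
    have hcard : (insert z (topKeys m Finset.univ c)).card = m + 1 := by
      rw [Finset.card_insert_of_notMem hz.2, card_topKeys_of_notMem hz.1 hz.2]
    have h1 : (m + 1) * θ = ∑ x, if x ∈ insert z (topKeys m Finset.univ c) then θ else 0 := by
      rw [Finset.sum_ite_mem, Finset.univ_inter, Finset.sum_const, hcard]
      simp
    rw [h1, ← Finset.sum_add_distrib]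
    refine Finset.sum_le_sum fun x _ => ?_
    change c x - θ + _ ≤ _
    split_ifs with h
    · rw [tsub_add_cancel_of_le (hI x h)]
    · rw [add_zero]; exact tsub_le_self

theorem card_reduceCounters_ne_zero_le (c : Fin n → ℝ≥0) :
    (Finset.univ.filter fun x => reduceCounters m c x ≠ 0).card ≤ m := by
  refine (Finset.card_le_card fun x hx => ?_).trans (card_topKeys_le m Finset.univ c)
  by_contra hx'
  refine (Finset.mem_filter.1 hx).2 (tsub_eq_zero_of_le ?_)
  exact Finset.le_sup (f := c) (Finset.mem_sdiff.2 ⟨Finset.mem_univ _, hx'⟩)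

theorem counters_words_run_le (a : Aggregation (Fin n)) :
    (counters n m).words ((counters n m).run a) ≤ 2 * m := by
  refine Nat.mul_le_mul_left 2 ?_
  cases a with
  | empty => simp [ComposableSketch.run, counters]
  | process a e => exact card_reduceCounters_ne_zero_le _
  | merge a b => exact card_reduceCounters_ne_zero_le _

/-- Counters `c` for the frequencies `f` from each of which `Δ` is missing at most, where every
loss of `δ` of a counter goes along with a loss of `(m + 1) δ` of the sum of all counters. -/
def IsCounterState (m : ℕ) (f : Fin n → ℝ) (c : Fin n → ℝ≥0) : Prop :=
  ∃ Δ : ℝ, 0 ≤ Δ ∧ (∀ x, f x - Δ ≤ c x ∧ (c x : ℝ) ≤ f x) ∧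
    ∑ x, (c x : ℝ) + (m + 1) * Δ ≤ ∑ x, f x

theorem IsCounterState.reduce {f : Fin n → ℝ} {c : Fin n → ℝ≥0} (h : IsCounterState m f c) :
    IsCounterState m f (reduceCounters m c) := by
  obtain ⟨Δ, h0, h1, h2⟩ := h
  refine ⟨Δ + nextLargest m Finset.univ c, by positivity, fun x => ⟨?_, ?_⟩, ?_⟩
  · have : c x ≤ reduceCounters m c x + nextLargest m Finset.univ c := le_tsub_add
    have : (c x : ℝ) ≤ reduceCounters m c x + nextLargest m Finset.univ c := by exact_mod_cast this
    linarith [(h1 x).1]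
  · have : reduceCounters m c x ≤ c x := tsub_le_self
    exact le_trans (by exact_mod_cast this) (h1 x).2
  · have := sum_reduceCounters_add_le (m := m) c
    have : ∑ x, (reduceCounters m c x : ℝ) + (m + 1) * (nextLargest m Finset.univ c : ℝ) ≤
        ∑ x, (c x : ℝ) := by exact_mod_cast this
    linarith

theorem IsCounterState.add {f f' : Fin n → ℝ} {c c' : Fin n → ℝ≥0} (h : IsCounterState m f c)
    (h' : IsCounterState m f' c') :
    IsCounterState m (fun x => f x + f' x) (fun x => c x + c' x) := by
  obtain ⟨Δ, h0, h1, h2⟩ := h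
  obtain ⟨Δ', h0', h1', h2'⟩ := h'
  refine ⟨Δ + Δ', by positivity, fun x => ⟨?_, ?_⟩, ?_⟩
  · push_cast; linarith [(h1 x).1, (h1' x).1]
  · push_cast; linarith [(h1 x).2, (h1' x).2]
  · push_cast; rw [Finset.sum_add_distrib, Finset.sum_add_distrib]; linarith

theorem isCounterState_run (a : Aggregation (Fin n)) (ha : ∀ e ∈ a.dataset, 0 < e.val) :
    IsCounterState m (freq a.dataset) ((counters n m).run a) := by
  induction a with
  | empty => exact ⟨0, le_rfl, by simp [Aggregation.dataset, ComposableSketch.run, counters],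
      by simp [Aggregation.dataset, ComposableSketch.run, counters]⟩
  | process a e ih =>
    have h1 := ih fun e' he' => ha e' (Multiset.mem_cons_of_mem he')
    have he : 0 < e.val := ha e (Multiset.mem_cons_self _ _)
    have h2 : IsCounterState m (fun x => if e.key = x then e.val else 0)
        (fun x => if e.key = x then e.val.toNNReal else 0) := by
      have : ∀ x, (((if e.key = x then e.val.toNNReal else 0 : ℝ≥0)) : ℝ) =
          if e.key = x then e.val else 0 := by
        intro x; split_ifs
        · exact Real.coe_toNNReal _ he.le
        · rfl
      exact ⟨0, le_rfl, fun x => ⟨by rw [this, sub_zero], (this x).le⟩, by simp [this]⟩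
    have := (h1.add h2).reduce
    rw [Aggregation.dataset, show freq (e ::ₘ a.dataset) =
      fun x => freq a.dataset x + if e.key = x then e.val else 0 from funext (freq_cons _ _)]
    exact this
  | merge a b iha ihb =>
    have := ((iha fun e he => ha e (Multiset.mem_add.2 (.inl he))).add
      (ihb fun e he => ha e (Multiset.mem_add.2 (.inr he)))).reduce
    rw [Aggregation.dataset, show freq (a.dataset + b.dataset) =
      fun x => freq a.dataset x + freq b.dataset x from funext (freq_add _ _)]
    exact this

/-- The error bound of the counter-based sketch in terms of the residual of the frequencies. -/
theorem abs_counters_est_sub_le (a : Aggregation (Fin n)) (ha : ∀ e ∈ a.dataset, 0 < e.val)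
    (J : Finset (Fin n)) (hJ : J.card ≤ m) {ε : ℝ}
    (hε : ∑ x ∈ Finset.univ \ J, freq a.dataset x ≤ (m + 1 - J.card) * ε) (x : Fin n) :
    |(counters n m).est ((counters n m).run a) x - freq a.dataset x| ≤ ε := by
  obtain ⟨Δ, h0, h1, h2⟩ := isCounterState_run (m := m) a ha
  set c := (counters n m).run a
  have hcard : (J.card : ℝ) ≤ m := by exact_mod_cast hJ
  -- The counters on `J` alone retain the mass of `J` up to `|J| Δ`. Compared with the bound on the
  -- sum of all counters, this leaves `(m + 1 - |J|) Δ` for the residual to pay.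
  have h3 : ∑ x ∈ J, (freq a.dataset x - Δ) ≤ ∑ x, (c x : ℝ) :=
    (Finset.sum_le_sum fun x _ => (h1 x).1).trans
      (Finset.sum_le_sum_of_subset_of_nonneg (Finset.subset_univ _) fun x _ _ => (c x).2)
  rw [Finset.sum_sub_distrib, Finset.sum_const, nsmul_eq_mul] at h3
  have h4 := Finset.sum_sdiff (f := freq a.dataset) (Finset.subset_univ J)
  have h5 : (m + 1 - J.card) * Δ ≤ (m + 1 - J.card) * ε := by linarith
  have h6 : Δ ≤ ε := le_of_mul_le_mul_left h5 (by linarith)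
  change |(c x : ℝ) - _| ≤ ε
  rw [abs_le]
  constructor <;> linarith [h1 x]

end Counters

/-! ### A Chernoff bound -/

section Chernoff

variable {Ω : Type*} [MeasurableSpace Ω] {P : Measure Ω} [IsProbabilityMeasure P]

/-- On `[0, 1]` the exponential lies below its chord `1 + (exp θ - 1) X`; then `1 + y ≤ exp y` after
integration. -/
theorem mgf_le_of_mem_Icc {X : Ω → ℝ} (hX : Measurable X) (h01 : ∀ ω, X ω ∈ Set.Icc (0 : ℝ) 1)
    {θ : ℝ} : mgf X P θ ≤ Real.exp ((Real.exp θ - 1) * ∫ ω, X ω ∂P) := by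
  have hint : Integrable X P := by
    refine Integrable.of_bound hX.aestronglyMeasurable 1 (.of_forall fun ω => ?_)
    rw [Real.norm_eq_abs, abs_of_nonneg (h01 ω).1]; exact (h01 ω).2
  have h1 : ∀ ω, Real.exp (θ * X ω) ≤ 1 + (Real.exp θ - 1) * X ω := by
    intro ω
    have := convexOn_exp.2 (Set.mem_univ 0) (Set.mem_univ θ)
      (sub_nonneg.2 (h01 ω).2) (h01 ω).1 (by ring)
    simp only [smul_eq_mul, mul_zero, zero_add, Real.exp_zero, mul_one] at this
    rw [mul_comm θ]; linarith
  refine le_trans (b := 1 + (Real.exp θ - 1) * ∫ ω, X ω ∂P) ?_ ?_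
  · unfold mgf
    have h2 : Integrable (fun ω => 1 + (Real.exp θ - 1) * X ω) P :=
      (integrable_const _).add (hint.const_mul _)
    refine (integral_mono_of_nonneg (.of_forall fun ω => (Real.exp_pos _).le) h2
      (.of_forall h1)).trans_eq ?_
    rw [integral_add (integrable_const _) (hint.const_mul _), integral_const_mul]
    simp
  · rw [add_comm]; exact Real.add_one_le_exp _

/-- A Chernoff bound for sums of independent variables with values in `[0, 1]`. -/
theorem measureReal_le_sum_le {ι : Type*} {X : ι → Ω → ℝ} (hX : ∀ i, Measurable (X i))
    (h01 : ∀ i ω, X i ω ∈ Set.Icc (0 : ℝ) 1) (hind : iIndepFun X P) (s : Finset ι) {μ θ : ℝ}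
    (hμ : ∑ i ∈ s, ∫ ω, X i ω ∂P ≤ μ) (hθ : 0 ≤ θ) (t : ℝ) :
    P.real {ω | t ≤ ∑ i ∈ s, X i ω} ≤ Real.exp ((Real.exp θ - 1) * μ - θ * t) := by
  have hmeas : Measurable (∑ i ∈ s, X i) := by
    rw [Finset.sum_fn]; exact Finset.measurable_sum s fun i _ => hX i
  have hint : Integrable (fun ω => Real.exp (θ * (∑ i ∈ s, X i) ω)) P := by
    refine Integrable.of_bound (by fun_prop) (Real.exp (θ * s.card)) (.of_forall fun ω => ?_)
    rw [Real.norm_eq_abs, abs_of_pos (Real.exp_pos _), Finset.sum_apply]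
    gcongr
    exact (Finset.sum_le_card_nsmul s _ 1 fun i _ => (h01 i ω).2).trans_eq (by simp)
  have h1 := measure_ge_le_exp_mul_mgf t hθ hint
  simp only [Finset.sum_apply] at h1
  refine h1.trans ?_
  rw [hind.mgf_sum hX, sub_eq_neg_add, Real.exp_add, ← neg_mul]
  gcongr
  refine (Finset.prod_le_prod (fun i _ => mgf_nonneg) fun i _ =>
    mgf_le_of_mem_Icc (hX i) (h01 i)).trans ?_
  rw [← Real.exp_sum, ← Finset.mul_sum]
  gcongr
  linarith [Real.add_one_le_exp θ]

end Chernoff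

/-! ### Error probability of CountSketch for fixed frequencies -/

section Hash

theorem measurableSet_of_hash {Ω : Type*} [MeasurableSpace Ω] {P : Measure Ω} {n d w : ℕ}
    {h : Fin d → Fin n → Ω → Fin w} {s : Fin d → Fin n → Ω → Bool}
    (H : IsCountSketchHash P h s) (i : Fin d)
    (p : (Fin n → Fin w) → (Fin n → Bool) → Prop) :
    MeasurableSet {ω | p (fun y => h i y ω) (fun y => s i y ω)} := by
  have h1 : Measurable fun ω => ((fun y => h i y ω, fun y => s i y ω) :
      (Fin n → Fin w) × (Fin n → Bool)) :=
    (measurable_pi_lambda _ fun y => H.measurable_h i y).prodMk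
      (measurable_pi_lambda _ fun y => H.measurable_s i y)
  exact h1 (Set.toFinite {g | p g.1 g.2}).measurableSet

variable {Ω : Type*} [MeasurableSpace Ω] {P : Measure Ω} [IsProbabilityMeasure P] {n d w : ℕ}
  {h : Fin d → Fin n → Ω → Fin w} {s : Fin d → Fin n → Ω → Bool}

theorem sgn_mul_self (b : Bool) : sgn b * sgn b = 1 := by cases b <;> simp [sgn]

theorem abs_sgn (b : Bool) : |sgn b| = 1 := by cases b <;> simp [sgn]

theorem IsCountSketchHash.collision (H : IsCountSketchHash P h s) (i : Fin d) {x y : Fin n}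
    (hxy : y ≠ x) : P.real {ω | h i y ω = h i x ω} = 1 / w := by
  have hU : {ω | h i y ω = h i x ω} =
      ⋃ b ∈ (Finset.univ : Finset (Fin w)), (h i y ⁻¹' {b} ∩ h i x ⁻¹' {b}) := by
    ext ω; simp [eq_comm]
  have hw : (w : ℝ) ≠ 0 := by
    obtain ⟨ω⟩ : Nonempty Ω := nonempty_of_isProbabilityMeasure P
    have := (h i x ω).pos
    positivity
  rw [hU, measureReal_biUnion_finset]
  · have : ∀ b : Fin w, P.real (h i y ⁻¹' {b} ∩ h i x ⁻¹' {b}) = 1 / w * (1 / w) := by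
      intro b
      rw [measureReal_def, (H.pairwise_h i y x hxy).measure_inter_preimage_eq_mul _ _
        (measurableSet_singleton b) (measurableSet_singleton b), ENNReal.toReal_mul]
      congr 1
      · exact H.uniform_h i y b
      · exact H.uniform_h i x b
    simp only [this, Finset.sum_const, Finset.card_univ, Fintype.card_fin, nsmul_eq_mul]
    field_simp
  · intro b _ b' _ hbb
    refine Set.disjoint_left.2 fun ω h1 h2 => hbb ?_
    exact h1.1.symm.trans h2.1
  · intro b _
    exact (H.measurable_h i y (measurableSet_singleton b)).inter
      (H.measurable_h i x (measurableSet_singleton b))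

theorem IsCountSketchHash.integral_sgn (H : IsCountSketchHash P h s) (i : Fin d) (x : Fin n) :
    ∫ ω, sgn (s i x ω) ∂P = 0 := by
  have h1 : ∀ ω, sgn (s i x ω) = 2 * (s i x ⁻¹' {true}).indicator 1 ω - 1 := by
    intro ω
    by_cases hs : s i x ω = true
    · rw [Set.indicator_of_mem (by exact hs), hs]; norm_num [sgn]
    · rw [Set.indicator_of_notMem (by exact hs), Bool.eq_false_of_not_eq_true hs]
      norm_num [sgn]
  have hm : MeasurableSet (s i x ⁻¹' {true}) := H.measurable_s i x (measurableSet_singleton _)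
  simp_rw [h1]
  rw [integral_sub, integral_const_mul, integral_indicator_one hm]
  · have : P.real (s i x ⁻¹' {true}) = 1 / 2 := H.uniform_s i x true
    rw [this]; simp
  · exact ((integrable_const (1 : ℝ)).indicator hm).const_mul 2
  · exact integrable_const _

theorem IsCountSketchHash.integral_sgn_mul_sgn (H : IsCountSketchHash P h s) (i : Fin d)
    {x y : Fin n} (hxy : x ≠ y) : ∫ ω, sgn (s i x ω) * sgn (s i y ω) ∂P = 0 := by
  have hsgn : Measurable sgn := measurable_of_finite _
  have := ((H.pairwise_s i x y hxy).comp hsgn hsgn).integral_fun_mul_eq_mul_integral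
    (hsgn.comp (H.measurable_s i x)).aestronglyMeasurable
    (hsgn.comp (H.measurable_s i y)).aestronglyMeasurable
  simp only [Function.comp_def] at this
  rw [this, H.integral_sgn, zero_mul]

open scoped Classical in
/-- The second moment of the contribution of the keys in `A` to the error of a row. -/
theorem IsCountSketchHash.integral_sq (H : IsCountSketchHash P h s) (i : Fin d) (x : Fin n)
    (f : Fin n → ℝ) {A : Finset (Fin n)} (hA : x ∉ A) :
    ∫ ω, (∑ y ∈ A, if h i y ω = h i x ω then sgn (s i y ω) * f y else 0) ^ 2 ∂P =
      (∑ y ∈ A, f y ^ 2) / w := by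
  set I : Fin n → (Fin n → Fin w) → ℝ := fun y g => if g y = g x then 1 else 0 with hI
  set V : Ω → Fin n → Fin w := fun ω y => h i y ω with hV
  set S : Ω → Fin n → Bool := fun ω y => s i y ω with hS
  have hVm : Measurable V := measurable_pi_lambda _ fun y => H.measurable_h i y
  have hSm : Measurable S := measurable_pi_lambda _ fun y => H.measurable_s i y
  have hsq : ∀ ω, (∑ y ∈ A, if h i y ω = h i x ω then sgn (s i y ω) * f y else 0) ^ 2 =
      ∑ y ∈ A, ∑ z ∈ A, f y * f z * ((I y (V ω) * I z (V ω)) * (sgn (S ω y) * sgn (S ω z))) := by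
    intro ω
    rw [sq, Finset.sum_mul_sum]
    refine Finset.sum_congr rfl fun y _ => Finset.sum_congr rfl fun z _ => ?_
    simp only [hI, hV, hS]
    split_ifs <;> ring
  have hbd : ∀ y z ω, |f y * f z * ((I y (V ω) * I z (V ω)) * (sgn (S ω y) * sgn (S ω z)))| ≤
      |f y * f z| := by
    intro y z ω
    rw [abs_mul, abs_mul (_ * _) (sgn _ * _), abs_mul (sgn _), abs_sgn, abs_sgn]
    refine mul_le_of_le_one_right (abs_nonneg _) ?_
    simp only [hI]
    split_ifs <;> simp
  have hmeas : ∀ y z, Measurable fun ω =>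
      f y * f z * ((I y (V ω) * I z (V ω)) * (sgn (S ω y) * sgn (S ω z))) := by
    intro y z
    have h1 : Measurable fun g : Fin n → Fin w => I y g * I z g := measurable_of_finite _
    have h2 : Measurable fun g : Fin n → Bool => sgn (g y) * sgn (g z) := measurable_of_finite _
    exact ((h1.comp hVm).mul (h2.comp hSm)).const_mul _
  have hint : ∀ y z, Integrable (fun ω =>
      f y * f z * ((I y (V ω) * I z (V ω)) * (sgn (S ω y) * sgn (S ω z)))) P :=
    fun y z => Integrable.of_bound (hmeas y z).aestronglyMeasurable _ (.of_forall (hbd y z))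
  simp_rw [hsq]
  rw [integral_finsetSum _ fun y _ => integrable_finsetSum _ fun z _ => hint y z,
    Finset.sum_div]
  refine Finset.sum_congr rfl fun y hy => ?_
  rw [integral_finsetSum _ fun z _ => hint y z, Finset.sum_eq_single_of_mem y hy]
  -- On the diagonal the signs cancel, and only the collision probability `1 / w` remains.
  · have h1 : ∀ ω, f y * f y * ((I y (V ω) * I y (V ω)) * (sgn (S ω y) * sgn (S ω y))) =
        f y ^ 2 * {ω | h i y ω = h i x ω}.indicator 1 ω := by
      intro ω
      rw [sgn_mul_self, mul_one, ← sq]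
      congr 1
      simp only [hI, hV]
      by_cases hc : h i y ω = h i x ω
      · rw [Set.indicator_of_mem (by exact hc)]; simp [hc]
      · rw [Set.indicator_of_notMem (by exact hc)]; simp [hc]
    simp_rw [h1]
    rw [integral_const_mul, integral_indicator_one
      (measurableSet_of_hash H i fun g _ => g y = g x),
      H.collision i (ne_of_mem_of_not_mem hy hA), mul_one_div]
  -- Off the diagonal the buckets separate from the signs by independence, and distinct signs are
  -- uncorrelated with mean zero.
  · intro z _ hzy
    have h1 : Measurable fun g : Fin n → Fin w => I y g * I z g := measurable_of_finite _
    have h2 : Measurable fun g : Fin n → Bool => sgn (g y) * sgn (g z) := measurable_of_finite _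
    have := ((H.indep_h_s i).comp h1 h2).integral_fun_mul_eq_mul_integral
      (h1.comp hVm).aestronglyMeasurable (h2.comp hSm).aestronglyMeasurable
    simp only [Function.comp_def] at this
    rw [integral_const_mul, this, H.integral_sgn_mul_sgn i hzy.symm, mul_zero, mul_zero]

/-- The error probability of a row of `CountSketch`. -/
theorem IsCountSketchHash.row_failure_le (H : IsCountSketchHash P h s) (i : Fin d) (x : Fin n)
    (f : Fin n → ℝ) (J : Finset (Fin n)) {ε q : ℝ} (hε : 0 ≤ ε) (hJ : (J.card : ℝ) ≤ w * (q / 2))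
    (hf : ∑ y ∈ Finset.univ \ J, f y ^ 2 ≤ w * (q / 2) * ε ^ 2) :
    P.real {ω | ε < |rowEstimate (fun y => h i y ω) (fun y => s i y ω) f x - f x|} ≤ q := by
  classical
  set A : Finset (Fin n) := (Finset.univ \ J).erase x with hA
  have hxA : x ∉ A := Finset.notMem_erase _ _
  set Z : Ω → ℝ := fun ω => ∑ y ∈ A, if h i y ω = h i x ω then sgn (s i y ω) * f y else 0 with hZ
  have hw : (0 : ℝ) < w := by
    obtain ⟨ω⟩ : Nonempty Ω := nonempty_of_isProbabilityMeasure P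
    have := (h i x ω).pos
    positivity
  -- A row fails only if `x` shares its bucket with another key of `J`, or if the colliding keys
  -- outside `J` contribute more than `ε`. Each case is allotted `q / 2`: a union bound for the
  -- first, Chebyshev for the second.
  have hsub : {ω | ε < |rowEstimate (fun y => h i y ω) (fun y => s i y ω) f x - f x|} ⊆
      (⋃ y ∈ J.erase x, {ω | h i y ω = h i x ω}) ∪ {ω | ε < |Z ω|} := by
    intro ω hω
    by_contra hc
    simp only [Set.mem_union, Set.mem_iUnion, Set.mem_ofPred_eq, not_or, not_exists] at hc
    refine hc.2 (lt_of_lt_of_eq hω ?_)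
    rw [← one_mul |Z ω|, ← abs_sgn (s i x ω), ← abs_mul]
    congr 1
    rw [rowEstimate, ← Finset.add_sum_erase _ _ (Finset.mem_univ x), if_pos rfl, mul_add,
      ← mul_assoc, sgn_mul_self, one_mul, add_sub_cancel_left]
    congr 1
    refine (Finset.sum_subset (fun y hy => ?_) fun y hy hyA => ?_).symm
    · exact Finset.mem_erase.2 ⟨(Finset.mem_erase.1 hy).1, Finset.mem_univ _⟩
    · refine if_neg (hc.1 y (Finset.mem_erase.2 ⟨(Finset.mem_erase.1 hy).1, ?_⟩))
      by_contra hyJ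
      exact hyA (Finset.mem_erase.2 ⟨(Finset.mem_erase.1 hy).1,
        Finset.mem_sdiff.2 ⟨Finset.mem_univ _, hyJ⟩⟩)
  have h1 : P.real (⋃ y ∈ J.erase x, {ω | h i y ω = h i x ω}) ≤ q / 2 := by
    refine (measureReal_biUnion_finset_le _ _).trans ?_
    rw [Finset.sum_congr rfl fun y hy => H.collision i (Finset.mem_erase.1 hy).1,
      Finset.sum_const, nsmul_eq_mul, mul_one_div, div_le_iff₀ hw, mul_comm]
    refine le_trans ?_ hJ
    exact_mod_cast Finset.card_le_card (Finset.erase_subset _ _)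
  have hfA : ∑ y ∈ A, f y ^ 2 ≤ w * (q / 2) * ε ^ 2 :=
    (Finset.sum_le_sum_of_subset_of_nonneg (Finset.erase_subset _ _)
      fun y _ _ => sq_nonneg _).trans hf
  have h2 : P.real {ω | ε < |Z ω|} ≤ q / 2 := by
    -- Chebyshev says nothing for `ε = 0`, but then all frequencies in `A` vanish and so does `Z`.
    rcases hε.eq_or_lt with h0 | h0
    · have hz : ∀ y ∈ A, f y = 0 := by
        have : ∑ y ∈ A, f y ^ 2 = 0 :=
          le_antisymm (hfA.trans_eq (by rw [← h0]; ring)) (Finset.sum_nonneg fun y _ => sq_nonneg _)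
        rw [Finset.sum_eq_zero_iff_of_nonneg fun y _ => sq_nonneg _] at this
        exact fun y hy => by simpa using this y hy
      have : {ω | ε < |Z ω|} = ∅ := by
        ext ω
        have : Z ω = 0 := Finset.sum_eq_zero fun y hy => by simp [hz y hy]
        simp [this, ← h0]
      rw [this, measureReal_empty]
      have : 0 ≤ w * (q / 2) := le_trans (Nat.cast_nonneg _) hJ
      exact nonneg_of_mul_nonneg_right this hw
    · have hm := mul_meas_ge_le_integral_of_nonneg (μ := P) (f := fun ω => Z ω ^ 2)
        (.of_forall fun ω => sq_nonneg _) ?_ (ε ^ 2)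
      · rw [H.integral_sq i x f hxA] at hm
        have h3 : P.real {ω | ε < |Z ω|} ≤ P.real {ω | ε ^ 2 ≤ Z ω ^ 2} := by
          refine measureReal_mono fun ω hω => ?_
          have hω' : ε < |Z ω| := hω
          change ε ^ 2 ≤ Z ω ^ 2
          rw [← sq_abs (Z ω)]
          exact pow_le_pow_left₀ hε hω'.le 2
        have h4 : (∑ y ∈ A, f y ^ 2) / w ≤ ε ^ 2 * (q / 2) := by
          rw [div_le_iff₀ hw]; linarith
        exact h3.trans (le_of_mul_le_mul_left (hm.trans h4) (by positivity))
      · refine Integrable.of_bound (C := (∑ y ∈ A, |f y|) ^ 2) ?_ (.of_forall fun ω => ?_)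
        · refine Measurable.aestronglyMeasurable (Measurable.pow_const ?_ 2)
          refine Finset.measurable_sum _ fun y _ => ?_
          refine Measurable.ite (measurableSet_of_hash H i fun g _ => g y = g x) ?_
            measurable_const
          exact ((measurable_of_finite sgn).comp (H.measurable_s i y)).mul_const _
        · rw [Real.norm_eq_abs, abs_pow]
          refine pow_le_pow_left₀ (abs_nonneg _) ?_ 2
          refine (Finset.abs_sum_le_sum_abs _ _).trans (Finset.sum_le_sum fun y _ => ?_)
          split_ifs
          · rw [abs_mul, abs_sgn, one_mul]
          · simp
  calc _ ≤ _ := measureReal_mono hsub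
    _ ≤ _ := measureReal_union_le _ _
    _ ≤ q / 2 + q / 2 := add_le_add h1 h2
    _ = q := by ring

open scoped Classical in
/-- With high probability, the majority of the rows of `CountSketch` estimate all keys well. -/
theorem IsCountSketchHash.failure_le (H : IsCountSketchHash P h s) (f : Fin n → ℝ)
    (J : Finset (Fin n)) {ε : ℝ} (hε : 0 ≤ ε) (hJ : (J.card : ℝ) ≤ w * (Real.exp (-4) / 2))
    (hf : ∑ y ∈ Finset.univ \ J, f y ^ 2 ≤ w * (Real.exp (-4) / 2) * ε ^ 2) :
    P.real {ω | ∃ x, d - d / 2 ≤ (Finset.univ.filter fun i =>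
      ε < |rowEstimate (fun y => h i y ω) (fun y => s i y ω) f x - f x|).card} ≤
      n * Real.exp (-d) := by
  have hset : {ω | ∃ x, d - d / 2 ≤ (Finset.univ.filter fun i =>
      ε < |rowEstimate (fun y => h i y ω) (fun y => s i y ω) f x - f x|).card} =
      ⋃ x ∈ (Finset.univ : Finset (Fin n)), {ω | d - d / 2 ≤ (Finset.univ.filter fun i =>
      ε < |rowEstimate (fun y => h i y ω) (fun y => s i y ω) f x - f x|).card} := by
    ext; simp
  rw [hset]
  refine (measureReal_biUnion_finset_le _ _).trans ?_
  have key : ∀ x, P.real {ω | d - d / 2 ≤ (Finset.univ.filter fun i =>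
      ε < |rowEstimate (fun y => h i y ω) (fun y => s i y ω) f x - f x|).card} ≤
      Real.exp (-d) := by
    intro x
    set φ : (Fin n → Fin w) × (Fin n → Bool) → ℝ :=
      fun g => if ε < |rowEstimate g.1 g.2 f x - f x| then 1 else 0 with hφ
    have hφm : Measurable φ := measurable_of_finite _
    set X : Fin d → Ω → ℝ := fun i ω => φ (fun y => h i y ω, fun y => s i y ω) with hX
    have hXm : ∀ i, Measurable (X i) := fun i => hφm.comp
      ((measurable_pi_lambda _ fun y => H.measurable_h i y).prodMk
      (measurable_pi_lambda _ fun y => H.measurable_s i y))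
    have h01 : ∀ i ω, X i ω ∈ Set.Icc (0 : ℝ) 1 := by
      intro i ω
      simp only [hX, hφ]
      split_ifs <;> simp
    have hind : iIndepFun X P := H.indep_rows.comp (fun _ => φ) fun _ => hφm
    have hmean : ∑ i, ∫ ω, X i ω ∂P ≤ d * Real.exp (-4) := by
      refine (Finset.sum_le_card_nsmul _ _ (Real.exp (-4)) fun i _ => ?_).trans_eq (by simp)
      have h1 : X i = {ω | ε < |rowEstimate (fun y => h i y ω) (fun y => s i y ω) f x
          - f x|}.indicator 1 := by
        ext ω
        simp only [hX, hφ, Set.indicator_apply, Set.mem_ofPred_eq, Pi.one_apply]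
      rw [h1, integral_indicator_one
        (measurableSet_of_hash H i fun g b => ε < |rowEstimate g b f x - f x|)]
      exact H.row_failure_le i x f J hε hJ hf
    -- The row failure probability `exp (-4)` is matched with `θ = 4`: the exponent `(exp 4 - 1) d
    -- exp (-4) - 4 d / 2` is at most `d - 2 d = -d`.
    refine le_trans (measureReal_mono (fun ω hω => ?_))
      ((measureReal_le_sum_le hXm h01 hind Finset.univ hmean (θ := 4) (by norm_num)
        ((d : ℝ) / 2)).trans ?_)
    · change (d : ℝ) / 2 ≤ ∑ i, X i ω
      simp only [hX, hφ, Finset.sum_boole]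
      have h1 : d ≤ 2 * (Finset.univ.filter fun i =>
        ε < |rowEstimate (fun y => h i y ω) (fun y => s i y ω) f x - f x|).card := by
        have : d - d / 2 ≤ _ := hω
        omega
      have h2 : (d : ℝ) ≤ 2 * ((Finset.univ.filter fun i =>
        ε < |rowEstimate (fun y => h i y ω) (fun y => s i y ω) f x - f x|).card : ℝ) := by
        exact_mod_cast h1
      linarith
    · refine Real.exp_le_exp.2 ?_
      have h1 : Real.exp 4 * Real.exp (-4) = 1 := by rw [← Real.exp_add]; simp
      have h2 : 0 ≤ (d : ℝ) * Real.exp (-4) := by positivity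
      linear_combination (d : ℝ) * h1 + h2
  exact (Finset.sum_le_card_nsmul _ _ _ fun x _ => key x).trans_eq (by simp)

end Hash

/-! ### Independent exponential variables: shifting and halving -/

section Exponential

open scoped ENNReal

local instance isProbabilityMeasure_expMeasure_one : IsProbabilityMeasure (expMeasure 1) :=
  isProbabilityMeasure_expMeasure one_pos

theorem expMeasure_one_eq : expMeasure 1 = volume.withDensity (exponentialPDF 1) := rfl

theorem measurable_exponentialPDF_one : Measurable (exponentialPDF 1) :=
  (measurable_exponentialPDFReal 1).ennreal_ofReal

theorem exponentialPDF_one_of_nonneg {x : ℝ} (hx : 0 ≤ x) :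
    exponentialPDF 1 x = ENNReal.ofReal (Real.exp (-x)) := by
  rw [exponentialPDF_of_nonneg hx]; simp

/-- The density is at most 1 on the half-line. Since only upper bounds on moments are needed, they
can be computed with Lebesgue measure. -/
theorem expMeasure_one_le : expMeasure 1 ≤ volume.restrict (Set.Ioi 0) := by
  rw [Measure.restrict_congr_set Ioi_ae_eq_Ici]
  refine Measure.le_iff.2 fun A hA => ?_
  rw [expMeasure_one_eq, withDensity_apply _ hA, Measure.restrict_apply hA]
  calc ∫⁻ a in A, exponentialPDF 1 a ≤ ∫⁻ a in A, (Set.Ici 0).indicator 1 a := by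
        refine lintegral_mono fun x => ?_
        by_cases hx : 0 ≤ x
        · rw [exponentialPDF_one_of_nonneg hx, Set.indicator_of_mem (by exact hx)]
          simpa using hx
        · rw [exponentialPDF_of_neg (not_le.1 hx)]; exact zero_le
    _ = volume (A ∩ Set.Ici 0) := by
        rw [lintegral_indicator_one measurableSet_Ici, Measure.restrict_apply measurableSet_Ici,
          Set.inter_comm]

theorem ae_expMeasure_one_pos : ∀ᵐ x ∂expMeasure 1, 0 < x :=
  (Measure.absolutelyContinuous_of_le expMeasure_one_le).ae_le
    (ae_restrict_mem measurableSet_Ioi)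

theorem nullSingletonClass_expMeasure_one : NullSingletonClass (expMeasure 1) :=
  ⟨fun x => withDensity_absolutelyContinuous _ _ (measure_singleton x)⟩

/-- The exponential distribution is memoryless. -/
theorem expMeasure_one_shift {a : ℝ} (ha : 0 ≤ a) {A : Set ℝ} (hA : MeasurableSet A) :
    expMeasure 1 {y | a ≤ y ∧ y - a ∈ A} = ENNReal.ofReal (Real.exp (-a)) * expMeasure 1 A := by
  have hS : MeasurableSet {y : ℝ | a ≤ y ∧ y - a ∈ A} :=
    measurableSet_Ici.inter ((measurable_id.sub_const a) hA)
  rw [expMeasure_one_eq, withDensity_apply _ hA, withDensity_apply _ hS,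
    ← lintegral_indicator hS, ← lintegral_indicator hA,
    ← lintegral_const_mul _ (measurable_exponentialPDF_one.indicator hA),
    ← lintegral_sub_right_eq_self
      (fun y => ENNReal.ofReal (Real.exp (-a)) * A.indicator (exponentialPDF 1) y) a]
  refine lintegral_congr fun y => ?_
  by_cases hy : a ≤ y
  · by_cases hyA : y - a ∈ A
    · rw [Set.indicator_of_mem (by exact ⟨hy, hyA⟩), Set.indicator_of_mem hyA,
        exponentialPDF_one_of_nonneg (ha.trans hy), exponentialPDF_one_of_nonneg (sub_nonneg.2 hy),
        ← ENNReal.ofReal_mul (Real.exp_pos _).le, ← Real.exp_add]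
      congr 2; ring
    · rw [Set.indicator_of_notMem (fun h => hyA h.2), Set.indicator_of_notMem hyA, mul_zero]
  · rw [Set.indicator_of_notMem (fun h => hy h.1)]
    by_cases hyA : y - a ∈ A
    · rw [Set.indicator_of_mem hyA, exponentialPDF_of_neg (by linarith), mul_zero]
    · rw [Set.indicator_of_notMem hyA, mul_zero]

/-- The law of `y / 2` has density `2 exp (-2 x) ≤ 2 exp (-x)`. -/
theorem map_half_expMeasure_one_le :
    (expMeasure 1).map (fun y => y / 2) ≤ (2 : ℝ≥0) • expMeasure 1 := by
  refine Measure.le_iff.2 fun A hA => ?_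
  have hm : Measurable fun y : ℝ => y / 2 := measurable_id.div_const 2
  rw [Measure.map_apply hm hA, expMeasure_one_eq, withDensity_apply _ (hm hA), Measure.smul_apply,
    withDensity_apply _ hA, ← lintegral_indicator (hm hA), ← lintegral_indicator hA]
  have hvol : (volume : Measure ℝ) = ENNReal.ofReal |2| • volume.map (fun x => 2 * x) :=
    (Real.smul_map_volume_mul_left two_ne_zero).symm
  rw [hvol, lintegral_smul_measure, ← hvol,
    lintegral_map (measurable_exponentialPDF_one.indicator (hm hA)) (measurable_const_mul 2)]
  have h2 : ENNReal.ofReal |2| = ((2 : ℝ≥0) : ℝ≥0∞) := by norm_num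
  rw [h2, ENNReal.smul_def]
  refine mul_le_mul_right (lintegral_mono fun y => ?_) _
  by_cases hyA : y ∈ A
  · rw [Set.indicator_of_mem (by simpa using hyA), Set.indicator_of_mem hyA]
    by_cases hy : 0 ≤ y
    · rw [exponentialPDF_one_of_nonneg hy, exponentialPDF_one_of_nonneg (by positivity)]
      exact ENNReal.ofReal_le_ofReal (Real.exp_le_exp.2 (by linarith))
    · rw [exponentialPDF_of_neg (by linarith)]; exact zero_le
  · rw [Set.indicator_of_notMem (by simpa using hyA)]; exact zero_le

/-- `OuterMeasure.pi` is the largest outer measure below the product on boxes, so it suffices to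
compare on boxes. -/
theorem pi_mono_of_le {ι : Type*} [Fintype ι] {α : ι → Type*} [∀ i, MeasurableSpace (α i)]
    {μ ν : ∀ i, Measure (α i)} [∀ i, SigmaFinite (μ i)] (h : ∀ i, μ i ≤ ν i) :
    Measure.pi μ ≤ Measure.pi ν := by
  refine Measure.le_iff.2 fun A hA => ?_
  have h1 : (Measure.pi μ).toOuterMeasure ≤ OuterMeasure.pi fun i => (ν i).toOuterMeasure := by
    refine OuterMeasure.le_pi.2 fun s _ => ?_
    change Measure.pi μ (Set.univ.pi s) ≤ _
    rw [Measure.pi_pi]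
    exact Finset.prod_le_prod' fun i _ => h i (s i)
  refine (h1 A).trans_eq ?_
  rw [Measure.pi, toMeasure_apply _ _ hA]

theorem pi_const_smul {ι : Type*} [Fintype ι] (c : ℝ≥0) (μ : Measure ℝ) [SigmaFinite μ] :
    Measure.pi (fun _ : ι => c • μ) = c ^ Fintype.card ι • Measure.pi fun _ : ι => μ := by
  refine Measure.pi_eq fun s _ => ?_
  simp only [Measure.smul_apply, Measure.pi_pi, ENNReal.smul_def, smul_eq_mul,
    Finset.prod_mul_distrib, Finset.prod_const, Finset.card_univ, ENNReal.coe_pow]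

/-- Halving independent exponential variables changes the measure by a bounded factor. -/
theorem map_half_pi_expMeasure_one_le (ι : Type*) [Fintype ι] :
    (Measure.pi fun _ : ι => expMeasure 1).map (fun a i => a i / 2) ≤
      (2 : ℝ≥0) ^ Fintype.card ι • Measure.pi fun _ : ι => expMeasure 1 := by
  have hm : Measurable fun y : ℝ => y / 2 := measurable_id.div_const 2
  have : IsProbabilityMeasure ((expMeasure 1).map fun y : ℝ => y / 2) :=
    Measure.isProbabilityMeasure_map hm.aemeasurable
  have h1 := Measure.pi_map_pi (μ := fun _ : ι => expMeasure 1) (f := fun _ y => y / 2)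
    fun _ => hm.aemeasurable
  rw [h1, ← pi_const_smul]
  exact pi_mono_of_le fun _ => map_half_expMeasure_one_le

/-- Memorylessness in every coordinate: restricted to the shifted orthant and moved back, the
product measure is a multiple of itself. This identity of measures is checked on boxes and then
holds for all measurable `G`. -/
theorem pi_expMeasure_one_shift {ι : Type*} [Fintype ι] {v : ι → ℝ} (hv : ∀ x, 0 ≤ v x)
    {G : Set (ι → ℝ)} (hG : MeasurableSet G) :
    (Measure.pi fun _ : ι => expMeasure 1) {b | (∀ x, v x ≤ b x) ∧ (fun x => b x - v x) ∈ G} =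
      ENNReal.ofReal (Real.exp (-∑ x, v x)) * (Measure.pi fun _ : ι => expMeasure 1) G := by
  set μ := Measure.pi fun _ : ι => expMeasure 1 with hμ
  set f : (ι → ℝ) → ι → ℝ := fun b x => b x - v x with hf
  have hfm : Measurable f := by fun_prop
  set S : Set (ι → ℝ) := {b | ∀ x, v x ≤ b x} with hS
  have hSm : MeasurableSet S := by
    rw [hS, Set.ofPred_forall]
    exact MeasurableSet.iInter fun x => measurableSet_le measurable_const (measurable_pi_apply x)
  have hc : ENNReal.ofReal (Real.exp (∑ x, v x)) * ENNReal.ofReal (Real.exp (-∑ x, v x)) = 1 := by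
    rw [← ENNReal.ofReal_mul (Real.exp_pos _).le, ← Real.exp_add]; simp
  have h1 : μ = ENNReal.ofReal (Real.exp (∑ x, v x)) • (μ.restrict S).map f := by
    refine Measure.pi_eq fun A hA => ?_
    have hbox : f ⁻¹' (Set.univ.pi A) ∩ S =
        Set.univ.pi fun x => {y | v x ≤ y ∧ y - v x ∈ A x} := by
      ext b
      simp only [hf, hS, Set.mem_inter_iff, Set.mem_preimage, Set.mem_univ_pi, Set.mem_ofPred_eq,
        ← forall_and]
      exact forall_congr' fun x => and_comm
    rw [Measure.smul_apply, Measure.map_apply hfm (MeasurableSet.univ_pi hA),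
      Measure.restrict_apply (hfm (MeasurableSet.univ_pi hA)), hbox, hμ, Measure.pi_pi,
      Finset.prod_congr rfl fun x _ => expMeasure_one_shift (hv x) (hA x),
      Finset.prod_mul_distrib, ← ENNReal.ofReal_prod_of_nonneg fun x _ => (Real.exp_pos _).le,
      ← Real.exp_sum, Finset.sum_neg_distrib, smul_eq_mul, ← mul_assoc, hc, one_mul]
  have hset : {b | (∀ x, v x ≤ b x) ∧ (fun x => b x - v x) ∈ G} = f ⁻¹' G ∩ S := by
    ext b; exact and_comm
  rw [hset]
  conv_rhs => rw [h1, Measure.smul_apply, Measure.map_apply hfm hG,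
    Measure.restrict_apply (hfm hG), smul_eq_mul, ← mul_assoc, mul_comm (ENNReal.ofReal _), hc,
    one_mul]

/-- The probability of an event on the excess of independent exponential variables over
thresholds that are proportional to weights. -/
theorem prod_pi_expMeasure_one_shift {α ι : Type*} [MeasurableSpace α] [Fintype ι]
    (ν : Measure α) [SFinite ν] {s : α → ℝ} (hs : Measurable s) {w : ι → ℝ} (hw : ∀ x, 0 ≤ w x)
    {F : Set α} (hF : MeasurableSet F) (hF0 : ∀ a ∈ F, 0 ≤ s a) {G : Set (ι → ℝ)}
    (hG : MeasurableSet G) :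
    (ν.prod (Measure.pi fun _ : ι => expMeasure 1)) {z | z.1 ∈ F ∧ (∀ x, s z.1 * w x ≤ z.2 x) ∧
        (fun x => z.2 x - s z.1 * w x) ∈ G} =
      (Measure.pi fun _ : ι => expMeasure 1) G *
        ∫⁻ a in F, ENNReal.ofReal (Real.exp (-(s a * ∑ x, w x))) ∂ν := by
  have hm : MeasurableSet {z : α × (ι → ℝ) | z.1 ∈ F ∧ (∀ x, s z.1 * w x ≤ z.2 x) ∧
        (fun x => z.2 x - s z.1 * w x) ∈ G} := by
    refine (measurable_fst hF).inter (MeasurableSet.inter ?_ ?_)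
    · change MeasurableSet {z : α × (ι → ℝ) | ∀ x, s z.1 * w x ≤ z.2 x}
      rw [Set.ofPred_forall]
      exact MeasurableSet.iInter fun x => measurableSet_le (by fun_prop) (by fun_prop)
    · exact (by fun_prop : Measurable fun z : α × (ι → ℝ) => fun x => z.2 x - s z.1 * w x) hG
  rw [Measure.prod_apply hm, ← lintegral_indicator hF, ← lintegral_const_mul _ (by
    refine Measurable.indicator ?_ hF; fun_prop)]
  refine lintegral_congr fun a => ?_
  by_cases ha : a ∈ F
  · rw [Set.indicator_of_mem ha, mul_comm, Finset.mul_sum,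
      ← pi_expMeasure_one_shift (fun x => mul_nonneg (hF0 a ha) (hw x)) hG]
    congr 1
    ext b
    simp [ha]
  · rw [Set.indicator_of_notMem ha, mul_zero]
    convert measure_empty (μ := Measure.pi fun _ : ι => expMeasure 1)
    ext b
    simp [ha]

/-- A tail bound for a homogeneous statistic `s` of independent exponential variables on a cone
`F`, with respect to the weight `exp (-s W)`. -/
theorem lintegral_tail_le {ι : Type*} [Fintype ι] {s : (ι → ℝ) → ℝ} (hs : Measurable s)
    (hs2 : ∀ a, s (fun i => a i / 2) = s a / 2) {F : Set (ι → ℝ)} (hF : MeasurableSet F)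
    (hF2 : ∀ a, (fun i => a i / 2) ∈ F ↔ a ∈ F) {W : ℝ} (hW : 0 ≤ W) (T : ℝ) :
    ∫⁻ a in F ∩ {a | T < s a}, ENNReal.ofReal (Real.exp (-(s a * W)))
        ∂(Measure.pi fun _ : ι => expMeasure 1) ≤
      ENNReal.ofReal (2 ^ Fintype.card ι * Real.exp (-(T * W / 2))) *
        ∫⁻ a in F, ENNReal.ofReal (Real.exp (-(s a * W)))
          ∂(Measure.pi fun _ : ι => expMeasure 1) := by
  set μ := Measure.pi fun _ : ι => expMeasure 1 with hμ
  set g : (ι → ℝ) → ℝ≥0∞ := F.indicator fun a => ENNReal.ofReal (Real.exp (-(s a * W))) with hg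
  have hgm : Measurable g := by refine Measurable.indicator ?_ hF; fun_prop
  have hTm : MeasurableSet {a | T < s a} := measurableSet_lt measurable_const hs
  have hhalf : Measurable fun (a : ι → ℝ) i => a i / 2 := by fun_prop
  rw [← lintegral_indicator (hF.inter hTm), ← lintegral_indicator hF]
  -- Half of the exponent is kept as the weight at `a / 2`, and the other half is at least `T W / 2`
  -- where `T < s a`. Undoing the halving then costs a factor 2 per coordinate.
  have h1 : ∀ a, (F ∩ {a | T < s a}).indicator
      (fun a => ENNReal.ofReal (Real.exp (-(s a * W)))) a ≤
      ENNReal.ofReal (Real.exp (-(T * W / 2))) * g (fun i => a i / 2) := by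
    intro a
    by_cases ha : a ∈ F ∩ {a | T < s a}
    · rw [Set.indicator_of_mem ha, hg, Set.indicator_of_mem ((hF2 a).2 ha.1), hs2,
        ← ENNReal.ofReal_mul (Real.exp_pos _).le, ← Real.exp_add]
      refine ENNReal.ofReal_le_ofReal (Real.exp_le_exp.2 ?_)
      have : T < s a := ha.2
      nlinarith
    · rw [Set.indicator_of_notMem ha]; exact zero_le
  refine (lintegral_mono h1).trans ?_
  have h2 : Measurable fun a : ι → ℝ => g fun i => a i / 2 := hgm.comp hhalf
  rw [lintegral_const_mul _ h2, ← lintegral_map hgm hhalf]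
  refine (mul_le_mul_right (lintegral_mono' (map_half_pi_expMeasure_one_le ι) le_rfl) _).trans ?_
  rw [ENNReal.smul_def, lintegral_smul_measure, smul_eq_mul, ← mul_assoc]
  refine mul_le_mul_left (le_of_eq ?_) _
  rw [mul_comm, ENNReal.ofReal_mul (by positivity), ENNReal.ofReal_pow (by norm_num)]
  norm_num

end Exponential

/-! ### Truncated inverse moments of an exponential variable -/

section Moments

attribute [local instance] isProbabilityMeasure_expMeasure_one

theorem integral_expMeasure_one_le {X Y : ℝ → ℝ} (hX : Measurable X) (hX0 : ∀ r, 0 ≤ X r)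
    (hXY : ∀ r, 0 < r → X r ≤ Y r) (hY : IntegrableOn Y (Set.Ioi 0)) :
    ∫ r, X r ∂expMeasure 1 ≤ ∫ r in Set.Ioi 0, Y r := by
  have hXi : IntegrableOn X (Set.Ioi 0) := by
    refine Integrable.mono' hY hX.aestronglyMeasurable ?_
    filter_upwards [ae_restrict_mem measurableSet_Ioi] with r hr
    rw [Real.norm_eq_abs, abs_of_nonneg (hX0 r)]
    exact hXY r hr
  exact (integral_mono_measure expMeasure_one_le (.of_forall hX0) hXi).trans
    (setIntegral_mono_on hXi hY measurableSet_Ioi hXY)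

theorem integral_indicator_expMeasure_one_le {b : ℝ} (hb : 0 ≤ b) :
    ∫ r, (if r < b then (1 : ℝ) else 0) ∂expMeasure 1 ≤ b := by
  have hi : ∀ r : ℝ, (if r < b then (1 : ℝ) else 0) = (Set.Iio b).indicator 1 r := by
    intro r; simp [Set.indicator_apply]
  have h1 : (Set.Iio b ∩ Set.Ioi 0) = Set.Ioo 0 b := by ext; simp [and_comm]
  have h2 := integral_expMeasure_one_le (X := fun r => if r < b then (1 : ℝ) else 0)
    (Y := (Set.Iio b).indicator 1)
    (Measurable.ite measurableSet_Iio measurable_const measurable_const)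
    (fun r => by split_ifs <;> norm_num) (fun r _ => (hi r).le) ?_
  · refine h2.trans_eq ?_
    rw [integral_indicator_one measurableSet_Iio, measureReal_def,
      Measure.restrict_apply measurableSet_Iio, h1, Real.volume_Ioo, sub_zero,
      ENNReal.toReal_ofReal hb]
  · rw [IntegrableOn, integrable_indicator_iff measurableSet_Iio, IntegrableOn,
      Measure.restrict_restrict measurableSet_Iio, h1]
    exact integrable_const _

/-- The function `min 1 ((a / r) ^ ρ)` for `r > 0`. -/
noncomputable def decay (ρ a r : ℝ) : ℝ := if r ≤ a then 1 else (a / r) ^ ρ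

variable {ρ a : ℝ}

theorem measurable_decay (ρ a : ℝ) : Measurable (decay ρ a) :=
  Measurable.ite measurableSet_Iic measurable_const
    ((measurable_const.div measurable_id).pow_const ρ)

theorem decay_nonneg (ha : 0 ≤ a) (r : ℝ) : 0 ≤ decay ρ a r := by
  unfold decay
  split_ifs with h
  · exact zero_le_one
  · exact Real.rpow_nonneg (div_nonneg ha (ha.trans (not_le.1 h).le)) _

theorem decay_le_one (hρ : 0 ≤ ρ) (ha : 0 ≤ a) (r : ℝ) : decay ρ a r ≤ 1 := by
  unfold decay
  split_ifs with h
  · exact le_rfl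
  · have hr := ha.trans (not_le.1 h).le
    exact Real.rpow_le_one (div_nonneg ha hr) (div_le_one_of_le₀ (not_le.1 h).le hr) hρ

/-- An excess is at most the variable itself, so this carries bounds from the excesses over to the
variables; it has to hold for negative arguments too, where `decay` is 1. -/
theorem decay_antitone (hρ : 0 ≤ ρ) (ha : 0 ≤ a) : Antitone (decay ρ a) := by
  intro r r' hrr
  by_cases h : r ≤ a
  · refine (decay_le_one hρ ha r').trans_eq ?_
    rw [decay, if_pos h]
  · have h' : ¬ r' ≤ a := fun h' => h (hrr.trans h')
    rw [decay, decay, if_neg h, if_neg h']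
    have hr : 0 < r := ha.trans_lt (not_le.1 h)
    exact Real.rpow_le_rpow (div_nonneg ha (hr.le.trans hrr))
      (div_le_div_of_nonneg_left ha hr hrr) hρ

/-- The interval up to `a` contributes `a`, and the power tail contributes `a / (ρ - 1)`. -/
theorem integral_decay_le (hρ : 1 < ρ) (ha : 0 < a) :
    ∫ r, decay ρ a r ∂expMeasure 1 ≤ a * (ρ / (ρ - 1)) := by
  have hpow : ∀ r ∈ Set.Ioi a, (a / r) ^ ρ = a ^ ρ * r ^ (-ρ) := by
    intro r hr
    have hr' : 0 < r := ha.trans hr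
    rw [Real.div_rpow ha.le hr'.le, Real.rpow_neg hr'.le, div_eq_mul_inv]
  have hIoi : IntegrableOn (decay ρ a) (Set.Ioi a) := by
    have : IntegrableOn (fun r : ℝ => a ^ ρ * r ^ (-ρ)) (Set.Ioi a) :=
      (integrableOn_Ioi_rpow_of_lt (by linarith) ha).const_mul _
    refine this.congr_fun (fun r hr => ?_) measurableSet_Ioi
    rw [decay, if_neg (not_le.2 hr)]; exact (hpow r hr).symm
  have hIoc : IntegrableOn (decay ρ a) (Set.Ioc 0 a) := by
    refine (integrableOn_const (C := (1 : ℝ)) (by simp)).congr_fun (fun r hr => ?_)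
      measurableSet_Ioc
    rw [decay, if_pos hr.2]
  have hU : Set.Ioi 0 = Set.Ioc 0 a ∪ Set.Ioi a := (Set.Ioc_union_Ioi_eq_Ioi ha.le).symm
  refine (integral_expMeasure_one_le (measurable_decay ρ a) (decay_nonneg ha.le)
    (fun r _ => le_rfl) (hU ▸ hIoc.union hIoi)).trans_eq ?_
  rw [hU, setIntegral_union (Set.Ioc_disjoint_Ioi le_rfl) measurableSet_Ioi hIoc hIoi,
    setIntegral_congr_fun (g := fun _ => (1 : ℝ)) measurableSet_Ioc
      (fun r hr => by rw [decay, if_pos hr.2]),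
    setIntegral_congr_fun (g := fun r => a ^ ρ * r ^ (-ρ)) measurableSet_Ioi
      (fun r hr => by rw [decay, if_neg (not_le.2 hr)]; exact hpow r hr),
    integral_const_mul, integral_Ioi_rpow_of_lt (by linarith) ha]
  have h1 : a ^ ρ * a ^ (-ρ + 1) = a := by
    rw [← Real.rpow_add ha]; simp
  have h2 : ρ - 1 ≠ 0 := by linarith
  have h3 : -ρ + 1 ≠ 0 := by linarith
  have h4 : ∫ r in Set.Ioc 0 a, (1 : ℝ) = a := by simp [ha.le]
  rw [h4]
  have h5 : a ^ ρ * (-a ^ (-ρ + 1) / (-ρ + 1)) = a / (ρ - 1) := by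
    rw [mul_div_assoc', mul_neg, h1, show -ρ + 1 = -(ρ - 1) by ring, neg_div_neg_eq]
  rw [h5]
  field_simp
  ring

/-- For exponent 1 the Lebesgue integral diverges. It is cut off at `N * a`: below, it gives `a + a
log N`; beyond, the integrand is at most `1 / N` and the total mass is 1. Taking `N = n` later on
produces the factor `log n`. -/
theorem integral_decay_one_le (ha : 0 < a) {N : ℝ} (hN : 1 ≤ N) :
    ∫ r, decay 1 a r ∂expMeasure 1 ≤ a * (1 + Real.log N) + 1 / N := by
  have hN0 : 0 < N := by linarith
  have haN : a ≤ N * a := le_mul_of_one_le_left ha.le hN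
  set Y : ℝ → ℝ := (Set.Iic (N * a)).indicator (decay 1 a) with hY
  have hYm : Measurable Y := (measurable_decay 1 a).indicator measurableSet_Iic
  have hle : ∀ r, decay 1 a r ≤ Y r + 1 / N := by
    intro r
    by_cases hr : r ≤ N * a
    · rw [hY, Set.indicator_of_mem (by exact hr)]
      exact le_add_of_nonneg_right (by positivity)
    · have hr' := not_le.1 hr
      rw [hY, Set.indicator_of_notMem (by exact hr), zero_add, decay,
        if_neg (not_le.2 (haN.trans_lt hr')), Real.rpow_one,
        div_le_div_iff₀ (ha.trans (haN.trans_lt hr')) hN0]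
      linarith
  have hY0 : ∀ r, 0 ≤ Y r := Set.indicator_nonneg fun r _ => decay_nonneg ha.le r
  have hint : ∀ {f : ℝ → ℝ}, Measurable f → (∀ r, 0 ≤ f r) → (∀ r, f r ≤ 1) →
      Integrable f (expMeasure 1) := fun hf h0 h1 =>
    Integrable.of_bound hf.aestronglyMeasurable 1 (.of_forall fun r => by
      rw [Real.norm_eq_abs, abs_of_nonneg (h0 r)]; exact h1 r)
  have hYi : Integrable Y (expMeasure 1) := hint hYm hY0 fun r =>
    (Set.indicator_le_self' (fun r _ => decay_nonneg ha.le r) r).trans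
      (decay_le_one zero_le_one ha.le r)
  have h1 : ∫ r, decay 1 a r ∂expMeasure 1 ≤ ∫ r, Y r ∂expMeasure 1 + 1 / N := by
    refine (integral_mono (hint (measurable_decay 1 a) (decay_nonneg ha.le)
      (decay_le_one zero_le_one ha.le)) (hYi.add (integrable_const _)) hle).trans_eq ?_
    simp only [Pi.add_apply]
    rw [integral_add hYi (integrable_const _)]
    simp
  refine h1.trans (add_le_add_left ?_ _)
  have hIoc : IntegrableOn (decay 1 a) (Set.Ioc 0 a) := by
    refine (integrableOn_const (C := (1 : ℝ)) (by simp)).congr_fun (fun r hr => ?_)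
      measurableSet_Ioc
    rw [decay, if_pos hr.2]
  have hinv : IntegrableOn (fun r : ℝ => a * r⁻¹) (Set.Ioc a (N * a)) := by
    refine ((ContinuousOn.integrableOn_Icc ?_).mono_set Set.Ioc_subset_Icc_self)
    exact continuousOn_const.mul
      (continuousOn_inv₀.mono fun r hr => (ha.trans_le hr.1).ne')
  have hIoc' : IntegrableOn (decay 1 a) (Set.Ioc a (N * a)) := by
    refine hinv.congr_fun (fun r hr => ?_) measurableSet_Ioc
    rw [decay, if_neg (not_le.2 hr.1), Real.rpow_one, div_eq_mul_inv]
  have hI : Set.Iic (N * a) ∩ Set.Ioi 0 = Set.Ioc 0 a ∪ Set.Ioc a (N * a) := by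
    rw [Set.Ioc_union_Ioc_eq_Ioc ha.le haN]; ext; simp [and_comm]
  refine (integral_expMeasure_one_le hYm hY0 (fun r _ => le_rfl) ?_).trans_eq ?_
  · rw [IntegrableOn, integrable_indicator_iff measurableSet_Iic, IntegrableOn,
      Measure.restrict_restrict measurableSet_Iic, hI]
    exact hIoc.union hIoc'
  · rw [integral_indicator measurableSet_Iic, Measure.restrict_restrict measurableSet_Iic, hI,
      setIntegral_union (Set.Ioc_disjoint_Ioc_of_le le_rfl) measurableSet_Ioc hIoc hIoc',
      setIntegral_congr_fun (f := decay 1 a) (g := fun _ => (1 : ℝ)) (s := Set.Ioc 0 a)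
        measurableSet_Ioc (fun r hr => by rw [decay, if_pos hr.2]),
      setIntegral_congr_fun (f := decay 1 a) (g := fun r => a * r⁻¹) (s := Set.Ioc a (N * a))
        measurableSet_Ioc (fun r hr => by
          rw [decay, if_neg (not_le.2 hr.1), Real.rpow_one, div_eq_mul_inv]),
      integral_const_mul, ← intervalIntegral.integral_of_le haN,
      integral_inv_of_pos ha (by positivity), mul_div_cancel_right₀ _ ha.ne']
    have h4 : ∫ r in Set.Ioc 0 a, (1 : ℝ) = a := by simp [ha.le]
    rw [h4]; ring

end Moments

/-! ### Chernoff bounds for functions of exponential variables -/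

section Concentration

open scoped ENNReal

attribute [local instance] isProbabilityMeasure_expMeasure_one

variable {ι : Type*} [Fintype ι]

theorem pi_expMeasure_one_le_sum_le {g : ι → ℝ → ℝ} (hg : ∀ x, Measurable (g x))
    (h01 : ∀ x r, g x r ∈ Set.Icc (0 : ℝ) 1) {μ t k : ℝ}
    (hμ : ∑ x, ∫ r, g x r ∂expMeasure 1 ≤ μ) (hμ0 : 0 ≤ μ) (ht : 2 * μ + k ≤ t) :
    (Measure.pi fun _ : ι => expMeasure 1) {b | t ≤ ∑ x, g x (b x)} ≤
      ENNReal.ofReal (Real.exp (-k)) := by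
  have hind : iIndepFun (fun (x : ι) (b : ι → ℝ) => g x (b x))
      (Measure.pi fun _ : ι => expMeasure 1) :=
    iIndepFun_pi (X := g) fun x => (hg x).aemeasurable
  have hmean : ∀ x, ∫ b : ι → ℝ, g x (b x) ∂(Measure.pi fun _ : ι => expMeasure 1) =
      ∫ r, g x r ∂expMeasure 1 := fun x =>
    integral_comp_eval (μ := fun _ : ι => expMeasure 1) (hg x).aestronglyMeasurable
  have h1 := measureReal_le_sum_le (X := fun (x : ι) (b : ι → ℝ) => g x (b x))
    (fun x => (hg x).comp (measurable_pi_apply x)) (fun x b => h01 x (b x)) hind Finset.univ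
    (μ := μ) (θ := 1) (by simpa only [hmean] using hμ) zero_le_one t
  rw [← ofReal_measureReal]
  refine ENNReal.ofReal_le_ofReal (h1.trans (Real.exp_le_exp.2 ?_))
  -- With `θ = 1` the exponent is `(e - 1) μ - t`, and `e - 1 < 2`.
  have := Real.exp_one_lt_d9
  nlinarith

theorem measurableSet_le_sum {g : ι → ℝ → ℝ} (hg : ∀ x, Measurable (g x)) (t : ℝ) :
    MeasurableSet {b : ι → ℝ | t ≤ ∑ x, g x (b x)} :=
  measurableSet_le measurable_const
    (Finset.measurable_sum _ fun x _ => (hg x).comp (measurable_pi_apply x))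

end Concentration

/-! ### The variables beyond the k smallest ratios -/

section OrderStatistics

open scoped ENNReal

attribute [local instance] isProbabilityMeasure_expMeasure_one

variable {ι : Type*} [Fintype ι]

/-- Given which `k` weighted exponential variables are the smallest, and in which order, it is
unlikely that the next one is large, that many others are moderately small, or that the others have
a large sum of inverse powers. -/
theorem conditional_failure_le {k : ℕ} {j : Fin k} {c : Fin k → ℝ}
    (hc : ∀ i, 0 < c i) {w : ι → ℝ} (hw : ∀ x, 0 < w x) {M ρ μ Λ : ℝ} (hM : 0 < M)
    (hMW : M * ∑ x, w x = 16 * k) (hρ : 0 ≤ ρ)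
    (hμ : ∑ x, ∫ r, decay ρ (M * w x) r ∂expMeasure 1 ≤ μ) (hΛ : 2 * μ + k ≤ Λ) :
    ((Measure.pi fun _ : Fin k => expMeasure 1).prod (Measure.pi fun _ : ι => expMeasure 1))
      ({z | ((∀ i, 0 ≤ z.1 i) ∧ Monotone fun i => z.1 i / c i) ∧
          ∀ x, z.1 j / c j * w x ≤ z.2 x} \
        {z | z.1 j / c j ≤ M ∧ (∃ x, z.2 x ≤ M * w x) ∧
          ∑ x, (if z.2 x < 16 * (M * w x) then (1 : ℝ) else 0) < 513 * k ∧
          ∑ x, decay ρ (M * w x) (z.2 x) < Λ}) ≤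
      ENNReal.ofReal (3 * Real.exp (-(k : ℝ))) *
    ((Measure.pi fun _ : Fin k => expMeasure 1).prod (Measure.pi fun _ : ι => expMeasure 1))
      {z | ((∀ i, 0 ≤ z.1 i) ∧ Monotone fun i => z.1 i / c i) ∧
          ∀ x, z.1 j / c j * w x ≤ z.2 x} := by
  set π := Measure.pi fun _ : ι => expMeasure 1 with hπ
  set ν := Measure.pi fun _ : Fin k => expMeasure 1 with hν
  set s : (Fin k → ℝ) → ℝ := fun a => a j / c j with hs
  set W := ∑ x, w x with hW
  have hk1 : (1 : ℝ) ≤ k := by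
    have := j.pos
    exact_mod_cast this
  have hW0 : 0 ≤ W := Finset.sum_nonneg fun x _ => (hw x).le
  have hsm : Measurable s := by fun_prop
  have hw0 : ∀ x, 0 ≤ w x := fun x => (hw x).le
  set F : Set (Fin k → ℝ) := {a | (∀ i, 0 ≤ a i) ∧ Monotone fun i => a i / c i} with hF
  have hFm : MeasurableSet F := by
    have h1 : F = (⋂ i, {a | 0 ≤ a i}) ∩ ⋂ i, ⋂ i', ⋂ _ : i ≤ i', {a | a i / c i ≤ a i' / c i'} := by
      ext a; simp [hF, Monotone]
    rw [h1]
    refine MeasurableSet.inter (.iInter fun i => ?_)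
      (.iInter fun i => .iInter fun i' => .iInter fun _ => ?_)
    · exact measurableSet_le measurable_const (measurable_pi_apply i)
    · exact measurableSet_le (by fun_prop) (by fun_prop)
  have hF0 : ∀ a ∈ F, 0 ≤ s a := fun a ha => div_nonneg (ha.1 j) (hc j).le
  set T : Set (Fin k → ℝ) := F ∩ {a | M / 2 < s a} with hT
  have hTm : MeasurableSet T := hFm.inter (measurableSet_lt measurable_const hsm)
  set I : Set (Fin k → ℝ) → ℝ≥0∞ :=
    fun F' => ∫⁻ a in F', ENNReal.ofReal (Real.exp (-(s a * W))) ∂ν with hI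
  -- The first `k` variables lie in `F'`, the others exceed their thresholds, and the excesses lie
  -- in `G`. By `hprob` the probability is the product of `π G` and a weighted integral over `F'`,
  -- so each bad event is compared with `I F`, the probability of the conditioning event.
  set A : Set (Fin k → ℝ) → Set (ι → ℝ) → Set ((Fin k → ℝ) × (ι → ℝ)) := fun F' G =>
    {z | z.1 ∈ F' ∧ (∀ x, s z.1 * w x ≤ z.2 x) ∧ (fun x => z.2 x - s z.1 * w x) ∈ G} with hA
  have hprob : ∀ F' G, MeasurableSet F' → F' ⊆ F → MeasurableSet G →
      (ν.prod π) (A F' G) = π G * I F' := fun F' G hF' hFF hG =>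
    prod_pi_expMeasure_one_shift ν hsm hw0 hF' (fun a ha => hF0 a (hFF ha)) hG
  have hE : {z : (Fin k → ℝ) × (ι → ℝ) | z.1 ∈ F ∧ ∀ x, s z.1 * w x ≤ z.2 x} = A F Set.univ := by
    ext z; simp [hA]
  set G₂ : Set (ι → ℝ) := {b | ∀ x, M / 2 * w x ≤ b x} with hG₂
  set g₃ : ι → ℝ → ℝ := fun x r => if r < 16 * (M * w x) then 1 else 0 with hg₃
  set G₃ : Set (ι → ℝ) := {b | 513 * (k : ℝ) ≤ ∑ x, g₃ x (b x)} with hG₃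
  set G₄ : Set (ι → ℝ) := {b | Λ ≤ ∑ x, decay ρ (M * w x) (b x)} with hG₄
  have hg₃m : ∀ x, Measurable (g₃ x) := fun x =>
    Measurable.ite measurableSet_Iio measurable_const measurable_const
  have hG₂m : MeasurableSet G₂ := by
    rw [hG₂, Set.ofPred_forall]
    exact .iInter fun x => measurableSet_le measurable_const (measurable_pi_apply x)
  have hG₃m : MeasurableSet G₃ := measurableSet_le_sum hg₃m _
  have hG₄m : MeasurableSet G₄ := measurableSet_le_sum (fun x => measurable_decay ρ (M * w x)) _
  have hMw : ∀ x, 0 ≤ M * w x := fun x => mul_nonneg hM.le (hw0 x)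
  -- The four bad events constrain `s` and the excesses. Bounds of `M / 2` for `s` and for one
  -- excess ratio give a variable with ratio at most `M`; the counting and decay sums only shrink
  -- from the excesses to the variables.
  have hsub : A F Set.univ \ {z | s z.1 ≤ M ∧ (∃ x, z.2 x ≤ M * w x) ∧
      ∑ x, g₃ x (z.2 x) < 513 * k ∧ ∑ x, decay ρ (M * w x) (z.2 x) < Λ} ⊆
      (A T Set.univ ∪ A F G₂) ∪ (A F G₃ ∪ A F G₄) := by
    rintro z ⟨⟨hzF, hz, -⟩, hbad⟩
    by_contra hcon
    simp only [Set.mem_union, not_or] at hcon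
    obtain ⟨⟨h1, h2⟩, h3, h4⟩ := hcon
    have hs0 := hF0 z.1 hzF
    have h1' : s z.1 ≤ M / 2 := by
      by_contra hlt
      exact h1 ⟨⟨hzF, not_le.1 hlt⟩, hz, trivial⟩
    have h2' : ∃ x, z.2 x - s z.1 * w x < M / 2 * w x := by
      by_contra hall
      push Not at hall
      exact h2 ⟨hzF, hz, hall⟩
    have h3' : ∑ x, g₃ x (z.2 x - s z.1 * w x) < 513 * k := by
      by_contra hlt
      exact h3 ⟨hzF, hz, not_lt.1 hlt⟩
    have h4' : ∑ x, decay ρ (M * w x) (z.2 x - s z.1 * w x) < Λ := by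
      by_contra hlt
      exact h4 ⟨hzF, hz, not_lt.1 hlt⟩
    have hle : ∀ x, z.2 x - s z.1 * w x ≤ z.2 x := fun x =>
      sub_le_self _ (mul_nonneg hs0 (hw0 x))
    refine hbad ⟨by linarith, ?_, ?_, ?_⟩
    · obtain ⟨x, hx⟩ := h2'
      have := mul_le_mul_of_nonneg_right h1' (hw0 x)
      exact ⟨x, by linarith⟩
    · refine (Finset.sum_le_sum fun x _ => ?_).trans_lt h3'
      simp only [hg₃]
      by_cases hx : z.2 x < 16 * (M * w x)
      · rw [if_pos hx, if_pos ((hle x).trans_lt hx)]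
      · rw [if_neg hx]; split_ifs <;> norm_num
    · exact (Finset.sum_le_sum fun x _ => decay_antitone hρ (hMw x) (hle x)).trans_lt h4'
  have hb1 : (ν.prod π) (A T Set.univ) ≤ ENNReal.ofReal (Real.exp (-(k : ℝ)) / 2) * I F := by
    rw [hprob T _ hTm Set.inter_subset_left .univ, measure_univ, one_mul]
    refine (lintegral_tail_le (s := s) hsm (fun a => ?_) hFm (fun a => ?_) hW0 (M / 2)).trans ?_
    · simp only [hs]; ring
    · have h5 : ∀ i, a i / 2 / c i = a i / c i / 2 := fun i => by ring
      simp only [hF, Set.mem_ofPred_eq, h5, Monotone]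
      refine and_congr (forall_congr' fun i => ?_)
        (forall_congr' fun i => forall_congr' fun i' => forall_congr' fun _ => ?_)
      · constructor <;> intro h <;> linarith
      · constructor <;> intro h <;> linarith
    · refine mul_le_mul_left (ENNReal.ofReal_le_ofReal ?_) _
      -- The tail bound is `2^k exp (-4 k)`, and both `2^k` and the factor 2 are at most `exp k`.
      have h6 : M / 2 * W / 2 = 4 * k := by linarith
      have h7 : (2 : ℝ) ^ k ≤ Real.exp k := by
        rw [← Real.exp_one_pow]
        exact pow_le_pow_left₀ (by norm_num) (by linarith [Real.exp_one_gt_d9]) _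
      have h8 : (2 : ℝ) ≤ Real.exp k :=
        (by linarith [Real.exp_one_gt_d9] : (2 : ℝ) ≤ Real.exp 1).trans (Real.exp_le_exp.2 hk1)
      rw [h6, Fintype.card_fin, le_div_iff₀ two_pos]
      calc 2 ^ k * Real.exp (-(4 * (k : ℝ))) * 2
          ≤ Real.exp k * Real.exp (-(4 * (k : ℝ))) * Real.exp k := by gcongr
        _ = Real.exp (-(2 * (k : ℝ))) := by rw [← Real.exp_add, ← Real.exp_add]; congr 1; ring
        _ ≤ _ := Real.exp_le_exp.2 (by linarith)
  have hb2 : (ν.prod π) (A F G₂) ≤ ENNReal.ofReal (Real.exp (-(k : ℝ)) / 2) * I F := by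
    rw [hprob F _ hFm subset_rfl hG₂m]
    refine mul_le_mul_left ?_ _
    have h5 := pi_expMeasure_one_shift (ι := ι) (v := fun x => M / 2 * w x)
      (fun x => mul_nonneg (by linarith) (hw0 x)) MeasurableSet.univ
    rw [measure_univ, mul_one, ← Finset.mul_sum] at h5
    have h6 : G₂ = {b | (∀ x, M / 2 * w x ≤ b x) ∧ (fun x => b x - M / 2 * w x) ∈ Set.univ} := by
      ext b; simp [hG₂]
    rw [h6, h5]
    refine ENNReal.ofReal_le_ofReal ?_
    have h7 : M / 2 * ∑ x, w x = 8 * k := by rw [← hW]; linarith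
    have h8 : (2 : ℝ) ≤ Real.exp k :=
      (by linarith [Real.exp_one_gt_d9] : (2 : ℝ) ≤ Real.exp 1).trans (Real.exp_le_exp.2 hk1)
    rw [h7, le_div_iff₀ two_pos]
    calc Real.exp (-(8 * (k : ℝ))) * 2 ≤ Real.exp (-(8 * (k : ℝ))) * Real.exp k := by gcongr
      _ = Real.exp (-(7 * (k : ℝ))) := by rw [← Real.exp_add]; congr 1; ring
      _ ≤ _ := Real.exp_le_exp.2 (by linarith)
  have hb3 : (ν.prod π) (A F G₃) ≤ ENNReal.ofReal (Real.exp (-(k : ℝ))) * I F := by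
    rw [hprob F _ hFm subset_rfl hG₃m]
    -- The mean count is at most `16 M W = 256 k`, and `513 = 2 * 256 + 1`.
    refine mul_le_mul_left (pi_expMeasure_one_le_sum_le (μ := 256 * k) hg₃m
      (fun x r => ?_) ?_ (by positivity) (by linarith)) _
    · simp only [hg₃]; split_ifs <;> norm_num
    · refine (Finset.sum_le_sum fun x _ =>
        integral_indicator_expMeasure_one_le (b := 16 * (M * w x))
          (by linarith [hMw x])).trans_eq ?_
      rw [← Finset.mul_sum, ← Finset.mul_sum, hMW]; ring
  have hb4 : (ν.prod π) (A F G₄) ≤ ENNReal.ofReal (Real.exp (-(k : ℝ))) * I F := by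
    rw [hprob F _ hFm subset_rfl hG₄m]
    refine mul_le_mul_left (pi_expMeasure_one_le_sum_le (μ := μ)
      (fun x => measurable_decay ρ (M * w x)) (fun x r => ?_) hμ ?_ hΛ) _
    · exact ⟨decay_nonneg (hMw x) r, decay_le_one hρ (hMw x) r⟩
    · exact (Finset.sum_nonneg fun x _ => integral_nonneg fun r =>
        decay_nonneg (hMw x) r).trans hμ
  have hEI : (ν.prod π) (A F Set.univ) = I F := by
    rw [hprob F _ hFm subset_rfl .univ, measure_univ, one_mul]
  change (ν.prod π) ({z | z.1 ∈ F ∧ ∀ x, s z.1 * w x ≤ z.2 x} \ _) ≤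
    _ * (ν.prod π) {z | z.1 ∈ F ∧ ∀ x, s z.1 * w x ≤ z.2 x}
  rw [hE, hEI]
  refine (measure_mono hsub).trans ((measure_union_le _ _).trans
    ((add_le_add ((measure_union_le _ _).trans (add_le_add hb1 hb2))
      ((measure_union_le _ _).trans (add_le_add hb3 hb4))).trans_eq ?_))
  -- The four bounds are 1/2, 1/2, 1 and 1 times `exp (-k)`.
  have he := (Real.exp_pos (-(k : ℝ))).le
  rw [← add_mul, ← add_mul, ← add_mul, ← ENNReal.ofReal_add (by positivity) (by positivity),
    ← ENNReal.ofReal_add he he, ← ENNReal.ofReal_add (by positivity) (by positivity)]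
  congr 2
  ring

end OrderStatistics

/-! ### Transformed frequencies in terms of exponential variables -/

section Transformed

variable {κ : Type*} {p : ℝ} {r : κ → ℝ} {x y : κ}

theorem measurable_transformed (p : ℝ) (v : κ → ℝ) (x : κ) :
    Measurable fun r : κ → ℝ => transformed p r v x := by
  unfold transformed
  exact (measurable_const.div ((measurable_pi_apply x).pow_const _)).nnnorm

theorem measurableSet_card_filter {α : Type*} [MeasurableSpace α] (s : Finset κ)
    {V : κ → Set α} (hV : ∀ x, MeasurableSet (V x)) (Q : ℕ → Prop) :
    open scoped Classical in
    MeasurableSet {a | Q (s.filter fun x => a ∈ V x).card} := by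
  classical
  have h1 : Measurable fun a => ∑ x ∈ s, if a ∈ V x then 1 else 0 :=
    Finset.measurable_sum _ fun x _ => Measurable.ite (hV x) measurable_const measurable_const
  simp_rw [Finset.card_filter]
  exact h1 (MeasurableSpace.measurableSet_top (s := {i | Q i}))

theorem transformed_eq_zero {v : κ → ℝ} (h : v x = 0) : transformed p r v x = 0 := by
  simp [transformed, h]

theorem coe_transformed (hp : 0 < p) {v : κ → ℝ} (hr : 0 < r x) :
    (transformed p r v x : ℝ) = (|v x| ^ p / r x) ^ (1 / p) := by
  rw [transformed, coe_nnnorm, norm_div, Real.norm_eq_abs, Real.norm_eq_abs,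
    abs_of_pos (Real.rpow_pos_of_pos hr _), Real.div_rpow (by positivity) hr.le,
    ← Real.rpow_mul (abs_nonneg _), mul_one_div_cancel hp.ne', Real.rpow_one]

theorem transformed_pos {v : κ → ℝ} (hr : 0 < r x) (hv : v x ≠ 0) : 0 < transformed p r v x := by
  rw [transformed, nnnorm_pos]
  exact div_ne_zero hv (Real.rpow_pos_of_pos hr _).ne'

theorem le_transformed_iff (hp : 0 < p) {v : κ → ℝ} (hr : 0 < r x) {c : ℝ} (hc : 0 ≤ c) :
    c ≤ transformed p r v x ↔ r x * c ^ p ≤ |v x| ^ p := by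
  rw [coe_transformed hp hr, one_div, Real.le_rpow_inv_iff_of_pos hc (by positivity) hp,
    le_div_iff₀ hr, mul_comm]

/-- The top keys by transformed frequency are thus the keys with the smallest ratios of an
exponential variable to its weight, the setting of `conditional_failure_le`. -/
theorem transformed_le_transformed_iff (hp : 0 < p) {v : κ → ℝ} (hx : 0 < r x) (hy : 0 < r y)
    (hvx : v x ≠ 0) (hvy : v y ≠ 0) :
    transformed p r v y ≤ transformed p r v x ↔ r x / |v x| ^ p ≤ r y / |v y| ^ p := by
  have h1 : 0 < |v x| ^ p := Real.rpow_pos_of_pos (abs_pos.2 hvx) _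
  have h2 : 0 < |v y| ^ p := Real.rpow_pos_of_pos (abs_pos.2 hvy) _
  rw [← NNReal.coe_le_coe, coe_transformed hp hx, coe_transformed hp hy,
    Real.rpow_le_rpow_iff (by positivity) (by positivity) (by positivity),
    div_le_div_iff₀ hy hx, div_le_div_iff₀ h1 h2, mul_comm, mul_comm (|v x| ^ p)]

end Transformed

/-! ### The concentration event and the top tuple -/

section Concentrated

variable {κ : Type*} [LinearOrder κ]

/-- More than `k` keys have transformed frequencies larger than `3 ε` (unless `ε = 0`), fewer than
`m` keys have transformed frequencies larger than `ε`, and those of the other keys have a small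
`q`-th moment. -/
def concentrated (p q L : ℝ) (k m : ℕ) (D : Multiset (DataElement κ)) (ε : ℝ) : Set (κ → ℝ) :=
  {r | (∀ x ∈ keys D, 0 < r x) ∧
    (k + 1 ≤ ((keys D).filter fun x => 3 * ε < transformed p r (freq D) x).card ∨ ε = 0) ∧
    ((keys D).filter fun x => ε < transformed p r (freq D) x).card < m ∧
    ∑ x ∈ keys D, (if (transformed p r (freq D) x : ℝ) ≤ ε then
      (transformed p r (freq D) x : ℝ) ^ q else 0) ≤ L * ε ^ q}

theorem measurableSet_concentrated (p q L : ℝ) (k m : ℕ) (D : Multiset (DataElement κ)) (ε : ℝ) :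
    MeasurableSet (concentrated p q L k m D ε) := by
  classical
  have htr : ∀ x, Measurable fun r : κ → ℝ => (transformed p r (freq D) x : ℝ) := fun x =>
    (measurable_transformed p (freq D) x).coe_nnreal_real
  have hlt : ∀ c : ℝ, ∀ x, MeasurableSet {r : κ → ℝ | c < transformed p r (freq D) x} :=
    fun c x => measurableSet_lt measurable_const (htr x)
  have h1 : concentrated p q L k m D ε = (⋂ x ∈ keys D, {r : κ → ℝ | 0 < r x}) ∩
      (({r | k + 1 ≤ ((keys D).filter fun x =>
          r ∈ {r : κ → ℝ | 3 * ε < transformed p r (freq D) x}).card} ∪ {_r | ε = 0}) ∩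
      ({r | ((keys D).filter fun x =>
          r ∈ {r : κ → ℝ | ε < transformed p r (freq D) x}).card < m} ∩
        {r | ∑ x ∈ keys D, (if (transformed p r (freq D) x : ℝ) ≤ ε then
          (transformed p r (freq D) x : ℝ) ^ q else 0) ≤ L * ε ^ q})) := by
    ext r
    simp only [concentrated, Set.mem_inter_iff, Set.mem_iInter, Set.mem_union, Set.mem_ofPred_eq]
  rw [h1]
  refine .inter ?_ (.inter (.union ?_ (.const _)) (.inter ?_ ?_))
  · exact (keys D).measurableSet_biInter fun x _ =>
      measurableSet_lt measurable_const (measurable_pi_apply x)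
  · exact measurableSet_card_filter (keys D) (hlt (3 * ε)) (fun i => k + 1 ≤ i)
  · exact measurableSet_card_filter (keys D) (hlt ε) (fun i => i < m)
  · refine measurableSet_le (Finset.measurable_sum _ fun x _ => ?_) measurable_const
    exact Measurable.ite (measurableSet_le (htr x) measurable_const) ((htr x).pow_const q)
      measurable_const

theorem measurableSet_isTopTuple (p : ℝ) {k : ℕ} (D : Multiset (DataElement κ)) (t : Fin k → κ) :
    MeasurableSet {r : κ → ℝ | IsTopTuple p r D t} := by
  by_cases h : Function.Injective t ∧ ∀ i, t i ∈ keys D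
  · have h1 : {r : κ → ℝ | IsTopTuple p r D t} =
        (⋂ i, ⋂ j, ⋂ _ : i ≤ j,
          {r | transformed p r (freq D) (t j) ≤ transformed p r (freq D) (t i)}) ∩
        ⋂ y ∈ keys D, ⋂ _ : y ∉ Set.range t, ⋂ i,
          {r | transformed p r (freq D) y ≤ transformed p r (freq D) (t i)} := by
      ext r
      simp only [Set.mem_inter_iff, Set.mem_iInter, Set.mem_ofPred_eq]
      exact ⟨fun H => ⟨fun i j hij => H.antitone hij, H.top⟩,
        fun H => ⟨h.1, h.2, fun i j hij => H.1 i j hij, H.2⟩⟩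
    rw [h1]
    have hle : ∀ x y, MeasurableSet
        {r : κ → ℝ | transformed p r (freq D) x ≤ transformed p r (freq D) y} := fun x y =>
      measurableSet_le (measurable_transformed _ _ _) (measurable_transformed _ _ _)
    exact (MeasurableSet.iInter fun i => .iInter fun j => .iInter fun _ => hle _ _).inter
      ((keys D).measurableSet_biInter fun y _ => .iInter fun _ => .iInter fun i => hle _ _)
  · have h1 : {r : κ → ℝ | IsTopTuple p r D t} = ∅ := by
      ext r
      simp only [Set.mem_ofPred_eq, Set.mem_empty_iff_false, iff_false]
      exact fun H => h ⟨H.injective, H.mem⟩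
    rw [h1]
    exact .empty

/-- The keys with non-zero frequency. -/
noncomputable def support (D : Multiset (DataElement κ)) : Finset κ := (keys D).filter fun x => freq D x ≠ 0

variable {p : ℝ} {D : Multiset (DataElement κ)} {r : κ → ℝ} {x : κ}

theorem mem_support : x ∈ support D ↔ x ∈ keys D ∧ freq D x ≠ 0 := Finset.mem_filter

/-- A tuple containing a key of transformed frequency 0 must also contain every key of the support,
for which there is no room. -/
theorem IsTopTuple.mem_support {k : ℕ} {t : Fin k → κ} (h : IsTopTuple p r D t)
    (hr : ∀ x ∈ keys D, 0 < r x) (hk : k < (support D).card) (i : Fin k) : t i ∈ support D := by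
  by_contra hi
  have hi0 : freq D (t i) = 0 := by
    by_contra h0
    exact hi (WORp.mem_support.2 ⟨h.mem i, h0⟩)
  refine hk.not_ge ?_
  have hsub : support D ⊆ Finset.univ.image t := by
    intro y hy
    rw [WORp.mem_support] at hy
    by_contra hyt
    have := h.top y hy.1 (by simpa using hyt) i
    rw [transformed_eq_zero hi0] at this
    exact (transformed_pos (hr y hy.1) hy.2).not_ge this
  exact (Finset.card_le_card hsub).trans (Finset.card_image_le.trans_eq (by simp))

theorem IsTopTuple.card_filter_lt {k : ℕ} {t : Fin k → κ} (h : IsTopTuple p r D t)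
    (hinj : Set.InjOn (transformed p r (freq D)) (support D)) (hts : ∀ i, t i ∈ support D)
    (i : Fin k) : ((keys D).filter fun y =>
      transformed p r (freq D) (t i) < transformed p r (freq D) y).card = i := by
  have : ((keys D).filter fun y =>
      transformed p r (freq D) (t i) < transformed p r (freq D) y) = (Finset.Iio i).image t := by
    ext y
    simp only [Finset.mem_filter, Finset.mem_image, Finset.mem_Iio]
    constructor
    · rintro ⟨hy, hlt⟩
      by_cases hyt : y ∈ Set.range t
      · obtain ⟨i', rfl⟩ := hyt
        exact ⟨i', not_le.1 fun hle => hlt.not_ge (h.antitone hle), rfl⟩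
      · exact absurd (h.top y hy hyt i) hlt.not_ge
    · rintro ⟨i', hi', rfl⟩
      refine ⟨h.mem i', lt_of_le_of_ne (h.antitone hi'.le) fun heq => ?_⟩
      exact hi'.ne' (h.injective (hinj (hts i) (hts i') heq))
  rw [this, Finset.card_image_of_injective _ h.injective, Fin.card_Iio]

/-- Without ties in the support, exactly `i` keys lie strictly above the `i`-th entry. If the `i`-th
entries differed in value, one of these sets would be strictly contained in the other. -/
theorem IsTopTuple.unique {k : ℕ} {t t' : Fin k → κ} (h : IsTopTuple p r D t)
    (h' : IsTopTuple p r D t') (hr : ∀ x ∈ keys D, 0 < r x) (hk : k < (support D).card)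
    (hinj : Set.InjOn (transformed p r (freq D)) (support D)) : t = t' := by
  have key : ∀ {t t' : Fin k → κ}, IsTopTuple p r D t → IsTopTuple p r D t' → ∀ i,
      transformed p r (freq D) (t' i) ≤ transformed p r (freq D) (t i) := by
    intro t t' h h' i
    by_contra! hlt
    have h1 := h.card_filter_lt hinj (h.mem_support hr hk) i
    have h2 := h'.card_filter_lt hinj (h'.mem_support hr hk) i
    refine absurd (Finset.card_lt_card (?_ : (keys D).filter (fun y =>
      transformed p r (freq D) (t' i) < transformed p r (freq D) y) ⊂ (keys D).filter fun y =>
      transformed p r (freq D) (t i) < transformed p r (freq D) y)) (by rw [h1, h2]; exact lt_irrefl _)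
    refine ⟨fun y hy => ?_, fun hsub => ?_⟩
    · rw [Finset.mem_filter] at hy ⊢
      exact ⟨hy.1, hlt.trans hy.2⟩
    · have := hsub (Finset.mem_filter.2 ⟨h'.mem i, hlt⟩)
      exact lt_irrefl _ (Finset.mem_filter.1 this).2
  funext i
  exact hinj (h.mem_support hr hk i) (h'.mem_support hr hk i)
    (le_antisymm (key h' h i) (key h h' i))

theorem exists_isTopTuple (p : ℝ) (r : κ → ℝ) {k : ℕ} (hk : k ≤ (keys D).card) :
    ∃ t : Fin k → κ, IsTopTuple p r D t := by
  set f := transformed p r (freq D) with hf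
  have h1 : (keys D).image (rank (keys D) f) = Finset.range (keys D).card := by
    refine Finset.eq_of_subset_of_card_le (fun i hi => ?_) ?_
    · obtain ⟨x, hx, rfl⟩ := Finset.mem_image.1 hi
      exact Finset.mem_range.2 (rank_lt_card hx)
    · rw [Finset.card_image_of_injOn (rank_injOn _ f), Finset.card_range]
  have h2 : ∀ i : Fin k, ∃ x ∈ keys D, rank (keys D) f x = i := fun i => by
    have := Finset.mem_range.2 (i.2.trans_le hk)
    rw [← h1] at this
    exact Finset.mem_image.1 this
  choose t ht hrank using h2
  refine ⟨t, fun i j hij => ?_, ht, fun i j hij => ?_, fun y hy hyt i => ?_⟩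
  · exact Fin.ext (by rw [← hrank i, ← hrank j, hij])
  · exact le_of_rank_le (ht j) (by rw [hrank, hrank]; exact hij)
  · refine le_of_rank_le hy ?_
    rw [hrank]
    by_contra! hlt
    have hyk : rank (keys D) f y < k := hlt.trans i.2
    exact hyt ⟨⟨_, hyk⟩, rank_injOn (keys D) f (ht _) hy (hrank ⟨_, hyk⟩)⟩

end Concentrated

/-! ### Joint law of the randomization, and absence of ties -/

section Law

attribute [local instance] isProbabilityMeasure_expMeasure_one

theorem IsExpHash.measurable_fun {Ω κ : Type*} [MeasurableSpace Ω] {P : Measure Ω} {r : κ → Ω → ℝ}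
    (H : IsExpHash P r) : Measurable fun ω x => r x ω :=
  measurable_pi_lambda _ H.measurable

theorem IsExpHash.ae_pos {Ω κ : Type*} [MeasurableSpace Ω] {P : Measure Ω} {r : κ → Ω → ℝ}
    (H : IsExpHash P r) (s : Finset κ) : ∀ᵐ ω ∂P, ∀ x ∈ s, 0 < r x ω := by
  rw [Filter.eventually_all_finset]
  intro x _
  refine ae_of_ae_map (H.measurable x).aemeasurable (p := fun y => 0 < y) ?_
  rw [H.law x]
  exact ae_expMeasure_one_pos

variable {Ω κ : Type*} [MeasurableSpace Ω] {P : Measure Ω} [IsProbabilityMeasure P]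
  {r : κ → Ω → ℝ}

theorem IsExpHash.map_pi (H : IsExpHash P r) {ι : Type*} [Fintype ι] {g : ι → κ}
    (hg : Function.Injective g) :
    P.map (fun ω i => r (g i) ω) = Measure.pi fun _ : ι => expMeasure 1 := by
  have h1 := (iIndepFun_iff_map_fun_eq_pi_map
    (fun i => (H.measurable (g i)).aemeasurable)).1 (H.indep.precomp hg)
  refine h1.trans ?_
  congr 1
  funext i
  exact H.law (g i)

theorem IsExpHash.map_prod (H : IsExpHash P r) {k : ℕ} {t : Fin k → κ}
    (ht : Function.Injective t) (U : Finset κ) (hU : ∀ i, t i ∉ U) :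
    P.map (fun ω => ((fun i => r (t i) ω), (fun x : U => r x ω))) =
      (Measure.pi fun _ : Fin k => expMeasure 1).prod
        (Measure.pi fun _ : U => expMeasure 1) := by
  classical
  have hd : Disjoint (Finset.univ.image t) U := by
    rw [Finset.disjoint_left]
    intro x hx
    obtain ⟨i, -, rfl⟩ := Finset.mem_image.1 hx
    exact hU i
  have h1 := H.indep.indepFun_finset _ _ hd H.measurable
  have h2 := h1.comp (φ := fun (a : Finset.univ.image t → ℝ) (i : Fin k) =>
      a ⟨t i, Finset.mem_image_of_mem t (Finset.mem_univ i)⟩) (ψ := id)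
    (by fun_prop) measurable_id
  have h3 : IndepFun (fun ω i => r (t i) ω) (fun ω (x : U) => r x ω) P := h2
  have hm1 : Measurable fun ω i => r (t i) ω := measurable_pi_lambda _ fun i => H.measurable _
  have hm2 : Measurable fun ω (x : U) => r x ω := measurable_pi_lambda _ fun i => H.measurable _
  rw [(indepFun_iff_map_prod_eq_prod_map_map hm1.aemeasurable hm2.aemeasurable).1 h3,
    H.map_pi ht, H.map_pi Subtype.val_injective]

/-- Given `r y`, the law of `r x` has no atoms. -/
theorem IsExpHash.ae_ne (H : IsExpHash P r) {x y : κ} (hxy : x ≠ y) (c : ℝ) :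
    ∀ᵐ ω ∂P, r x ω ≠ c * r y ω := by
  have hm := (H.measurable x).prodMk (H.measurable y)
  have h1 := (indepFun_iff_map_prod_eq_prod_map_map (H.measurable x).aemeasurable
    (H.measurable y).aemeasurable).1 (H.indep.indepFun hxy)
  refine ae_of_ae_map hm.aemeasurable (p := fun z : ℝ × ℝ => z.1 ≠ c * z.2) ?_
  rw [h1, H.law, H.law]
  have hS : MeasurableSet {z : ℝ × ℝ | z.1 = c * z.2} :=
    measurableSet_eq_fun measurable_fst (measurable_snd.const_mul c)
  have : (expMeasure 1).prod (expMeasure 1) {z : ℝ × ℝ | z.1 = c * z.2} = 0 := by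
    rw [Measure.prod_apply_symm hS]
    refine (lintegral_congr fun b => ?_).trans lintegral_zero
    have : (fun a : ℝ => (a, b)) ⁻¹' {z : ℝ × ℝ | z.1 = c * z.2} = {c * b} := by ext; simp
    rw [this]
    have := nullSingletonClass_expMeasure_one
    exact measure_singleton _
  rw [ae_iff]
  simpa using this

theorem IsExpHash.ae_injOn [LinearOrder κ] (H : IsExpHash P r) {p : ℝ} (hp : 0 < p)
    (D : Multiset (DataElement κ)) :
    ∀ᵐ ω ∂P, Set.InjOn (transformed p (fun x => r x ω) (freq D)) (support D) := by
  have h1 : ∀ᵐ ω ∂P, ∀ x ∈ support D, ∀ y ∈ support D, x ≠ y →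
      r x ω ≠ |freq D x| ^ p / |freq D y| ^ p * r y ω := by
    rw [Filter.eventually_all_finset]
    intro x _
    rw [Filter.eventually_all_finset]
    intro y _
    by_cases hxy : x = y
    · exact .of_forall fun ω h => absurd hxy h
    · filter_upwards [H.ae_ne hxy (|freq D x| ^ p / |freq D y| ^ p)] with ω h _ using h
  filter_upwards [h1, H.ae_pos (keys D)] with ω h1 hpos x hx y hy heq
  by_contra hne
  refine h1 x hx y hy hne ?_
  rw [Finset.mem_coe, mem_support] at hx hy
  have hx' : 0 < |freq D x| ^ p := Real.rpow_pos_of_pos (abs_pos.2 hx.2) _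
  have hy' : 0 < |freq D y| ^ p := Real.rpow_pos_of_pos (abs_pos.2 hy.2) _
  have h2 := (transformed_le_transformed_iff (r := fun x => r x ω) hp (hpos y hy.1) (hpos x hx.1) hy.2 hx.2).1 heq.le
  have h3 := (transformed_le_transformed_iff (r := fun x => r x ω) hp (hpos x hx.1) (hpos y hy.1) hx.2 hy.2).1 heq.ge
  have h4 := le_antisymm h2 h3
  rw [div_eq_div_iff hy'.ne' hx'.ne'] at h4
  field_simp
  linarith

end Law

/-! ### Concentration, conditioned on the top tuple -/

section Conditional

attribute [local instance] isProbabilityMeasure_expMeasure_one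

/-- The factor of `k` in the bound for the residual `q`-th moment. -/
noncomputable def residualBound (p q : ℝ) (n : ℕ) : ℝ :=
  if p < q then 32 * (q / (q - p)) + 1 else 32 * (1 + Real.log n) + 3

theorem exists_sum_integral_decay_le {p q : ℝ} (hp : 0 < p) (hpq : p ≤ q) {n k : ℕ} (hn : 1 ≤ n)
    {ι : Type*} [Fintype ι] (hι : Fintype.card ι ≤ n) {a : ι → ℝ} (ha : ∀ x, 0 < a x)
    (hsum : ∑ x, a x = 16 * k) (hk : 1 ≤ k) :
    ∃ μ, ∑ x, ∫ r, decay (q / p) (a x) r ∂expMeasure 1 ≤ μ ∧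
      2 * μ + k ≤ residualBound p q n * k := by
  unfold residualBound
  split_ifs with h
  · have hρ : 1 < q / p := (one_lt_div hp).2 h
    -- The weights sum to `16 k`, and Chernoff asks for twice the mean plus `k`.
    refine ⟨16 * k * (q / p / (q / p - 1)), ?_, le_of_eq ?_⟩
    · rw [← hsum, Finset.sum_mul]
      exact Finset.sum_le_sum fun x _ => integral_decay_le hρ (ha x)
    · have h1 : q / p / (q / p - 1) = q / (q - p) := by
        have : q - p ≠ 0 := by linarith
        have : q / p - 1 ≠ 0 := by linarith
        field_simp
      rw [h1]; ring
  · have hqp : q / p = 1 := by rw [le_antisymm hpq (not_lt.1 h)]; exact div_self (by linarith)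
    have hn' : (1 : ℝ) ≤ n := by exact_mod_cast hn
    have hk' : (1 : ℝ) ≤ k := by exact_mod_cast hk
    -- The cut-off errors `1 / n` of at most `n` keys add up to at most 1, which `1 ≤ k` absorbs.
    refine ⟨16 * k * (1 + Real.log n) + 1, ?_, by nlinarith⟩
    rw [hqp, ← hsum, Finset.sum_mul]
    refine (Finset.sum_le_sum fun x _ => integral_decay_one_le (ha x) hn').trans ?_
    rw [Finset.sum_add_distrib, Finset.sum_const, Finset.card_univ, nsmul_eq_mul, mul_one_div]
    have : (Fintype.card ι : ℝ) / n ≤ 1 :=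
      div_le_one_of_le₀ (by exact_mod_cast hι) (by linarith)
    linarith

variable {κ : Type*} [LinearOrder κ] {p q : ℝ} {D : Multiset (DataElement κ)} {r : κ → ℝ} {k : ℕ}

/-- With `τ = M ^ (-(1 / p))`, a key of the support has ratio at most `M` iff its transformed
frequency is at least `τ`. The level is `τ / 4`, so that `3 ε < τ`. Since `p ≤ 2` and `q ≤ 2`, the
factor 4 costs at most 16, in the ratios as well as in the moment. -/
theorem mem_concentrated_of_bounds (hp : 0 < p) (hpq : p ≤ q) (hq : q ≤ 2) {t : Fin k → κ}
    (htinj : Function.Injective t) (hts : ∀ i, t i ∈ support D) {j : Fin k} (hj : ∀ i, i ≤ j)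
    (hr : ∀ x ∈ keys D, 0 < r x) {M Λ : ℝ} (hM : 0 < M)
    (hmono : Monotone fun i => r (t i) / |freq D (t i)| ^ p)
    (h1 : r (t j) / |freq D (t j)| ^ p ≤ M)
    (h2 : ∃ x : (support D \ Finset.univ.image t : Finset κ), r x ≤ M * |freq D x| ^ p)
    (h3 : ∑ x : (support D \ Finset.univ.image t : Finset κ),
      (if r x < 16 * (M * |freq D x| ^ p) then (1 : ℝ) else 0) < 513 * k)
    (h4 : ∑ x : (support D \ Finset.univ.image t : Finset κ),
      decay (q / p) (M * |freq D x| ^ p) (r x) < Λ) :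
    r ∈ concentrated p q (16 * Λ) k (600 * k) D (M ^ (-(1 / p)) / 4) := by
  set U := support D \ Finset.univ.image t with hU
  set τ := M ^ (-(1 / p)) with hτ
  set f := transformed p r (freq D) with hf
  have hτ0 : 0 < τ := Real.rpow_pos_of_pos hM _
  have hτp : τ ^ p = M⁻¹ := by
    rw [hτ, ← Real.rpow_mul hM.le, neg_mul, one_div_mul_cancel hp.ne', Real.rpow_neg_one]
  have hw : ∀ x ∈ support D, 0 < |freq D x| ^ p := fun x hx =>
    Real.rpow_pos_of_pos (abs_pos.2 (mem_support.1 hx).2) _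
  have hrs : ∀ x ∈ support D, 0 < r x := fun x hx => hr x (mem_support.1 hx).1
  have hle : ∀ x ∈ support D, r x ≤ M * |freq D x| ^ p ↔ τ ≤ f x := by
    intro x hx
    rw [hf, le_transformed_iff hp (hrs x hx) hτ0.le, hτp, ← div_eq_mul_inv, div_le_iff₀ hM,
      mul_comm M]
  have htτ : ∀ i, τ ≤ f (t i) := by
    intro i
    refine (hle _ (hts i)).1 ?_
    rw [← div_le_iff₀ (hw _ (hts i))]
    exact (hmono (hj i)).trans h1
  have hsupp : ∀ x ∈ keys D, 0 < (f x : ℝ) → x ∈ support D := by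
    intro x hx hfx
    refine mem_support.2 ⟨hx, fun h0 => ?_⟩
    rw [hf, transformed_eq_zero h0] at hfx
    exact lt_irrefl _ hfx
  refine ⟨hr, .inl ?_, ?_, ?_⟩
  · obtain ⟨⟨x, hxU⟩, hx⟩ := h2
    rw [hU, Finset.mem_sdiff] at hxU
    have hcard : (insert x (Finset.univ.image t)).card = k + 1 := by
      rw [Finset.card_insert_of_notMem hxU.2, Finset.card_image_of_injective _ htinj]
      simp
    rw [← hcard]
    refine Finset.card_le_card fun y hy => ?_
    have hy' : y ∈ support D ∧ τ ≤ f y := by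
      rcases Finset.mem_insert.1 hy with rfl | hy
      · exact ⟨hxU.1, (hle _ hxU.1).1 hx⟩
      · obtain ⟨i, -, rfl⟩ := Finset.mem_image.1 hy
        exact ⟨hts i, htτ i⟩
    rw [Finset.mem_filter]
    exact ⟨(mem_support.1 hy'.1).1, lt_of_lt_of_le (by linarith) hy'.2⟩
  -- A key above `τ / 4` is in the tuple or has ratio below `4 ^ p M ≤ 16 M`. This leaves fewer than
  -- `k + 513 k` keys.
  · have hsub : (keys D).filter (fun x => τ / 4 < f x) ⊆
        Finset.univ.image t ∪ U.filter fun x => r x < 16 * (M * |freq D x| ^ p) := by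
      intro x hx
      rw [Finset.mem_filter] at hx
      have hxs := hsupp x hx.1 (by linarith [hx.2])
      rw [Finset.mem_union, Finset.mem_filter, hU, Finset.mem_sdiff]
      by_cases hxt : x ∈ Finset.univ.image t
      · exact .inl hxt
      · refine .inr ⟨⟨hxs, hxt⟩, ?_⟩
        by_contra! hge
        refine hx.2.not_ge ?_
        rw [hf, coe_transformed hp (hrs x hxs), one_div,
          Real.rpow_inv_le_iff_of_pos (by have := hw x hxs; have := hrs x hxs; positivity)
            (by positivity) hp, Real.div_rpow hτ0.le (by norm_num), hτp, div_le_iff₀ (hrs x hxs)]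
        have h16 : (4 : ℝ) ^ p ≤ 16 := by
          calc (4 : ℝ) ^ p ≤ 4 ^ (2 : ℝ) := Real.rpow_le_rpow_of_exponent_le (by norm_num)
                (hpq.trans hq)
            _ = 16 := by norm_num
        have h40 : (0 : ℝ) < 4 ^ p := by positivity
        have h5 := hw x hxs
        rw [div_mul_eq_mul_div, inv_mul_eq_div, div_div, le_div_iff₀ (by positivity)]
        calc |freq D x| ^ p * (M * 4 ^ p) ≤ |freq D x| ^ p * (M * 16) := by gcongr
          _ ≤ r x := by linarith
    have hcast : ((U.filter fun x => r x < 16 * (M * |freq D x| ^ p)).card : ℝ) < 513 * k := by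
      refine lt_of_eq_of_lt ?_ h3
      rw [Finset.sum_coe_sort U (fun x => if r x < 16 * (M * |freq D x| ^ p) then (1 : ℝ) else 0),
        Finset.sum_boole]
    have hcast' : (U.filter fun x => r x < 16 * (M * |freq D x| ^ p)).card < 513 * k := by
      exact_mod_cast hcast
    have h5 := Finset.card_le_card hsub
    have h6 := Finset.card_union_le (Finset.univ.image t)
      (U.filter fun x => r x < 16 * (M * |freq D x| ^ p))
    have h7 : (Finset.univ.image t).card ≤ k := Finset.card_image_le.trans_eq (by simp)
    change ((keys D).filter fun x => τ / 4 < f x).card < 600 * k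
    omega
  · have hq0 : 0 < q := hp.trans_le hpq
    -- Below `τ` the `q`-th power of the transformed frequency is exactly `τ ^ q` times `decay` with
    -- exponent `q / p`.
    have hterm : ∀ x ∈ U, (if (f x : ℝ) ≤ τ / 4 then (f x : ℝ) ^ q else 0) ≤
        τ ^ q * decay (q / p) (M * |freq D x| ^ p) (r x) := by
      intro x hx
      have hxs := (Finset.mem_sdiff.1 hx).1
      have hMw : 0 < M * |freq D x| ^ p := mul_pos hM (hw x hxs)
      split_ifs with hle'
      · have hnot : ¬ r x ≤ M * |freq D x| ^ p := by
          rw [hle x hxs]; intro h; linarith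
        have hd := hw x hxs
        have hrx := hrs x hxs
        rw [decay, if_neg hnot, hf, coe_transformed hp hrx, ← Real.rpow_mul (by positivity),
          mul_div_assoc, Real.mul_rpow hM.le (by positivity), ← mul_assoc, hτ,
          ← Real.rpow_mul hM.le, ← Real.rpow_add hM, one_div_mul_eq_div, neg_mul,
          one_div_mul_eq_div, neg_add_cancel, Real.rpow_zero, one_mul]
      · exact mul_nonneg (Real.rpow_nonneg hτ0.le _) (decay_nonneg hMw.le _)
    have hsplit : ∑ x ∈ keys D, (if (f x : ℝ) ≤ τ / 4 then (f x : ℝ) ^ q else 0) =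
        ∑ x ∈ U, (if (f x : ℝ) ≤ τ / 4 then (f x : ℝ) ^ q else 0) := by
      refine (Finset.sum_subset (fun x hx =>
        (mem_support.1 (Finset.mem_sdiff.1 hx).1).1) fun x hx hxU => ?_).symm
      by_cases hxs : x ∈ support D
      · have hxt : x ∈ Finset.univ.image t := by
          by_contra h; exact hxU (Finset.mem_sdiff.2 ⟨hxs, h⟩)
        obtain ⟨i, -, rfl⟩ := Finset.mem_image.1 hxt
        exact if_neg (by have := htτ i; intro h; linarith)
      · have h0 : (f x : ℝ) = 0 := by
          by_contra h
          exact hxs (hsupp x hx (lt_of_le_of_ne (f x).2 (Ne.symm h)))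
        rw [h0, Real.zero_rpow hq0.ne', ite_self]
    rw [hsplit]
    refine (Finset.sum_le_sum hterm).trans ?_
    rw [← Finset.mul_sum,
      ← Finset.sum_coe_sort U (fun x => decay (q / p) (M * |freq D x| ^ p) (r x))]
    have h4q : (4 : ℝ) ^ q ≤ 16 := by
      calc (4 : ℝ) ^ q ≤ 4 ^ (2 : ℝ) := Real.rpow_le_rpow_of_exponent_le (by norm_num) hq
        _ = 16 := by norm_num
    have hΛ0 : 0 ≤ Λ := (Finset.sum_nonneg fun (x : U) _ => decay_nonneg
      (mul_pos hM (hw x (Finset.mem_sdiff.1 x.2).1)).le _).trans h4.le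
    have h40 : (0 : ℝ) < 4 ^ q := by positivity
    have hτq : 0 < τ ^ q := Real.rpow_pos_of_pos hτ0 q
    rw [Real.div_rpow hτ0.le (by norm_num), mul_div_assoc', le_div_iff₀ h40]
    have h4' := h4.le
    calc τ ^ q * (∑ x : U, decay (q / p) (M * |freq D x| ^ p) (r x)) * 4 ^ q
        ≤ τ ^ q * Λ * 16 := by gcongr
      _ = 16 * Λ * τ ^ q := by ring

/-- It is enough to compare with the last entry of the tuple, and keys of frequency zero impose no
condition. The redundant sign condition makes the right side the event of `conditional_failure_le`.
-/
theorem isTopTuple_iff_of_pos (hp : 0 < p) {t : Fin k → κ} (htinj : Function.Injective t)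
    (hts : ∀ i, t i ∈ support D) {j : Fin k} (hj : ∀ i, i ≤ j) (hr : ∀ x ∈ keys D, 0 < r x) :
    IsTopTuple p r D t ↔ ((∀ i, 0 ≤ r (t i)) ∧ Monotone fun i => r (t i) / |freq D (t i)| ^ p) ∧
      ∀ x : (support D \ Finset.univ.image t : Finset κ),
        r (t j) / |freq D (t j)| ^ p * |freq D x| ^ p ≤ r x := by
  have hrs : ∀ x ∈ support D, 0 < r x := fun x hx => hr x (mem_support.1 hx).1
  have hw : ∀ x ∈ support D, 0 < |freq D x| ^ p := fun x hx =>
    Real.rpow_pos_of_pos (abs_pos.2 (mem_support.1 hx).2) _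
  have hiff : ∀ x ∈ support D, ∀ y ∈ support D,
      transformed p r (freq D) y ≤ transformed p r (freq D) x ↔
        r x / |freq D x| ^ p ≤ r y / |freq D y| ^ p := fun x hx y hy =>
    transformed_le_transformed_iff hp (hrs x hx) (hrs y hy) (mem_support.1 hx).2
      (mem_support.1 hy).2
  constructor
  · intro h
    refine ⟨⟨fun i => (hrs _ (hts i)).le, fun i i' hi =>
      (hiff _ (hts i) _ (hts i')).1 (h.antitone hi)⟩, fun x => ?_⟩
    have hx := Finset.mem_sdiff.1 x.2
    have := h.top x (mem_support.1 hx.1).1 (by simpa using hx.2) j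
    rw [hiff _ (hts j) _ hx.1, le_div_iff₀ (hw _ hx.1)] at this
    exact this
  · rintro ⟨⟨-, hmono⟩, hU⟩
    refine ⟨htinj, fun i => (mem_support.1 (hts i)).1, fun i i' hi =>
      (hiff _ (hts i) _ (hts i')).2 (hmono hi), fun y hy hyt i => ?_⟩
    by_cases hys : y ∈ support D
    · refine (hiff _ (hts i) _ hys).2 ((hmono (hj i)).trans ?_)
      rw [le_div_iff₀ (hw _ hys)]
      exact hU ⟨y, Finset.mem_sdiff.2 ⟨hys, by simpa using hyt⟩⟩
    · have h0 : freq D y = 0 := by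
        by_contra h; exact hys (mem_support.2 ⟨hy, h⟩)
      rw [transformed_eq_zero h0]; exact zero_le

theorem mem_concentrated_zero (hq : 0 < q) (L : ℝ) {m : ℕ} (hr : ∀ x ∈ keys D, 0 < r x)
    (hm : (support D).card < m) : r ∈ concentrated p q L k m D 0 := by
  have hpos : ∀ x ∈ keys D, 0 < (transformed p r (freq D) x : ℝ) → x ∈ support D := by
    intro x hx hfx
    refine mem_support.2 ⟨hx, fun h0 => ?_⟩
    rw [transformed_eq_zero h0] at hfx
    exact lt_irrefl _ hfx
  refine ⟨hr, .inr rfl, lt_of_le_of_lt (Finset.card_le_card fun x hx => ?_) hm, ?_⟩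
  · rw [Finset.mem_filter] at hx
    exact hpos x hx.1 hx.2
  · rw [Real.zero_rpow hq.ne', mul_zero]
    refine Finset.sum_nonpos fun x _ => ?_
    split_ifs with h
    · rw [le_antisymm h (NNReal.coe_nonneg _), Real.zero_rpow hq.ne']
    · exact le_rfl

variable {Ω : Type*} [MeasurableSpace Ω] {P : Measure Ω} [IsProbabilityMeasure P]
  {R : κ → Ω → ℝ}

/-- Conditioned on the top `k` keys, the transformed frequencies are concentrated with high
probability. -/
theorem exists_concentrated (H : IsExpHash P R) (hp : 0 < p) (hpq : p ≤ q) (hq : q ≤ 2) {n : ℕ}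
    (hn : 1 ≤ n) (hDn : (keys D).card ≤ n) (hk : 1 ≤ k) (hK : k < (support D).card)
    (t : Fin k → κ) :
    ∃ ε, 0 ≤ ε ∧ (1 - 3 * Real.exp (-(k : ℝ))) * P.real {ω | IsTopTuple p (fun x => R x ω) D t} ≤
      P.real {ω | IsTopTuple p (fun x => R x ω) D t ∧ (fun x => R x ω) ∈
        concentrated p q (16 * (residualBound p q n * k)) k (600 * k) D ε} := by
  by_cases ht : Function.Injective t ∧ ∀ i, t i ∈ support D
  swap
  -- Such a tuple is almost surely not the top tuple, so any level will do.
  · refine ⟨0, le_rfl, ?_⟩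
    have h0 : P {ω | IsTopTuple p (fun x => R x ω) D t} = 0 := by
      refine measure_mono_null (t := {ω | ¬ ∀ x ∈ keys D, 0 < R x ω}) (fun ω hω hpos => ?_)
        (ae_iff.1 (H.ae_pos (keys D)))
      have hω' : IsTopTuple p (fun x => R x ω) D t := hω
      exact ht ⟨hω'.injective, hω'.mem_support hpos hK⟩
    rw [measureReal_def, h0, ENNReal.toReal_zero, mul_zero]
    exact measureReal_nonneg
  obtain ⟨htinj, hts⟩ := ht
  set U : Finset κ := support D \ Finset.univ.image t with hU
  set w : U → ℝ := fun x => |freq D x| ^ p with hw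
  have hw0 : ∀ x, 0 < w x := fun x =>
    Real.rpow_pos_of_pos (abs_pos.2 (mem_support.1 (Finset.mem_sdiff.1 x.2).1).2) _
  have hc0 : ∀ i, 0 < |freq D (t i)| ^ p := fun i =>
    Real.rpow_pos_of_pos (abs_pos.2 (mem_support.1 (hts i)).2) _
  have hUne : Nonempty U := by
    have : (Finset.univ.image t).card < (support D).card :=
      (Finset.card_image_le.trans_eq (by simp)).trans_lt hK
    obtain ⟨x, hx, hxt⟩ := Finset.exists_mem_notMem_of_card_lt_card this
    exact ⟨⟨x, Finset.mem_sdiff.2 ⟨hx, hxt⟩⟩⟩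
  have hW : 0 < ∑ x, w x := Finset.sum_pos (fun x _ => hw0 x) Finset.univ_nonempty
  -- `M`, and with it the level, depends on `t` but not on the outcome.
  set M : ℝ := 16 * k / ∑ x, w x with hM
  have hk0 : (0 : ℝ) < k := by exact_mod_cast hk
  have hM0 : 0 < M := by positivity
  have hMW : M * ∑ x, w x = 16 * k := div_mul_cancel₀ _ hW.ne'
  have hUn : Fintype.card U ≤ n := by
    rw [Fintype.card_coe]
    exact (Finset.card_le_card (Finset.sdiff_subset.trans (Finset.filter_subset _ _))).trans hDn
  obtain ⟨μ, hμ, hΛ⟩ := exists_sum_integral_decay_le hp hpq hn hUn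
    (a := fun x => M * w x) (fun x => mul_pos hM0 (hw0 x)) (by rw [← Finset.mul_sum, hMW]) hk
  set Λ := residualBound p q n * k with hΛdef
  set j : Fin k := ⟨k - 1, by omega⟩ with hjdef
  have hj : ∀ i : Fin k, i ≤ j := fun i => Fin.le_def.2 (by simp only [hjdef]; omega)
  have hmain := conditional_failure_le (j := j) hc0 hw0 hM0 hMW
    (div_nonneg (hp.le.trans hpq) hp.le) hμ hΛ
  set Φ : Ω → (Fin k → ℝ) × (U → ℝ) := fun ω => (fun i => R (t i) ω, fun x => R x ω) with hΦ
  have hΦm : Measurable Φ := (measurable_pi_lambda _ fun i => H.measurable _).prodMk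
    (measurable_pi_lambda _ fun i => H.measurable _)
  have hlaw : P.map Φ = _ := H.map_prod htinj U fun i hi =>
    (Finset.mem_sdiff.1 hi).2 (Finset.mem_image_of_mem t (Finset.mem_univ i))
  rw [← hlaw] at hmain
  set E : Set ((Fin k → ℝ) × (U → ℝ)) :=
    {z | ((∀ i, 0 ≤ z.1 i) ∧ Monotone fun i => z.1 i / |freq D (t i)| ^ p) ∧
      ∀ x, z.1 j / |freq D (t j)| ^ p * w x ≤ z.2 x} with hE
  set G : Set ((Fin k → ℝ) × (U → ℝ)) :=
    {z | z.1 j / |freq D (t j)| ^ p ≤ M ∧ (∃ x, z.2 x ≤ M * w x) ∧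
      ∑ x, (if z.2 x < 16 * (M * w x) then (1 : ℝ) else 0) < 513 * k ∧
      ∑ x, decay (q / p) (M * w x) (z.2 x) < Λ} with hG
  set ε := M ^ (-(1 / p)) / 4 with hε
  have hpos := H.ae_pos (keys D)
  have hTE : {ω | IsTopTuple p (fun x => R x ω) D t} =ᵐ[P] Φ ⁻¹' E := by
    filter_upwards [hpos] with ω hω
    exact propext (isTopTuple_iff_of_pos hp htinj hts hj hω)
  have hEm : NullMeasurableSet (Φ ⁻¹' E) P := by
    refine NullMeasurableSet.congr (MeasurableSet.nullMeasurableSet ?_) hTE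
    exact H.measurable_fun (measurableSet_isTopTuple p D t)
  have hmeasT : MeasurableSet {ω | IsTopTuple p (fun x => R x ω) D t} :=
    H.measurable_fun (measurableSet_isTopTuple p D t)
  set C : Set Ω := {ω | (fun x => R x ω) ∈ concentrated p q (16 * Λ) k (600 * k) D ε} with hC
  have hCm : MeasurableSet C := H.measurable_fun (measurableSet_concentrated _ _ _ _ _ _ _)
  -- Only this inequality is needed, so measurability of `E \ G` is not.
  have hsub : P ({ω | IsTopTuple p (fun x => R x ω) D t} \ C) ≤ P.map Φ (E \ G) := by
    refine le_trans (measure_mono_ae ?_) (Measure.le_map_apply hΦm.aemeasurable _)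
    filter_upwards [hpos] with ω hω hωTC
    have hωE := (isTopTuple_iff_of_pos hp htinj hts hj hω).1 hωTC.1
    refine ⟨hωE, fun hωG => hωTC.2 ?_⟩
    exact mem_concentrated_of_bounds hp hpq hq htinj hts hj hω hM0 hωE.1.2 hωG.1 hωG.2.1
      hωG.2.2.1 hωG.2.2.2
  have hEmeas : MeasurableSet E := by
    have h1 : E = ((⋂ i, {z | 0 ≤ z.1 i}) ∩ ⋂ i, ⋂ i', ⋂ _ : i ≤ i',
        {z | z.1 i / |freq D (t i)| ^ p ≤ z.1 i' / |freq D (t i')| ^ p}) ∩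
        ⋂ x, {z | z.1 j / |freq D (t j)| ^ p * w x ≤ z.2 x} := by
      ext z
      simp only [hE, Monotone, Set.mem_inter_iff, Set.mem_iInter, Set.mem_ofPred_eq]
    rw [h1]
    refine ((MeasurableSet.iInter fun i => ?_).inter (.iInter fun i => .iInter fun i' =>
      .iInter fun _ => ?_)).inter (.iInter fun x => ?_)
    · exact measurableSet_le (by fun_prop) (by fun_prop)
    · exact measurableSet_le (by fun_prop) (by fun_prop)
    · exact measurableSet_le (by fun_prop) (by fun_prop)
  have hfin : P ({ω | IsTopTuple p (fun x => R x ω) D t} \ C) ≤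
      ENNReal.ofReal (3 * Real.exp (-(k : ℝ))) * P {ω | IsTopTuple p (fun x => R x ω) D t} := by
    refine hsub.trans (hmain.trans_eq ?_)
    rw [Measure.map_apply hΦm hEmeas, measure_congr hTE]
  refine ⟨ε, by positivity, ?_⟩
  have h5 := measureReal_sdiff_add_inter (μ := P)
    (s := {ω | IsTopTuple p (fun x => R x ω) D t}) hCm
  have h6 : P.real ({ω | IsTopTuple p (fun x => R x ω) D t} \ C) ≤
      3 * Real.exp (-(k : ℝ)) * P.real {ω | IsTopTuple p (fun x => R x ω) D t} := by
    have := ENNReal.toReal_mono (ENNReal.mul_ne_top ENNReal.ofReal_ne_top (measure_ne_top _ _)) hfin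
    rwa [ENNReal.toReal_mul, ENNReal.toReal_ofReal (by positivity)] at this
  have h7 : {ω | IsTopTuple p (fun x => R x ω) D t ∧ (fun x => R x ω) ∈
        concentrated p q (16 * Λ) k (600 * k) D ε} =
      {ω | IsTopTuple p (fun x => R x ω) D t} ∩ C := rfl
  rw [h7]
  linarith

end Conditional

/-! ### From concentration to success probabilities -/

section Success

variable {Ω κ σ : Type*} [MeasurableSpace Ω] [LinearOrder κ] {P : Measure Ω}
  [IsProbabilityMeasure P] {r : κ → Ω → ℝ} {p q γ : ℝ} {n k : ℕ}
  {R : Ω → FrequencySketch n σ} {keyHash : κ → Fin n} {D : Multiset (DataElement κ)}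
  {a₁ a₂ : Aggregation κ}

/-- It suffices that the method succeeds with probability `γ` given that the transformed
frequencies are concentrated. -/
theorem succeedsWithProb_of_concentrated (H : IsExpHash P r) (hp : 0 < p) (hpq : p ≤ q)
    (hq : q ≤ 2) (hn : 1 ≤ n) (hDn : (keys D).card ≤ n) (hk : 1 ≤ k) (hγ : 0 ≤ γ)
    (hV : ∀ ε, 0 ≤ ε → ∀ V ⊆ concentrated p q (16 * (residualBound p q n * k)) k (600 * k) D ε,
      MeasurableSet V → ∃ S : Set Ω, MeasurableSet S ∧ S ⊆ {ω | (fun x => r x ω) ∈ V} ∧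
        (∀ ω ∈ S, IsExactSample p k (fun x => r x ω) D
          (twoPassSample (R ω) p k (600 * k) keyHash (fun x => r x ω) a₁ a₂)) ∧
        γ * P.real {ω | (fun x => r x ω) ∈ V} ≤ P.real S) :
    SucceedsWithProb P (γ * (1 - 3 * Real.exp (-(k : ℝ)))) R p k (600 * k) keyHash r D a₁ a₂ := by
  set L := 16 * (residualBound p q n * k) with hL
  set E : (Fin k → κ) → Set Ω := fun t => {ω | IsTopTuple p (fun x => r x ω) D t} with hE
  set success : Set Ω := {ω | IsExactSample p k (fun x => r x ω) D
    (twoPassSample (R ω) p k (600 * k) keyHash (fun x => r x ω) a₁ a₂)} with hsuccess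
  set β := γ * (1 - 3 * Real.exp (-(k : ℝ))) with hβ
  have hpos := H.ae_pos (keys D)
  have hβγ : β ≤ γ := by
    have := Real.exp_pos (-(k : ℝ))
    exact mul_le_of_le_one_right hγ (by linarith)
  have hEm : ∀ t, MeasurableSet (E t) := fun t =>
    H.measurable_fun (measurableSet_isTopTuple p D t)
  -- With at most `k` non-zero frequencies, level 0 is almost surely concentrated, so conditioning
  -- on any event of `r` costs nothing.
  have small : (support D).card ≤ k → ∀ W : Set (κ → ℝ), MeasurableSet W →
      ∃ S : Set Ω, MeasurableSet S ∧ S ⊆ {ω | (fun x => r x ω) ∈ W} ∧ S ⊆ success ∧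
        β * P.real {ω | (fun x => r x ω) ∈ W} ≤ P.real S := by
    intro hs W hW
    obtain ⟨S, hSm, hSV, hSs, hSP⟩ := hV 0 le_rfl (W ∩ concentrated p q L k (600 * k) D 0)
      Set.inter_subset_right (hW.inter (measurableSet_concentrated _ _ _ _ _ _ _))
    refine ⟨S, hSm, fun ω hω => (hSV hω).1, hSs, le_trans ?_ hSP⟩
    have : P.real {ω | (fun x => r x ω) ∈ W ∩ concentrated p q L k (600 * k) D 0} =
        P.real {ω | (fun x => r x ω) ∈ W} := by
      refine measureReal_congr ?_
      filter_upwards [hpos] with ω hω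
      refine propext ⟨fun h => h.1, fun h => ⟨h, ?_⟩⟩
      exact mem_concentrated_zero (hp.trans_le hpq) L hω (by omega)
    rw [this]
    exact mul_le_mul_of_nonneg_right hβγ measureReal_nonneg
  -- Here `hV` is applied to the event that `t` is on top and its level is concentrated; this
  -- explains the arbitrary subsets `V`. Success is only bounded from below by measurable sets `S`,
  -- so it need not be measurable itself.
  have hcond : ∀ t, ∃ S : Set Ω, MeasurableSet S ∧ S ⊆ E t ∧ S ⊆ success ∧
      β * P.real (E t) ≤ P.real S := by
    intro t
    rcases le_or_gt (support D).card k with hs | hs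
    · exact small hs _ (measurableSet_isTopTuple p D t)
    · obtain ⟨ε, hε, hc⟩ := exists_concentrated H hp hpq hq hn hDn hk hs t
      obtain ⟨S, hSm, hSV, hSs, hSP⟩ := hV ε hε
        ({r' | IsTopTuple p r' D t} ∩ concentrated p q L k (600 * k) D ε) Set.inter_subset_right
        ((measurableSet_isTopTuple p D t).inter (measurableSet_concentrated _ _ _ _ _ _ _))
      refine ⟨S, hSm, fun ω hω => (hSV hω).1, hSs, le_trans ?_ hSP⟩
      rw [hβ, mul_assoc]
      exact mul_le_mul_of_nonneg_left hc hγ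
  choose S hSm hSE hSs hSP using hcond
  refine ⟨?_, fun t ht => ?_⟩
  · change β ≤ P.real success
    rcases le_or_gt (support D).card k with hs | hs
    · obtain ⟨S', -, -, hS's, hS'P⟩ := small hs Set.univ .univ
      have h1 : P.real {ω | (fun x => r x ω) ∈ Set.univ} = 1 := by
        have : {ω | (fun x => r x ω) ∈ (Set.univ : Set (κ → ℝ))} = Set.univ := by ext; simp
        rw [this]; simp
      rw [h1, mul_one] at hS'P
      exact hS'P.trans (measureReal_mono hS's)
    · rcases le_or_gt β 0 with hβ0 | hβ0
      · exact hβ0.trans measureReal_nonneg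
      have hinj := H.ae_injOn hp D
      -- Tuples of keys of `D` form a finite type, so the probabilities can be summed. The top tuple
      -- exists always and is almost surely unique: the events cover the space, and the success sets
      -- are almost disjoint.
      set T : (Fin k → keys D) → Fin k → κ := fun t i => t i with hT
      have hTinj : Function.Injective T := fun t t' h =>
        funext fun i => Subtype.ext (congrFun h i)
      have hdisj : Pairwise (Function.onFun (AEDisjoint P) fun t => S (T t)) := by
        intro t t' htt
        refine measure_mono_null (t := {ω | ¬ ((∀ x ∈ keys D, 0 < r x ω) ∧
          Set.InjOn (transformed p (fun x => r x ω) (freq D)) (support D))}) (fun ω hω hc => ?_)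
          (ae_iff.1 (hpos.and hinj))
        exact htt (hTinj ((hSE _ hω.1 : IsTopTuple _ _ _ _).unique (hSE _ hω.2) hc.1 hs hc.2))
      have hU : P.real (⋃ t, S (T t)) = ∑ t, P.real (S (T t)) := by
        rw [measureReal_def, measure_iUnion₀ hdisj fun t => (hSm _).nullMeasurableSet,
          tsum_fintype, ENNReal.toReal_sum fun t _ => measure_ne_top _ _]
        rfl
      have hcover : (⋃ t, E (T t)) = Set.univ := by
        refine Set.eq_univ_of_forall fun ω => ?_
        obtain ⟨t, ht⟩ := exists_isTopTuple (D := D) p (fun x => r x ω)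
          (hs.le.trans (Finset.card_le_card (Finset.filter_subset _ _)))
        exact Set.mem_iUnion.2 ⟨fun i => ⟨t i, ht.mem i⟩, ht⟩
      have h1 : 1 ≤ ∑ t, P.real (E (T t)) := by
        calc (1 : ℝ) = P.real (⋃ t, E (T t)) := by rw [hcover]; simp
          _ ≤ _ := measureReal_iUnion_fintype_le _
      calc β ≤ β * ∑ t, P.real (E (T t)) := le_mul_of_one_le_right hβ0.le h1
        _ ≤ ∑ t, P.real (S (T t)) := by
          rw [Finset.mul_sum]; exact Finset.sum_le_sum fun t _ => hSP _
        _ = P.real (⋃ t, S (T t)) := hU.symm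
        _ ≤ P.real success := measureReal_mono (Set.iUnion_subset fun t => hSs _)
  · change β ≤ (P[|E t]).real success
    have hEt : 0 < P.real (E t) := ENNReal.toReal_pos ht (measure_ne_top _ _)
    rw [measureReal_def, cond_apply (hEm t), ENNReal.toReal_mul, ENNReal.toReal_inv,
      ← measureReal_def, ← measureReal_def, inv_mul_eq_div, le_div_iff₀ hEt]
    exact (hSP t).trans (measureReal_mono (Set.subset_inter (hSE t) (hSs t)))

end Success

/-! ### Sketch errors on the concentration event -/

section Sketches

theorem passOne_dataset {κ : Type*} {n : ℕ} {p : ℝ} {keyHash : κ → Fin n} {r : κ → ℝ}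
    {D : Multiset (DataElement κ)} {a₁ : Aggregation κ} (h₁ : a₁.dataset = D) :
    (a₁.map (outputElement p keyHash r)).dataset = D.map (outputElement p keyHash r) := by
  rw [Aggregation.dataset_map, h₁]

variable {κ σ : Type*} [LinearOrder κ] {n k : ℕ} {p q L ε : ℝ} {keyHash : κ → Fin n}
  {r : κ → ℝ} {D : Multiset (DataElement κ)} {a₁ a₂ : Aggregation κ}

theorem isExactSample_of_concentrated (R : FrequencySketch n σ) (hk : 1 ≤ k)
    (hinj : Set.InjOn keyHash (keys D)) (h₂ : a₂.dataset = D)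
    (hr : r ∈ concentrated p q L k (600 * k) D ε)
    (herr : ∀ z, |R.est (passOne R p keyHash r a₁) z -
      freq (D.map (outputElement p keyHash r)) z| ≤ ε) :
    IsExactSample p k r D (twoPassSample R p k (600 * k) keyHash r a₁ a₂) := by
  refine isExactSample_twoPassSample R h₂ (by omega) (fun x hx => ?_) hr.2.2.1 hr.2.1
  have := herr (keyHash x)
  rw [freq_map_outputElement_of_injOn p r hinj hx] at this
  exact (abs_norm_sub_norm_le _ _).trans this

/-- The hashes of the keys with transformed frequencies larger than `ε`. -/
noncomputable def largeHashes (p ε : ℝ) (keyHash : κ → Fin n) (r : κ → ℝ)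
    (D : Multiset (DataElement κ)) : Finset (Fin n) :=
  ((keys D).filter fun x => ε < transformed p r (freq D) x).image keyHash

theorem card_largeHashes_lt {m : ℕ} (hr : r ∈ concentrated p q L k m D ε) :
    (largeHashes p ε keyHash r D).card < m :=
  Finset.card_image_le.trans_lt hr.2.2.1

/-- Hashes of no key contribute `φ 0 = 0`, and by injectivity the others correspond to keys. With
`φ` the identity or the square, this turns the moment bound of `concentrated` into the residual
bound of the sketch. -/
theorem sum_compl_largeHashes (hinj : Set.InjOn keyHash (keys D)) {φ : ℝ → ℝ} (hφ : φ 0 = 0) :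
    ∑ z ∈ Finset.univ \ largeHashes p ε keyHash r D,
        φ (freq (D.map (outputElement p keyHash r)) z) =
      ∑ x ∈ keys D, if (transformed p r (freq D) x : ℝ) ≤ ε then
        φ (freq D x / r x ^ (1 / p)) else 0 := by
  set s := (keys D).filter fun x => (transformed p r (freq D) x : ℝ) ≤ ε with hs
  have hsD : s ⊆ keys D := Finset.filter_subset _ _
  rw [← Finset.sum_filter, ← hs]
  have h1 : ∑ z ∈ s.image keyHash, φ (freq (D.map (outputElement p keyHash r)) z) =
      ∑ x ∈ s, φ (freq D x / r x ^ (1 / p)) := by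
    rw [Finset.sum_image (hinj.mono hsD)]
    exact Finset.sum_congr rfl fun x hx => by
      rw [freq_map_outputElement_of_injOn p r hinj (hsD hx)]
  rw [← h1]
  refine (Finset.sum_subset (fun z hz => ?_) fun z hz hzs => ?_).symm
  · obtain ⟨x, hx, rfl⟩ := Finset.mem_image.1 hz
    refine Finset.mem_sdiff.2 ⟨Finset.mem_univ _, fun hmem => ?_⟩
    obtain ⟨y, hy, hyx⟩ := Finset.mem_image.1 hmem
    rw [Finset.mem_filter] at hy hx
    rw [hinj hy.1 hx.1 hyx] at hy
    exact hy.2.not_ge hx.2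
  · rw [freq_map_outputElement_of_notMem, hφ]
    intro hmem
    obtain ⟨x, hx, rfl⟩ := Finset.mem_image.1 hmem
    rcases le_or_gt (transformed p r (freq D) x : ℝ) ε with h | h
    · exact hzs (Finset.mem_image_of_mem _ (Finset.mem_filter.2 ⟨hx, h⟩))
    · exact (Finset.mem_sdiff.1 hz).2
        (Finset.mem_image_of_mem _ (Finset.mem_filter.2 ⟨hx, h⟩))

theorem freq_nonneg (hD : ∀ e ∈ D, 0 < e.val) (x : κ) : 0 ≤ freq D x := by
  refine Multiset.sum_nonneg fun v hv => ?_
  obtain ⟨e, he, rfl⟩ := Multiset.mem_map.1 hv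
  exact (hD e (Multiset.mem_of_mem_filter he)).le

theorem mem_keys_of_mem {e : DataElement κ} (he : e ∈ D) : e.key ∈ keys D := by
  rw [keys, Multiset.mem_toFinset]
  exact Multiset.mem_map_of_mem _ he

/-- Removing fewer than `600 k` large hashes leaves at least `L` counters to share a residual of at
most `L ε`. -/
theorem isExactSample_counters {m : ℕ} (hk : 1 ≤ k) (hD : ∀ e ∈ D, 0 < e.val)
    (hinj : Set.InjOn keyHash (keys D)) (h₁ : a₁.dataset = D) (h₂ : a₂.dataset = D) (hε : 0 ≤ ε)
    (hm : 600 * k + L ≤ m) (hL : 0 ≤ L) (hr : r ∈ concentrated p 1 L k (600 * k) D ε) :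
    IsExactSample p k r D (twoPassSample (counters n m) p k (600 * k) keyHash r a₁ a₂) := by
  refine isExactSample_of_concentrated _ hk hinj h₂ hr fun z => ?_
  have hJ := card_largeHashes_lt (keyHash := keyHash) hr
  have hJ' : ((largeHashes p ε keyHash r D).card : ℝ) ≤ 600 * k := by exact_mod_cast hJ.le
  have key := abs_counters_est_sub_le (m := m) (a₁.map (outputElement p keyHash r))
    (ε := ε) ?_ (largeHashes p ε keyHash r D) ?_ ?_ z
  · rw [passOne_dataset h₁] at key
    exact key
  · rw [passOne_dataset h₁]
    intro e' he'
    obtain ⟨e, he, rfl⟩ := Multiset.mem_map.1 he'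
    exact div_pos (hD e he) (Real.rpow_pos_of_pos (hr.1 _ (mem_keys_of_mem he)) _)
  · have : ((largeHashes p ε keyHash r D).card : ℝ) ≤ m := by linarith
    exact_mod_cast this
  · rw [passOne_dataset h₁, sum_compl_largeHashes hinj (φ := fun y => y) rfl]
    refine le_trans (le_of_eq ?_) (hr.2.2.2.trans ?_)
    · refine Finset.sum_congr rfl fun x hx => ?_
      rw [Real.rpow_one, transformed, coe_nnnorm, Real.norm_eq_abs, abs_of_nonneg
        (div_nonneg (freq_nonneg hD x) (Real.rpow_nonneg (hr.1 x hx).le _))]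
    · rw [Real.rpow_one]
      exact mul_le_mul_of_nonneg_right (by linarith) hε

end Sketches

/-! ### Freezing one of two independent variables -/

section Independence

open scoped ENNReal

/-- Fubini for the product law: a bound that holds for each frozen value `a ∈ V` may be integrated
over `V`. -/
theorem measure_le_of_indepFun {Ω α β : Type*} [MeasurableSpace Ω] [MeasurableSpace α]
    [MeasurableSpace β] {P : Measure Ω} [IsProbabilityMeasure P] {X : Ω → α} {Y : Ω → β}
    (hX : Measurable X) (hY : Measurable Y) (hXY : IndepFun X Y P) {V : Set α}
    (hV : MeasurableSet V) {A : Set (α × β)} (hA : MeasurableSet A) {δ : ℝ≥0∞}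
    (hδ : ∀ a ∈ V, P {ω | (a, Y ω) ∈ A} ≤ δ) :
    P {ω | X ω ∈ V ∧ (X ω, Y ω) ∈ A} ≤ δ * P {ω | X ω ∈ V} := by
  have h1 := (indepFun_iff_map_prod_eq_prod_map_map hX.aemeasurable hY.aemeasurable).1 hXY
  have hA' : MeasurableSet (Prod.fst ⁻¹' V ∩ A) := (measurable_fst hV).inter hA
  have : IsProbabilityMeasure (P.map Y) := Measure.isProbabilityMeasure_map hY.aemeasurable
  have h2 : P {ω | X ω ∈ V ∧ (X ω, Y ω) ∈ A} =
      P.map (fun ω => (X ω, Y ω)) (Prod.fst ⁻¹' V ∩ A) := by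
    rw [Measure.map_apply (hX.prodMk hY) hA']; rfl
  have h3 : P {ω | X ω ∈ V} = P.map X V := by rw [Measure.map_apply hX hV]; rfl
  rw [h2, h3, h1, Measure.prod_apply hA', ← lintegral_indicator_const hV]
  refine lintegral_mono fun a => ?_
  by_cases ha : a ∈ V
  · rw [Set.indicator_of_mem ha, Measure.map_apply hY (measurable_prodMk_left hA')]
    exact (measure_mono fun ω hω => hω.2).trans (hδ a ha)
  · rw [Set.indicator_of_notMem ha]
    refine le_of_eq (measure_mono_null (t := ∅) (fun b hb => ha hb.1) measure_empty)

end Independence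

/-! ### Success of CountSketch on concentrated randomizations -/

section CountSketchSuccess

variable {κ : Type*} [LinearOrder κ] {n k d w : ℕ} {p L ε : ℝ} {keyHash : κ → Fin n}
  {D : Multiset (DataElement κ)} {a₁ a₂ : Aggregation κ}

theorem isExactSample_countSketch {r : κ → ℝ} {h : Fin d → Fin n → Fin w}
    {s : Fin d → Fin n → Bool} (hk : 1 ≤ k) (hinj : Set.InjOn keyHash (keys D))
    (h₁ : a₁.dataset = D) (h₂ : a₂.dataset = D) (hr : r ∈ concentrated p 2 L k (600 * k) D ε)
    (hrows : ∀ x, (Finset.univ.filter fun i => ε < |rowEstimate (h i) (s i)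
        (freq (D.map (outputElement p keyHash r))) x -
      freq (D.map (outputElement p keyHash r)) x|).card < d - d / 2) :
    IsExactSample p k r D
      (twoPassSample (countSketch d w h s) p k (600 * k) keyHash r a₁ a₂) := by
  refine isExactSample_of_concentrated _ hk hinj h₂ hr fun z => ?_
  rw [passOne, countSketch_est_run, passOne_dataset h₁]
  exact abs_median_sub_le _ (hrows z)

theorem measurable_freq_map_outputElement (p : ℝ) (keyHash : κ → Fin n)
    (D : Multiset (DataElement κ)) (z : Fin n) :
    Measurable fun r : κ → ℝ => freq (D.map (outputElement p keyHash r)) z := by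
  simp_rw [fun r => freq_map_outputElement p keyHash r D subset_rfl z]
  refine Finset.measurable_sum _ fun x _ => ?_
  split_ifs
  · exact measurable_const.div ((measurable_pi_apply x).pow_const _)
  · exact measurable_const

variable {Ω : Type*} [MeasurableSpace Ω] {P : Measure Ω} [IsProbabilityMeasure P]

/-- The sketched frequencies and the large hashes are functions of `r` alone. For each frozen `r` in
`V` the hashes fail with probability at most `n * exp (-d)`, and independence transfers this to `V`.
-/
theorem exists_countSketch_success {r : κ → Ω → ℝ} {h : Fin d → Fin n → Ω → Fin w}
    {s : Fin d → Fin n → Ω → Bool} (hr : IsExpHash P r) (H : IsCountSketchHash P h s)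
    (hind : IndepFun (fun ω x => r x ω)
      (fun ω => ((fun i x => h i x ω), (fun i x => s i x ω))) P)
    (hk : 1 ≤ k) (hinj : Set.InjOn keyHash (keys D)) (h₁ : a₁.dataset = D) (h₂ : a₂.dataset = D)
    (hε : 0 ≤ ε) (hw : 600 * (k : ℝ) ≤ w * (Real.exp (-4) / 2))
    (hwL : L ≤ w * (Real.exp (-4) / 2)) {V : Set (κ → ℝ)}
    (hVc : V ⊆ concentrated p 2 L k (600 * k) D ε) (hV : MeasurableSet V) :
    ∃ S : Set Ω, MeasurableSet S ∧ S ⊆ {ω | (fun x => r x ω) ∈ V} ∧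
      (∀ ω ∈ S, IsExactSample p k (fun x => r x ω) D
        (twoPassSample (countSketch d w (fun i x => h i x ω) (fun i x => s i x ω)) p k (600 * k)
          keyHash (fun x => r x ω) a₁ a₂)) ∧
      (1 - n * Real.exp (-d)) * P.real {ω | (fun x => r x ω) ∈ V} ≤ P.real S := by
  classical
  set X : Ω → κ → ℝ := fun ω x => r x ω with hX
  set Y : Ω → (Fin d → Fin n → Fin w) × (Fin d → Fin n → Bool) :=
    fun ω => ((fun i x => h i x ω), (fun i x => s i x ω)) with hY
  have hXm : Measurable X := hr.measurable_fun
  have hYm : Measurable Y :=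
    (measurable_pi_lambda _ fun i => measurable_pi_lambda _ fun x => H.measurable_h i x).prodMk
      (measurable_pi_lambda _ fun i => measurable_pi_lambda _ fun x => H.measurable_s i x)
  set f : (κ → ℝ) → Fin n → ℝ := fun r => freq (D.map (outputElement p keyHash r)) with hf
  have hfm : ∀ z, Measurable fun r => f r z := measurable_freq_map_outputElement p keyHash D
  set A : Set ((κ → ℝ) × ((Fin d → Fin n → Fin w) × (Fin d → Fin n → Bool))) :=
    {z | ∃ x, d - d / 2 ≤ (Finset.univ.filter fun i =>
      ε < |rowEstimate (z.2.1 i) (z.2.2 i) (f z.1) x - f z.1 x|).card} with hA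
  have hAm : MeasurableSet A := by
    -- There are finitely many hash configurations `η`, so measurability has to be checked in `r`
    -- only.
    have hA' : A = ⋃ η, ⋃ x, {r' | d - d / 2 ≤ (Finset.univ.filter fun i =>
        r' ∈ {r' | ε < |rowEstimate (η.1 i) (η.2 i) (f r') x - f r' x|}).card} ×ˢ {η} := by
      ext ⟨r', η⟩
      simp only [hA, Set.mem_iUnion, Set.mem_prod, Set.mem_singleton_iff, Set.mem_ofPred_eq]
      constructor
      · rintro ⟨x, hx⟩; exact ⟨η, x, hx, rfl⟩
      · rintro ⟨η, x, hx, rfl⟩; exact ⟨x, hx⟩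
    rw [hA']
    refine .iUnion fun η => .iUnion fun x => MeasurableSet.prod ?_ (measurableSet_singleton η)
    refine measurableSet_card_filter Finset.univ (fun i => ?_) (fun j => d - d / 2 ≤ j)
    refine measurableSet_lt measurable_const (Measurable.abs (Measurable.sub ?_ (hfm x)))
    refine (Finset.measurable_sum _ fun y _ => ?_).const_mul _
    split_ifs
    · exact (hfm y).const_mul _
    · exact measurable_const
  have hfail : ∀ r' ∈ V, P {ω | (r', Y ω) ∈ A} ≤ ENNReal.ofReal (n * Real.exp (-d)) := by
    intro r' hr'
    have hc := hVc hr'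
    have h5 := H.failure_le (f r') (largeHashes p ε keyHash r' D) hε ?_ ?_
    · rw [← ofReal_measureReal]
      exact ENNReal.ofReal_le_ofReal h5
    · refine le_trans ?_ hw
      exact_mod_cast (card_largeHashes_lt (keyHash := keyHash) hc).le
    · rw [sum_compl_largeHashes hinj (φ := fun y => y ^ 2) (by norm_num)]
      refine le_trans (le_of_eq ?_) (hc.2.2.2.trans ?_)
      · refine Finset.sum_congr rfl fun x hx => ?_
        rw [Real.rpow_two, transformed, coe_nnnorm, Real.norm_eq_abs, sq_abs]
      · rw [Real.rpow_two]
        exact mul_le_mul_of_nonneg_right hwL (sq_nonneg ε)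
  have hbad := measure_le_of_indepFun hXm hYm hind hV hAm hfail
  have hVm : MeasurableSet {ω | X ω ∈ V} := hXm hV
  have hZm : MeasurableSet {ω | (X ω, Y ω) ∈ A} := (hXm.prodMk hYm) hAm
  refine ⟨{ω | X ω ∈ V} \ {ω | (X ω, Y ω) ∈ A}, hVm.diff hZm, Set.sdiff_subset,
    fun ω hω => ?_, ?_⟩
  · refine isExactSample_countSketch hk hinj h₁ h₂ (hVc hω.1) fun x => ?_
    by_contra hge
    exact hω.2 ⟨x, by convert not_lt.1 hge⟩
  · have h6 := measureReal_sdiff_add_inter (μ := P) (s := {ω | X ω ∈ V}) hZm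
    have h7 : P.real ({ω | X ω ∈ V} ∩ {ω | (X ω, Y ω) ∈ A}) ≤
        n * Real.exp (-d) * P.real {ω | X ω ∈ V} := by
      have := ENNReal.toReal_mono
        (ENNReal.mul_ne_top ENNReal.ofReal_ne_top (measure_ne_top _ _)) hbad
      rwa [ENNReal.toReal_mul, ENNReal.toReal_ofReal (by positivity)] at this
    linarith

end CountSketchSuccess

/-! ### Sketch sizes -/

section Sizes

variable {p q : ℝ} {n k : ℕ}

theorem residualBound_nonneg (hp : 0 < p) (hpq : p ≤ q) (n : ℕ) : 0 ≤ residualBound p q n := by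
  unfold residualBound
  have := Real.log_natCast_nonneg n
  have : 0 ≤ q / (q - p) := div_nonneg (hp.le.trans hpq) (sub_nonneg.2 hpq)
  split_ifs <;> positivity

/-- The width of the sketches is `k + 1` times this factor. -/
noncomputable def widthFactor (p q : ℝ) (n : ℕ) : ℝ :=
  2 * Real.exp 4 * (600 + 16 * residualBound p q n)

/-- The constant in the bound for the width of the sketches. -/
noncomputable def widthConstant (p q : ℝ) : ℝ :=
  2 * Real.exp 4 * (600 + 16 * (32 * (q / (q - p)) + 1)) + 5664 * Real.exp 4

theorem one_le_widthFactor (hp : 0 < p) (hpq : p ≤ q) (n : ℕ) : 1 ≤ widthFactor p q n := by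
  have h1 := residualBound_nonneg hp hpq n
  have h2 := Real.add_one_le_exp (4 : ℝ)
  unfold widthFactor
  nlinarith

theorem widthConstant_nonneg (hp : 0 < p) (hpq : p ≤ q) : 0 ≤ widthConstant p q := by
  have : 0 ≤ q / (q - p) := div_nonneg (hp.le.trans hpq) (sub_nonneg.2 hpq)
  unfold widthConstant
  positivity

theorem widthFactor_le_of_lt (h : p < q) (n : ℕ) : widthFactor p q n ≤ widthConstant p q := by
  have := Real.exp_pos 4
  rw [widthFactor, residualBound, if_pos h, widthConstant]
  linarith

theorem one_le_two_mul_log (hn : 2 ≤ n) : 1 ≤ 2 * Real.log n := by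
  have h1 : Real.log 2 ≤ Real.log n := Real.log_le_log two_pos (by exact_mod_cast hn)
  linarith [Real.log_two_gt_d9]

theorem widthFactor_le_of_eq (h : p = q) (hn : 2 ≤ n) :
    widthFactor p q n ≤ widthConstant p q * Real.log n := by
  have h0 := Real.exp_pos 4
  have h1 := one_le_two_mul_log hn
  -- For `p = q` the quotient `q / (q - p)` in `widthConstant` is 0 by convention, and its last
  -- summand `2 * 2832 * exp 4` takes over. The number is `2 * 1160 + 512`, from `1 ≤ 2 log n`.
  rw [widthFactor, residualBound, if_neg h.not_lt, widthConstant, h, sub_self, div_zero]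
  have h2 : 600 + 16 * (32 * (1 + Real.log n) + 3) ≤ 2832 * Real.log n := by linarith
  have h3 := mul_le_mul_of_nonneg_left h2 (by positivity : 0 ≤ 2 * Real.exp 4)
  have h4 : 0 ≤ Real.log n * Real.exp 4 := by
    have : 0 ≤ Real.log n := by linarith
    positivity
  linarith

theorem le_sketchWidth {K : ℝ} :
    ((k : ℝ) + 1) * K ≤ sketchWidth 1 (k + 1) (1 / K) := by
  refine le_trans (le_of_eq ?_) (Nat.le_ceil _)
  push_cast
  rw [one_mul, one_div, div_inv_eq_mul]

/-- Both `(k + 1) K ≤ 2 k K` and the 1 lost by rounding up are paid by `1 ≤ k` and `1 ≤ K`. -/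
theorem sketchWidth_le {K : ℝ} (hK : 1 ≤ K) (hk : 1 ≤ k) :
    (sketchWidth 1 (k + 1) (1 / K) : ℝ) ≤ 3 * (k * K) := by
  have hk' : (1 : ℝ) ≤ k := by exact_mod_cast hk
  refine (Nat.ceil_lt_add_one (by positivity)).le.trans ?_
  push_cast
  rw [one_mul, one_div, div_inv_eq_mul]
  nlinarith

theorem log_div_rpow {c : ℝ} (hn : 2 ≤ n) :
    Real.log (n / (n : ℝ) ^ (-c)) = (1 + c) * Real.log n := by
  have hn' : (0 : ℝ) < n := by positivity
  rw [Real.log_div hn'.ne' (Real.rpow_pos_of_pos hn' _).ne', Real.log_rpow hn']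
  ring

theorem sketchDepth_le {c : ℝ} (hc : 0 < c) (hn : 2 ≤ n) :
    (sketchDepth 1 n ((n : ℝ) ^ (-c)) : ℝ) ≤ (3 + c) * Real.log n := by
  have h1 := one_le_two_mul_log hn
  unfold sketchDepth
  rw [log_div_rpow hn, one_mul]
  refine (Nat.ceil_lt_add_one (mul_nonneg (by linarith) (by linarith))).le.trans ?_
  linarith

/-- The depth is at least `(1 + c) log n`; the 1 pays for the union bound over the `n` hashes. -/
theorem mul_exp_neg_sketchDepth_le {c : ℝ} (hn : 2 ≤ n) :
    n * Real.exp (-(sketchDepth 1 n ((n : ℝ) ^ (-c)) : ℝ)) ≤ (n : ℝ) ^ (-c) := by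
  have hn' : (0 : ℝ) < n := by positivity
  have h1 : (1 + c) * Real.log n ≤ sketchDepth 1 n ((n : ℝ) ^ (-c)) := by
    refine le_trans (le_of_eq ?_) (Nat.le_ceil _)
    rw [log_div_rpow hn, one_mul]
  calc n * Real.exp (-(sketchDepth 1 n ((n : ℝ) ^ (-c)) : ℝ))
      ≤ n * Real.exp (-((1 + c) * Real.log n)) := by gcongr
    _ = Real.exp (Real.log n) * Real.exp (-((1 + c) * Real.log n)) := by rw [Real.exp_log hn']
    _ = (n : ℝ) ^ (-c) := by
      rw [← Real.exp_add, Real.rpow_def_of_pos hn']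
      congr 1
      ring

variable {κ σ : Type*} [LinearOrder κ] (R : FrequencySketch n σ) (keyHash : κ → Fin n)
  (r : κ → ℝ) (a₁ a₂ : Aggregation κ)

theorem twoPassKeyStrings_le (p : ℝ) (m : ℕ) :
    twoPassKeyStrings R p m keyHash r a₁ a₂ ≤ m :=
  card_keys_topSketch_run_le _ _ _

theorem twoPassWords_le (p : ℝ) (m : ℕ) :
    twoPassWords R p m keyHash r a₁ a₂ ≤ R.words (passOne R p keyHash r a₁) + 2 * m :=
  Nat.add_le_add_left (Nat.mul_le_mul_left 2 (card_keys_topSketch_run_le _ _ _)) _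

end Sizes

end WORp

/-! ### The theorem -/

theorem theorem2 :
    -- universal constants: the sketch constants `A₁`, `A₂`, and the factor `B` of the second pass
    ∃ (A₁ A₂ : ℝ) (B : ℕ), 0 < A₁ ∧ 0 < A₂ ∧ 0 < B ∧
    -- signed data, `CountSketch`, `0 < p ≤ 2`, for every exponent `c` of `1 / poly(n)`
    (∀ p : ℝ, 0 < p → p ≤ 2 → ∃ ψ : ℕ → ℕ → ℝ, (∀ n k, 0 < ψ n k) ∧
      ∀ c : ℝ, 0 < c → ∃ C : ℝ, ∀ n k : ℕ, 2 ≤ n → 1 ≤ k →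
      ∀ d w : ℕ, d = WORp.sketchDepth A₂ n ((n : ℝ) ^ (-c)) →
        w = WORp.sketchWidth A₁ (k + 1) (ψ n k) →
      ∀ (κ : Type*) [LinearOrder κ] (keyHash : κ → Fin n),
        -- sketch sizes, at all stages of all aggregations
        (∀ (h : Fin d → Fin n → Fin w) (s : Fin d → Fin n → Bool) (r : κ → ℝ)
            (a₁ a₂ : WORp.Aggregation κ),
          (p < 2 → (WORp.twoPassWords (WORp.countSketch d w h s) p (B * k) keyHash r a₁ a₂ : ℝ)
              ≤ C * k * Real.log n) ∧
          (p = 2 → (WORp.twoPassWords (WORp.countSketch d w h s) p (B * k) keyHash r a₁ a₂ : ℝ)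
              ≤ C * k * Real.log n ^ 2) ∧
          (WORp.twoPassKeyStrings (WORp.countSketch d w h s) p (B * k) keyHash r a₁ a₂ : ℝ)
              ≤ C * k) ∧
        -- success probability
        (∀ (D : Multiset (WORp.DataElement κ)) (a₁ a₂ : WORp.Aggregation κ),
          Set.InjOn keyHash (WORp.keys D) → a₁.dataset = D → a₂.dataset = D →
          ∀ (Ω : Type*) [MeasurableSpace Ω] (P : MeasureTheory.Measure Ω)
            [MeasureTheory.IsProbabilityMeasure P] (r : κ → Ω → ℝ)
            (h : Fin d → Fin n → Ω → Fin w) (s : Fin d → Fin n → Ω → Bool),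
            WORp.IsExpHash P r → WORp.IsCountSketchHash P h s →
            ProbabilityTheory.IndepFun (fun ω x => r x ω)
              (fun ω => ((fun i x => h i x ω), (fun i x => s i x ω))) P →
            WORp.SucceedsWithProb P ((1 - (n : ℝ) ^ (-c)) * (1 - 3 * Real.exp (-(k : ℝ))))
              (fun ω => WORp.countSketch d w (fun i x => h i x ω) (fun i x => s i x ω))
              p k (B * k) keyHash r D a₁ a₂)) ∧
    -- positive data, `Counters`, `0 < p ≤ 1`
    (∀ p : ℝ, 0 < p → p ≤ 1 → ∃ ψ : ℕ → ℕ → ℝ, (∀ n k, 0 < ψ n k) ∧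
      ∃ C : ℝ, ∀ n k : ℕ, 2 ≤ n → 1 ≤ k →
      ∀ m : ℕ, m = WORp.sketchWidth A₁ (k + 1) (ψ n k) →
      ∀ (κ : Type*) [LinearOrder κ] (keyHash : κ → Fin n),
        -- sketch sizes, at all stages of all aggregations
        (∀ (r : κ → ℝ) (a₁ a₂ : WORp.Aggregation κ),
          (p < 1 → (WORp.twoPassWords (WORp.counters n m) p (B * k) keyHash r a₁ a₂ : ℝ)
              ≤ C * k) ∧
          (p = 1 → (WORp.twoPassWords (WORp.counters n m) p (B * k) keyHash r a₁ a₂ : ℝ)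
              ≤ C * k * Real.log n) ∧
          (WORp.twoPassKeyStrings (WORp.counters n m) p (B * k) keyHash r a₁ a₂ : ℝ)
              ≤ C * k) ∧
        -- success probability
        (∀ (D : Multiset (WORp.DataElement κ)) (a₁ a₂ : WORp.Aggregation κ),
          (∀ e ∈ D, 0 < e.val) →
          Set.InjOn keyHash (WORp.keys D) → a₁.dataset = D → a₂.dataset = D →
          ∀ (Ω : Type*) [MeasurableSpace Ω] (P : MeasureTheory.Measure Ω)
            [MeasureTheory.IsProbabilityMeasure P] (r : κ → Ω → ℝ),
            WORp.IsExpHash P r →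
            WORp.SucceedsWithProb P (1 - 3 * Real.exp (-(k : ℝ)))
              (fun _ => WORp.counters n m) p k (B * k) keyHash r D a₁ a₂)) := by
  open WORp in
  -- All constants of the width are put into `ψ`, the inverse of `widthFactor`, so `A₁ = A₂ = 1`;
  -- 600 is the bound on large keys in `concentrated`.
  refine ⟨1, 1, 600, one_pos, one_pos, by norm_num, fun p hp hp2 => ?_, fun p hp hp1 => ?_⟩
  · have hK1 := one_le_widthFactor hp hp2
    have hC0 := widthConstant_nonneg hp hp2
    refine ⟨fun n _ => 1 / widthFactor p 2 n,
      fun n _ => one_div_pos.2 (zero_lt_one.trans_le (hK1 n)), fun c hc =>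
      -- The first term bounds the table. For the `1200 k` words of the second pass, `1 ≤ 2 log n`
      -- gives `2400 k log n` if `p < 2`, and its square gives `4800 k log² n` if `p = 2`.
      ⟨3 * ((3 + c) * widthConstant p 2) + 4800, ?_⟩⟩
    intro n k hn hk d w hd hw κ _ keyHash
    have hk' : (1 : ℝ) ≤ k := by exact_mod_cast hk
    have hlog := one_le_two_mul_log hn
    have hwle : (w : ℝ) ≤ 3 * (k * widthFactor p 2 n) := hw ▸ sketchWidth_le (hK1 n) hk
    have hwge : ((k : ℝ) + 1) * widthFactor p 2 n ≤ w := hw ▸ le_sketchWidth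
    have hdle : (d : ℝ) ≤ (3 + c) * Real.log n := hd ▸ sketchDepth_le hc hn
    have hl0 : 0 ≤ Real.log n := by linarith
    refine ⟨fun h s r a₁ a₂ => ?_, ?_⟩
    · have hwords : (twoPassWords (countSketch d w h s) p (600 * k) keyHash r a₁ a₂ : ℝ) ≤
          d * w + 1200 * k := by
        have : twoPassWords (countSketch d w h s) p (600 * k) keyHash r a₁ a₂ ≤
          d * w + 2 * (600 * k) := twoPassWords_le _ _ _ _ _ _ _
        refine (Nat.cast_le.2 this).trans_eq ?_
        push_cast; ring
      have hdw : (d : ℝ) * w ≤ (3 + c) * Real.log n * (3 * (k * widthFactor p 2 n)) := by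
        gcongr
      refine ⟨fun hlt => ?_, fun heq => ?_, ?_⟩
      · have h1 : (3 + c) * Real.log n * (3 * (k * widthFactor p 2 n)) ≤
            (3 + c) * Real.log n * (3 * (k * widthConstant p 2)) := by
          gcongr
          exact widthFactor_le_of_lt hlt n
        have h2 : (k : ℝ) * 1 ≤ k * (2 * Real.log n) := by gcongr
        nlinarith
      · have h1 : (3 + c) * Real.log n * (3 * (k * widthFactor p 2 n)) ≤
            (3 + c) * Real.log n * (3 * (k * (widthConstant p 2 * Real.log n))) := by
          gcongr
          exact widthFactor_le_of_eq heq hn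
        have h2 : (k : ℝ) * 1 ^ 2 ≤ k * (2 * Real.log n) ^ 2 := by gcongr
        nlinarith
      · have h1 : (twoPassKeyStrings (countSketch d w h s) p (600 * k) keyHash r a₁ a₂ : ℝ) ≤
            600 * k := by
          exact_mod_cast twoPassKeyStrings_le (countSketch d w h s) keyHash r a₁ a₂ p (600 * k)
        refine h1.trans (mul_le_mul_of_nonneg_right ?_ (by positivity))
        have : 0 ≤ (3 + c) * widthConstant p 2 := by positivity
        linarith
    · intro D a₁ a₂ hinj h₁ h₂ Ω _ P _ r h s hr H hind
      have hDn : (keys D).card ≤ n := by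
        simpa using Finset.card_le_card_of_injOn keyHash (t := Finset.univ)
          (fun _ _ => Finset.mem_coe.2 (Finset.mem_univ _)) hinj
      have hn1 : (1 : ℝ) ≤ n := by exact_mod_cast one_le_two.trans hn
      have hδ : (n : ℝ) ^ (-c) ≤ 1 := Real.rpow_le_one_of_one_le_of_nonpos hn1 (by linarith)
      have hδ' : n * Real.exp (-(d : ℝ)) ≤ (n : ℝ) ^ (-c) := hd ▸ mul_exp_neg_sketchDepth_le hn
      have hres := residualBound_nonneg hp hp2 n
      -- The factor `2 exp 4` of the width cancels `exp (-4) / 2`; what remains covers both the `600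
      -- k` large hashes and the residual.
      have hw' : ((k : ℝ) + 1) * (600 + 16 * residualBound p 2 n) ≤
          w * (Real.exp (-4) / 2) := by
        have h1 := mul_le_mul_of_nonneg_right hwge (by positivity : 0 ≤ Real.exp (-4) / 2)
        have h2 : Real.exp 4 * Real.exp (-4) = 1 := by rw [← Real.exp_add]; simp
        refine le_trans (le_of_eq ?_) h1
        rw [widthFactor]
        linear_combination
          (-((k : ℝ) + 1) * (600 + 16 * residualBound p 2 n)) * h2
      refine succeedsWithProb_of_concentrated hr hp hp2 le_rfl (by omega) hDn hk (by linarith)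
        fun ε hε V hVc hV => ?_
      obtain ⟨S, hSm, hSV, hSs, hSP⟩ := exists_countSketch_success (a₁ := a₁) (a₂ := a₂) hr H hind
        hk hinj h₁ h₂ hε (by nlinarith) (by nlinarith) hVc hV
      exact ⟨S, hSm, hSV, hSs,
        (mul_le_mul_of_nonneg_right (by linarith) measureReal_nonneg).trans hSP⟩
  · have hK1 := one_le_widthFactor hp hp1
    have hC0 := widthConstant_nonneg hp hp1
    refine ⟨fun n _ => 1 / widthFactor p 1 n,
      fun n _ => one_div_pos.2 (zero_lt_one.trans_le (hK1 n)),
      6 * widthConstant p 1 + 2400, ?_⟩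
    intro n k hn hk m hm κ _ keyHash
    have hk' : (1 : ℝ) ≤ k := by exact_mod_cast hk
    have hlog := one_le_two_mul_log hn
    have hmle : (m : ℝ) ≤ 3 * (k * widthFactor p 1 n) := hm ▸ sketchWidth_le (hK1 n) hk
    have hmge : ((k : ℝ) + 1) * widthFactor p 1 n ≤ m := hm ▸ le_sketchWidth
    refine ⟨fun r a₁ a₂ => ?_, ?_⟩
    · have hwords : (twoPassWords (counters n m) p (600 * k) keyHash r a₁ a₂ : ℝ) ≤
          2 * m + 1200 * k := by
        have : twoPassWords (counters n m) p (600 * k) keyHash r a₁ a₂ ≤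
          2 * m + 2 * (600 * k) := (twoPassWords_le _ _ _ _ _ _ _).trans
            (Nat.add_le_add_right (counters_words_run_le _) _)
        refine (Nat.cast_le.2 this).trans_eq ?_
        push_cast; ring
      refine ⟨fun hlt => ?_, fun heq => ?_, ?_⟩
      · have h1 : (k : ℝ) * widthFactor p 1 n ≤ k * widthConstant p 1 := by
          gcongr
          exact widthFactor_le_of_lt hlt n
        nlinarith
      · have h1 : (k : ℝ) * widthFactor p 1 n ≤ k * (widthConstant p 1 * Real.log n) := by
          gcongr
          exact widthFactor_le_of_eq heq hn
        have h2 : (k : ℝ) * 1 ≤ k * (2 * Real.log n) := by gcongr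
        nlinarith
      · have h1 : (twoPassKeyStrings (counters n m) p (600 * k) keyHash r a₁ a₂ : ℝ) ≤
            600 * k := by
          exact_mod_cast twoPassKeyStrings_le (counters n m) keyHash r a₁ a₂ p (600 * k)
        refine h1.trans (mul_le_mul_of_nonneg_right ?_ (by positivity))
        linarith
    · intro D a₁ a₂ hD hinj h₁ h₂ Ω _ P _ r hr
      have hDn : (keys D).card ≤ n := by
        simpa using Finset.card_le_card_of_injOn keyHash (t := Finset.univ)
          (fun _ _ => Finset.mem_coe.2 (Finset.mem_univ _)) hinj
      have hres := residualBound_nonneg hp hp1 n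
      have hm' : 600 * (k : ℝ) + 16 * (residualBound p 1 n * k) ≤ m := by
        refine le_trans ?_ hmge
        have he := Real.add_one_le_exp (4 : ℝ)
        have h0 : 0 ≤ 600 + 16 * residualBound p 1 n := by linarith
        have h1 : (600 + 16 * residualBound p 1 n) * 1 ≤ widthFactor p 1 n := by
          rw [widthFactor, mul_comm (2 * Real.exp 4)]
          gcongr
          linarith
        nlinarith
      -- Counters is deterministic, so it succeeds on the whole concentration event: `γ = 1`.
      rw [← one_mul (1 - 3 * Real.exp (-(k : ℝ)))]
      refine succeedsWithProb_of_concentrated hr hp hp1 one_le_two (by omega) hDn hk zero_le_one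
        fun ε hε V hVc hV => ⟨{ω | (fun x => r x ω) ∈ V}, hr.measurable_fun hV, subset_rfl,
          fun ω hω => ?_, by rw [one_mul]⟩
      exact isExactSample_counters hk hD hinj h₁ h₂ hε hm' (by positivity) (hVc hω)
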